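/- **Conventions.** All vertex sets are finite. For a tuple $e\in V^m$, write $\mathrm{mult}(v,e)$ for the number of entries of $e$ equal to $v$; $e$ is one-to-one if its entries are distinct. An $m$-digraph $H$ consists of a finite vertex set $V(H)$ and an edge set $E(H)\subseteq V(H)^m$ (so edges may have repeated vertices). For $S\subseteq V(H)$, the induced $m$-digraph $H[S]$ has vertex set $S$ and all edges of $H$ with entries in $S$. A perfect matching of $H$ is a set of one-to-one edges such that every vertex of $H$ lies in exactly one of them. *Fissility.* Let $\mathcal B=\{B_1,\dots,B_\ell\}$ be a family of pairwise disjoint subsets of $V(H)$ with $|B_1|+\dots+|B_\ell|=m$. A tuple $B\in\mathcal B^m$ is suitable if each $B_i$ occurs exactly $|B_i|$ times in $B$, and $E(H)$ contains every tuple $e\in B(1)\times\dots\times B(m)$ satisfying $e(i)=e(j)$ whenever $B(i)=B(j)$. $H$ is fissile if for every such family $\mathcal B$ and every suitable $B$ there is a one-to-one edge of $H$ whose vertices cover all sets in $B$. *Properties.* $\mathrm{Spa}$ is the set of $m$-digraphs $H$ with a perfect fractional matching, that is, a function $\omega\colon E(H)\to[0,1]$ with $\sum_{e\in E(H)}\omega(e)\,\mathrm{mult}(v,e)\le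 1$ for every $v\in V(H)$ and $\sum_{e\in E(H)}\omega(e)\ge |V(H)|/m$. $\mathrm{Div}$ is the set of $m$-digraphs $H$ such that the additive subgroup of $\mathbb Z^{V(H)}$ generated by the vectors $(\mathrm{mult}(v,e))_{v\in V(H)}$ with $e\in E(H)$ contains $\mathbf 1_v-\mathbf 1_u$ for all $u,v\in V(H)$, where $\mathbf 1_v$ is the unit vector at $v$. $\mathrm{Cov}$ is the set of $m$-digraphs $H$ such that every $v\in V(H)$ has $\mathrm{mult}(v,e)=1$ for some $e\in E(H)$. *Property graph and threshold.* An $s$-graph is an $s$-uniform hypergraph; $\delta_1(P)$ denotes the minimum vertex degree of $P$, the largest $\ell$ such that every vertex of $P$ lies in at least $\ell$ edges. For a family $\mathcal P$ of $m$-digraphs, the property $s$-graph $P^{(s)}(H,\mathcal P)$ has vertex set $V(H)$, and its edges are the $s$-sets $S\subseteq V(H)$ with $H[S]\in\mathcal P$. Let $\delta_1(\mathrm{Mat}_s)$ be the infimum of all $\delta\in[0,1]$ such that for every $\mu>0$ and all sufficiently large $n$ divisible by $s$, every $n$-vertex $s$-graph $P$ with $\delta_1(P)\ge(\delta+\mu)\binom{n-1}{s-1}$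 has a perfect matching (a set of disjoint edges covering all vertices). **Theorem.** For all integers $2\le m\le s$ and every $\mu>0$, there is $n_0>0$ such that the following holds for every $n\ge n_0$ divisible by $m$. Let $H$ be a fissile $m$-digraph on $n$ vertices with $$\delta_1\big(P^{(s)}(H,\ \mathrm{Spa}\cap\mathrm{Div}\cap\mathrm{Cov})\big)\ \ge\ \big(\delta_1(\mathrm{Mat}_s)+\mu\big)\binom{n-1}{s-1}.$$ Then $H$ has a perfect matching. -/

import Mathlib

open Finset

/-- A finite `s`-uniform hypergraph (`s`-graph) whose vertices are taken from the type `V`. -/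
structure UniformGraph (s : ℕ) (V : Type*) where
  vertices : Finset V
  edges : Finset (Finset V)
  edge_subset : ∀ S ∈ edges, S ⊆ vertices
  edge_card : ∀ S ∈ edges, S.card = s

namespace UniformGraph

variable {s : ℕ} {V : Type*}

/-- The number of edges of `P` that contain the set `D`. -/
def degree [DecidableEq V] (P : UniformGraph s V) (D : Finset V) : ℕ :=
  (P.edges.filter (fun S => D ⊆ S)).card

/-- The minimum `d`-degree: the largest `l` such that every `d`-set of vertices is contained in
at least `l` edges. -/
noncomputable def minDegree [DecidableEq V] (d : ℕ) (P : UniformGraph s V) : ℕ :=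
  sSup {l : ℕ | ∀ D : Finset V, D ⊆ P.vertices → D.card = d → l ≤ P.degree D}

/-- `P` has a perfect matching: a set of pairwise disjoint edges covering all vertices. -/
def HasPerfectMatching (P : UniformGraph s V) : Prop :=
  ∃ M : Finset (Finset V), M ⊆ P.edges ∧
    (∀ S ∈ M, ∀ T ∈ M, S ≠ T → Disjoint S T) ∧
    ∀ v ∈ P.vertices, ∃ S ∈ M, v ∈ S

end UniformGraph

/-- The minimum vertex degree threshold for perfect matchings in `s`-graphs. -/
noncomputable def matchingThreshold (s : ℕ) : ℝ :=
  sInf {δ : ℝ | δ ∈ Set.Icc (0 : ℝ) 1 ∧ ∀ μ : ℝ, 0 < μ → ∃ n₀ : ℕ, ∀ n : ℕ, n₀ ≤ n → s ∣ n →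
    ∀ (V : Type) [DecidableEq V] (P : UniformGraph s V), P.vertices.card = n →
      (δ + μ) * ((n - 1).choose (s - 1) : ℝ) ≤ (P.minDegree 1 : ℝ) → P.HasPerfectMatching}

/-- The multiplicity of `v` in the tuple `e`. -/
def tupleMult {m : ℕ} {V : Type*} [DecidableEq V] (v : V) (e : Fin m → V) : ℕ :=
  (univ.filter (fun i => e i = v)).card

/-- A finite `m`-uniform directed hypergraph (`m`-digraph) whose vertices are taken from the
type `V`. Edges are `m`-tuples of vertices, and may contain repeated vertices. -/
structure MDigraph (m : ℕ) (V : Type*) where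
  vertices : Finset V
  edges : Finset (Fin m → V)
  edge_mem : ∀ e ∈ edges, ∀ i, e i ∈ vertices

namespace MDigraph

variable {m : ℕ} {V : Type*}

/-- The induced `m`-digraph `H[S]`, consisting of all edges of `H` with entries in `S`. -/
def induce [DecidableEq V] (H : MDigraph m V) (S : Finset V) : MDigraph m V where
  vertices := H.vertices ∩ S
  edges := H.edges.filter (fun e => ∀ i, e i ∈ S)
  edge_mem := by
    intro e he i
    rw [Finset.mem_filter] at he
    exact Finset.mem_inter.2 ⟨H.edge_mem e he.1 i, he.2 i⟩

/-- A matching in `H`: a set of one-to-one edges such that no vertex is covered twice. -/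
def IsMatching (H : MDigraph m V) (M : Finset (Fin m → V)) : Prop :=
  M ⊆ H.edges ∧ (∀ e ∈ M, Function.Injective e) ∧
    ∀ e ∈ M, ∀ f ∈ M, e ≠ f → ∀ i j, e i ≠ f j

/-- A matching of `H` is perfect if it covers every vertex of `H`. -/
def HasPerfectMatching (H : MDigraph m V) : Prop :=
  ∃ M : Finset (Fin m → V), H.IsMatching M ∧ ∀ v ∈ H.vertices, ∃ e ∈ M, ∃ i, e i = v

/-- Given a family `𝓑` of pairwise disjoint sets of vertices whose sizes add up to `m`, the
`m`-tuple `B` of members of `𝓑` is suitable if each member of `𝓑` occurs in `B` as often as it has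
elements, and `H` has as an edge each tuple that picks one vertex from each entry of `B`, with the
same choice for equal entries. -/
def IsSuitable [DecidableEq V] (H : MDigraph m V) (𝓑 : Finset (Finset V))
    (B : Fin m → Finset V) : Prop :=
  (∀ X ∈ 𝓑, X ⊆ H.vertices) ∧
  (∀ X ∈ 𝓑, ∀ Y ∈ 𝓑, X ≠ Y → Disjoint X Y) ∧
  ∑ X ∈ 𝓑, X.card = m ∧
  (∀ i, B i ∈ 𝓑) ∧
  (∀ X ∈ 𝓑, X.card = tupleMult X B) ∧
  ∀ e : Fin m → V, (∀ i, e i ∈ B i) → (∀ i j, B i = B j → e i = e j) → e ∈ H.edges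

/-- `H` is fissile if for every suitable tuple `B` there is a one-to-one edge of `H` whose vertices
cover the sets of `B`. -/
def IsFissile [DecidableEq V] (H : MDigraph m V) : Prop :=
  ∀ (𝓑 : Finset (Finset V)) (B : Fin m → Finset V), H.IsSuitable 𝓑 B →
    ∃ e ∈ H.edges, Function.Injective e ∧ ∀ i, ∀ v ∈ B i, ∃ j, e j = v

/-- `ω` is a fractional matching in `H`; only its values on edges of `H` matter. -/
def IsFractionalMatching [DecidableEq V] (H : MDigraph m V) (ω : (Fin m → V) → ℝ) : Prop :=
  (∀ e ∈ H.edges, 0 ≤ ω e ∧ ω e ≤ 1) ∧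
    ∀ v ∈ H.vertices, ∑ e ∈ H.edges, ω e * (tupleMult v e : ℝ) ≤ 1

/-- The `m`-digraphs with a `ρ`-perfect fractional matching. -/
def RhoSpa (m : ℕ) (V : Type*) [DecidableEq V] (ρ : ℝ) : Set (MDigraph m V) :=
  {H | ∃ ω : (Fin m → V) → ℝ, H.IsFractionalMatching ω ∧
    (1 - ρ) * (H.vertices.card : ℝ) / (m : ℝ) ≤ ∑ e ∈ H.edges, ω e}

/-- The space property: `m`-digraphs with a perfect fractional matching. -/
def Spa (m : ℕ) (V : Type*) [DecidableEq V] : Set (MDigraph m V) := RhoSpa m V 0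

/-- The indicator vector of a tuple, whose value at `v` is the multiplicity of `v`. -/
def indicatorVec [DecidableEq V] (e : Fin m → V) : V → ℤ := fun v => (tupleMult v e : ℤ)

/-- The lattice of `H`, generated by the indicator vectors of the edges. Integer vectors on the
vertex set of `H` are viewed as functions on `V` that vanish outside of it. -/
def lattice [DecidableEq V] (H : MDigraph m V) : AddSubgroup (V → ℤ) :=
  AddSubgroup.closure {x | ∃ e ∈ H.edges, x = indicatorVec e}

/-- The divisibility property: `m`-digraphs whose lattice contains all transferrals. -/
def Div (m : ℕ) (V : Type*) [DecidableEq V] : Set (MDigraph m V) :=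
  {H | ∀ u ∈ H.vertices, ∀ v ∈ H.vertices,
    (Pi.single v 1 - Pi.single u 1 : V → ℤ) ∈ H.lattice}

/-- The cover property: every vertex has multiplicity one in some edge. -/
def Cov (m : ℕ) (V : Type*) [DecidableEq V] : Set (MDigraph m V) :=
  {H | ∀ v ∈ H.vertices, ∃ e ∈ H.edges, tupleMult v e = 1}

open Classical in
/-- The property `s`-graph of `H` for the family `𝓟`: its edges are the `s`-sets `S` of vertices
such that the induced `m`-digraph `H[S]` belongs to `𝓟`. -/
noncomputable def propertyGraph [DecidableEq V] (H : MDigraph m V) (𝓟 : Set (MDigraph m V))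
    (s : ℕ) : UniformGraph s V where
  vertices := H.vertices
  edges := (H.vertices.powersetCard s).filter (fun S => H.induce S ∈ 𝓟)
  edge_subset := by
    intro S hS
    exact (Finset.mem_powersetCard.1 (Finset.mem_filter.1 hS).1).1
  edge_card := by
    intro S hS
    exact (Finset.mem_powersetCard.1 (Finset.mem_filter.1 hS).1).2

end MDigraph

-- Write `s = k + 1`. Call a one-to-one `s`-tuple of vertices good if the edges among its entries,
-- read as `m`-tuples of indices, form a pattern with the space, divisibility and cover properties.
-- There are boundedly many patterns, so Erdős's theorem on partite hypergraphs turns a positive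
-- density of good tuples into a blow-up: disjoint sets all of whose transversals realise one good
-- pattern. Inside a blow-up, fissility replaces a pattern edge, even one with repetitions, by a
-- one-to-one edge on prescribed vertices (`IsBlowup.matchable_of_edge`). Hence any set that takes
-- `∑ e, p e * tupleMult i e` vertices from part `i`, with natural numbers `p e`, is exactly covered
-- by a matching. The three properties now have separate roles. Space: a blow-up whose parts all
-- have size `Q` is matchable, with one `Q` for all patterns. Divisibility: a bounded matching can
-- move a residue modulo `M` from one part to another. Cover: a given vertex can be placed in an
-- edge that uses it once. The threshold enters through a reduced structure on clusters, which
-- inherits the degree condition (`exists_degree_isDense`). Replacing clusters by nearly equal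
-- numbers of copies and applying the threshold gives families of dense tuples with prescribed loads
-- (`exists_cover_of_degree`). With constant loads this improves any partial tiling by blow-ups, so
-- iteration covers almost all vertices (`tilingProportion`). To finish, the leftover vertices are
-- covered by a small matching, a few more edges correct the total count modulo `M`, and residues
-- are moved until every cluster has lost a multiple of `M`. The moves need any two clusters to be
-- connected through a third; this follows from the lower bound `2 ^ (-k)` for the threshold, shown
-- by two disjoint cliques. A second use of the reduced structure, with slightly unequal loads,
-- equalises the losses. Every tile then has equal parts of size divisible by `Q`, and the space
-- property completes the matching.

universe u

/-! ### Multiplicities of entries in tuples. -/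

section TupleMult

variable {m : ℕ} {α β : Type*} [DecidableEq α] [DecidableEq β]

theorem tupleMult_comp_of_injective {u : α → β} (hu : Function.Injective u) (i : α)
    (e : Fin m → α) : tupleMult (u i) (u ∘ e) = tupleMult i e := by
  simp [tupleMult, hu.eq_iff]

theorem tupleMult_le (v : α) (e : Fin m → α) : tupleMult v e ≤ m :=
  (card_filter_le _ _).trans (by simp)

theorem sum_tupleMult [Fintype α] (e : Fin m → α) : ∑ i, tupleMult i e = m := by
  have := Finset.card_eq_sum_card_fiberwise (f := e) (s := univ) (t := univ) (by simp)
  simpa [tupleMult] using this.symm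

end TupleMult

/-! ### Good patterns and their integral weights. -/

namespace MDigraph

/-- A set of `m`-tuples over `Fin s` satisfying the space, divisibility and cover conditions, in
coordinates. -/
structure IsGoodPattern {m s : ℕ} (E : Finset (Fin m → Fin s)) : Prop where
  spa : ∃ ω : (Fin m → Fin s) → ℝ, (∀ e ∈ E, 0 ≤ ω e) ∧
    ∀ i, ∑ e ∈ E, ω e * (tupleMult i e : ℝ) = 1
  div : ∀ i j, ∃ c : (Fin m → Fin s) → ℤ, ∀ k, ∑ e ∈ E, c e * (tupleMult k e : ℤ) =
    (if k = i then 1 else 0) - (if k = j then 1 else 0)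
  cov : ∀ i, ∃ e ∈ E, tupleMult i e = 1

variable {m s : ℕ} {V : Type*} [DecidableEq V]

/-- The tuples of indices whose composition with `u` is an edge of `H`. -/
def pattern (H : MDigraph m V) (u : Fin s → V) : Finset (Fin m → Fin s) :=
  univ.filter (fun e => u ∘ e ∈ H.edges)

/-- One-to-one tuples of vertices whose pattern is good. -/
structure IsGoodTuple (H : MDigraph m V) (u : Fin s → V) : Prop where
  inj : Function.Injective u
  mem : ∀ i, u i ∈ H.vertices
  good : IsGoodPattern (H.pattern u)

theorem induce_edges_eq (H : MDigraph m V) (u : Fin s → V) :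
    (H.induce (univ.image u)).edges = (H.pattern u).image (fun e => u ∘ e) := by
  ext f
  simp only [induce, pattern, mem_filter, mem_image, mem_univ, true_and]
  constructor
  · rintro ⟨hf, h⟩
    choose e he using h
    have : u ∘ e = f := funext he
    exact ⟨e, this ▸ hf, this⟩
  · rintro ⟨e, he, rfl⟩
    exact ⟨he, fun i => ⟨e i, rfl⟩⟩

theorem sum_induce_edges (H : MDigraph m V) {u : Fin s → V} (hu : Function.Injective u)
    {R : Type*} [AddCommMonoid R] (f : (Fin m → V) → R) :
    ∑ e ∈ (H.induce (univ.image u)).edges, f e = ∑ e ∈ H.pattern u, f (u ∘ e) := by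
  rw [induce_edges_eq, sum_image]
  intro a _ b _ h
  exact hu.comp_left h

/-- Perfectness forces equality at every vertex: the weighted multiplicities add up to `m` times the
total weight, hence to at least `s`, while each of the `s` vertices receives at most 1. Divisibility
carries over because lattice elements are integer combinations of edges, read back along the
injection `u`. -/
theorem isGoodTuple_of_induce (hm : 0 < m) (H : MDigraph m V) {u : Fin s → V}
    (hu : Function.Injective u) (hmem : ∀ i, u i ∈ H.vertices)
    (h : H.induce (univ.image u) ∈ Spa m V ∩ Div m V ∩ Cov m V) : H.IsGoodTuple u := by
  have hv : (H.induce (univ.image u)).vertices = univ.image u := by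
    simp only [induce]
    refine inter_eq_right.2 ?_
    intro x hx
    obtain ⟨i, _, rfl⟩ := mem_image.1 hx
    exact hmem i
  obtain ⟨⟨hS, hD⟩, hC⟩ := h
  refine ⟨hu, hmem, ?_, ?_, ?_⟩
  · obtain ⟨ω, ⟨h1, h2⟩, h3⟩ := hS
    refine ⟨fun e => ω (u ∘ e), ?_, ?_⟩
    · intro e he
      refine (h1 (u ∘ e) ?_).1
      rw [induce_edges_eq]
      exact mem_image_of_mem _ he
    · have hle : ∀ i ∈ (univ : Finset (Fin s)),
          ∑ e ∈ H.pattern u, ω (u ∘ e) * (tupleMult i e : ℝ) ≤ 1 := by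
        intro i _
        have := h2 (u i) (by rw [hv]; simp)
        rw [sum_induce_edges H hu] at this
        simpa only [tupleMult_comp_of_injective hu] using this
      rw [sum_induce_edges H hu, hv, card_image_of_injective _ hu] at h3
      have hsum : ∑ i : Fin s, ∑ e ∈ H.pattern u, ω (u ∘ e) * (tupleMult i e : ℝ)
          = m * ∑ e ∈ H.pattern u, ω (u ∘ e) := by
        rw [sum_comm, mul_sum]
        refine sum_congr rfl fun e _ => ?_
        rw [← mul_sum, ← Nat.cast_sum, sum_tupleMult, mul_comm]
      have hm' : (0 : ℝ) < m := by exact_mod_cast hm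
      have h4 : (∑ i : Fin s, (1 : ℝ)) ≤
          ∑ i : Fin s, ∑ e ∈ H.pattern u, ω (u ∘ e) * (tupleMult i e : ℝ) := by
        rw [hsum]
        rw [div_le_iff₀ hm'] at h3
        simp at h3 ⊢
        linarith
      have := (sum_eq_sum_iff_of_le hle).1 (le_antisymm (sum_le_sum hle) h4)
      intro i
      exact this i (mem_univ i)
  · have key : ∀ x ∈ (H.induce (univ.image u)).lattice, ∃ c : (Fin m → Fin s) → ℤ,
        ∀ k, ∑ e ∈ H.pattern u, c e * (tupleMult k e : ℤ) = x (u k) := by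
      intro x hx
      refine AddSubgroup.closure_induction (p := fun x _ => ∃ c : (Fin m → Fin s) → ℤ,
        ∀ k, ∑ e ∈ H.pattern u, c e * (tupleMult k e : ℤ) = x (u k)) ?_ ?_ ?_ ?_ hx
      · rintro x ⟨f, hf, rfl⟩
        rw [induce_edges_eq] at hf
        obtain ⟨e, he, rfl⟩ := mem_image.1 hf
        refine ⟨fun e' => if e' = e then 1 else 0, fun k => ?_⟩
        simp [indicatorVec, tupleMult_comp_of_injective hu, he]
      · exact ⟨0, by simp⟩
      · rintro x y _ _ ⟨c, hc⟩ ⟨d, hd⟩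
        refine ⟨c + d, fun k => ?_⟩
        simp only [Pi.add_apply, add_mul, sum_add_distrib, hc, hd]
      · rintro x _ ⟨c, hc⟩
        refine ⟨-c, fun k => ?_⟩
        simp only [Pi.neg_apply, neg_mul, sum_neg_distrib, hc]
    intro i j
    obtain ⟨c, hc⟩ := key _ (hD (u j) (by rw [hv]; simp) (u i) (by rw [hv]; simp))
    refine ⟨c, fun k => ?_⟩
    rw [hc]
    simp [Pi.single_apply, hu.eq_iff]
  · intro i
    obtain ⟨f, hf, h⟩ := hC (u i) (by rw [hv]; simp)
    rw [induce_edges_eq] at hf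
    obtain ⟨e, he, rfl⟩ := mem_image.1 hf
    exact ⟨e, he, by rwa [tupleMult_comp_of_injective hu] at h⟩

/-- Simultaneous rounding: a perfect fractional matching can be scaled to an integral one. -/
theorem IsGoodPattern.exists_nat_weights {E : Finset (Fin m → Fin s)} (hE : IsGoodPattern E) :
    ∃ q : ℕ, 0 < q ∧ ∃ p : (Fin m → Fin s) → ℕ, ∀ i, ∑ e ∈ E, p e * tupleMult i e = q := by
  obtain ⟨ω, h0, h1⟩ := hE.spa
  -- The grid width `1 / T` keeps the total rounding error at a vertex at most `m * E.card / T < 1`.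
  set T : ℕ := m * E.card + 1 with hT
  have hTpos : (0 : ℝ) < T := by positivity
  -- `f n` records the grid cells of the fractional parts of `n * ω e`. There are finitely many cell
  -- patterns, so two multiples `a < b` share one.
  let f : ℕ → (Fin m → Fin s) → Fin T := fun n e =>
    ⟨⌊(T : ℝ) * Int.fract (n * ω e)⌋₊, by
      rw [Nat.floor_lt (by positivity)]
      have := Int.fract_lt_one (n * ω e)
      nlinarith⟩
  obtain ⟨a, b, hab, hf⟩ := Finite.exists_ne_map_eq_of_infinite f
  wlog hlt : a < b generalizing a b
  · exact this b a hab.symm hf.symm (by omega)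
  have hclose : ∀ e, |Int.fract (b * ω e) - Int.fract (a * ω e)| * T < 1 := by
    intro e
    have h := congrArg Fin.val (congrFun hf e)
    simp only [f] at h
    have ha := Nat.floor_le (show 0 ≤ (T : ℝ) * Int.fract (a * ω e) by positivity)
    have hb := Nat.floor_le (show 0 ≤ (T : ℝ) * Int.fract (b * ω e) by positivity)
    have ha' := Nat.lt_floor_add_one ((T : ℝ) * Int.fract (a * ω e))
    have hb' := Nat.lt_floor_add_one ((T : ℝ) * Int.fract (b * ω e))
    rw [h] at ha ha'
    have habs : |Int.fract (b * ω e) - Int.fract (a * ω e)| * T =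
        |(Int.fract (b * ω e) - Int.fract (a * ω e)) * T| := by
      rw [abs_mul, abs_of_pos hTpos]
    rw [habs, abs_lt]
    constructor <;> linarith
  -- The difference of floors equals `(b - a) * ω e` up to the difference of two fractional parts in
  -- the same cell. The resulting vertex sum is an integer at distance less than 1 from the integer
  -- `b - a`.
  refine ⟨b - a, by omega, fun e => (⌊(b : ℝ) * ω e⌋ - ⌊(a : ℝ) * ω e⌋).toNat, fun i => ?_⟩
  have hp : ∀ e ∈ E, (((⌊(b : ℝ) * ω e⌋ - ⌊(a : ℝ) * ω e⌋).toNat : ℕ) : ℤ) =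
      ⌊(b : ℝ) * ω e⌋ - ⌊(a : ℝ) * ω e⌋ := by
    intro e he
    refine Int.toNat_of_nonneg (sub_nonneg.2 (Int.floor_le_floor ?_))
    exact mul_le_mul_of_nonneg_right (by exact_mod_cast hlt.le) (h0 e he)
  have hdiff : (((∑ e ∈ E, (⌊(b : ℝ) * ω e⌋ - ⌊(a : ℝ) * ω e⌋).toNat * tupleMult i e : ℕ) : ℤ) : ℝ)
      - (((b - a : ℕ) : ℤ) : ℝ)
      = ∑ e ∈ E, (Int.fract (a * ω e) - Int.fract (b * ω e)) * (tupleMult i e : ℝ) := by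
    have h2 : (((b - a : ℕ) : ℤ) : ℝ) = ∑ e ∈ E, ((b : ℝ) - a) * ω e * (tupleMult i e : ℝ) := by
      rw [Nat.cast_sub hlt.le]
      simp only [mul_assoc]
      rw [← mul_sum, h1 i]
      push_cast; ring
    rw [h2]
    push_cast
    rw [← sum_sub_distrib]
    refine sum_congr rfl fun e he => ?_
    have h3 : (((⌊(b : ℝ) * ω e⌋ - ⌊(a : ℝ) * ω e⌋).toNat : ℕ) : ℝ) =
      (⌊(b : ℝ) * ω e⌋ : ℝ) - (⌊(a : ℝ) * ω e⌋ : ℝ) := by exact_mod_cast hp e he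
    rw [h3]
    simp only [Int.fract]
    ring
  have habs : |(((∑ e ∈ E, (⌊(b : ℝ) * ω e⌋ - ⌊(a : ℝ) * ω e⌋).toNat * tupleMult i e : ℕ) : ℤ) : ℝ)
      - (((b - a : ℕ) : ℤ) : ℝ)| < 1 := by
    rw [hdiff]
    calc |∑ e ∈ E, (Int.fract (a * ω e) - Int.fract (b * ω e)) * (tupleMult i e : ℝ)|
        ≤ ∑ e ∈ E, |(Int.fract (a * ω e) - Int.fract (b * ω e)) * (tupleMult i e : ℝ)| :=
          abs_sum_le_sum_abs _ _
      _ ≤ ∑ e ∈ E, (1 / T : ℝ) * m := by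
          refine sum_le_sum fun e _ => ?_
          rw [abs_mul, abs_sub_comm, Nat.abs_cast]
          refine mul_le_mul ?_ (by exact_mod_cast tupleMult_le i e) (by positivity) (by positivity)
          rw [le_div_iff₀ hTpos]
          exact (hclose e).le
      _ = (m * E.card) / T := by rw [sum_const, nsmul_eq_mul]; ring
      _ < 1 := by
          rw [div_lt_one hTpos, hT]
          push_cast
          linarith
  have : |((∑ e ∈ E, (⌊(b : ℝ) * ω e⌋ - ⌊(a : ℝ) * ω e⌋).toNat * tupleMult i e : ℕ) : ℤ)
      - ((b - a : ℕ) : ℤ)| < 1 := by exact_mod_cast habs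
  exact_mod_cast sub_eq_zero.1 (Int.abs_lt_one_iff.1 this)

/-- A common multiplier for all good patterns. -/
theorem exists_uniform_nat_weights (m s : ℕ) : ∃ q : ℕ, 0 < q ∧
    ∀ E : Finset (Fin m → Fin s), IsGoodPattern E →
      ∃ p : (Fin m → Fin s) → ℕ, ∀ i, ∑ e ∈ E, p e * tupleMult i e = q := by
  classical
  have h : ∀ E : Finset (Fin m → Fin s), ∃ q : ℕ, 0 < q ∧ (IsGoodPattern E →
      ∃ p : (Fin m → Fin s) → ℕ, ∀ i, ∑ e ∈ E, p e * tupleMult i e = q) := by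
    intro E
    by_cases hE : IsGoodPattern E
    · obtain ⟨q, hq, h⟩ := hE.exists_nat_weights
      exact ⟨q, hq, fun _ => h⟩
    · exact ⟨1, one_pos, fun h => absurd h hE⟩
  choose q hq hp using h
  -- The product is a common multiple of all the individual multipliers; patterns that are not good
  -- contribute the factor 1.
  refine ⟨∏ E, q E, prod_pos fun E _ => hq E, fun E hE => ?_⟩
  obtain ⟨p, hp⟩ := hp E hE
  obtain ⟨r, hr⟩ := dvd_prod_of_mem q (mem_univ E)
  refine ⟨fun e => r * p e, fun i => ?_⟩
  simp only [mul_assoc]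
  rw [← mul_sum, hp, hr, mul_comm]

/-- Transfers modulo `M` with bounded nonnegative coefficients. -/
theorem IsGoodPattern.exists_residue_weights {E : Finset (Fin m → Fin s)} (hE : IsGoodPattern E)
    {M : ℕ} (hM : 0 < M) (r : ℤ) (i j : Fin s) :
    ∃ p : (Fin m → Fin s) → ℕ, ∀ k,
      ∑ e ∈ E, p e * tupleMult k e ≤ s ^ m * (M * m) ∧
      ((∑ e ∈ E, p e * tupleMult k e : ℕ) : ℤ) ≡
        r * ((if k = i then 1 else 0) - (if k = j then 1 else 0)) [ZMOD M] := by
  obtain ⟨c, hc⟩ := hE.div i j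
  have hM' : (0 : ℤ) < M := by exact_mod_cast hM
  have hp : ∀ e, (((r * c e % M).toNat : ℕ) : ℤ) = r * c e % M := fun e =>
    Int.toNat_of_nonneg (Int.emod_nonneg _ hM'.ne')
  -- The coefficients `c` may be negative and are not bounded. Their residues in `[0, M)`, after
  -- scaling by `r`, give the same sums modulo `M`, and there are at most `s ^ m` of them.
  refine ⟨fun e => (r * c e % M).toNat, fun k => ⟨?_, ?_⟩⟩
  · calc ∑ e ∈ E, (r * c e % M).toNat * tupleMult k e ≤ ∑ e ∈ E, M * m := by
          refine sum_le_sum fun e _ => Nat.mul_le_mul ?_ (tupleMult_le _ _)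
          have := Int.emod_lt_of_pos (r * c e) hM'
          have := hp e
          omega
      _ ≤ s ^ m * (M * m) := by
          rw [sum_const, smul_eq_mul]
          refine Nat.mul_le_mul_right _ ((card_le_univ _).trans ?_)
          simp
  · rw [← hc k, mul_sum]
    push_cast
    refine Int.ModEq.sum fun e _ => ?_
    rw [hp, ← mul_assoc]
    exact (Int.mod_modEq _ _).mul_right _

/-! ### Sets exactly covered by matchings. -/

/-- `A` is exactly covered by a matching of `H`. -/
def Matchable (H : MDigraph m V) (A : Finset V) : Prop :=
  ∃ M : Finset (Fin m → V), H.IsMatching M ∧ M.biUnion (fun e => univ.image e) = A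

theorem matchable_empty (H : MDigraph m V) : H.Matchable ∅ :=
  ⟨∅, ⟨by simp, by simp, by simp⟩, by simp⟩

theorem matchable_image {H : MDigraph m V} {e : Fin m → V} (he : e ∈ H.edges)
    (hinj : Function.Injective e) : H.Matchable (univ.image e) := by
  refine ⟨{e}, ⟨by simpa, by simpa, ?_⟩, by simp⟩
  intro f hf g hg hfg
  simp only [mem_singleton] at hf hg
  exact absurd (hf.trans hg.symm) hfg

theorem Matchable.union {H : MDigraph m V} {A B : Finset V} (hA : H.Matchable A)
    (hB : H.Matchable B) (hAB : Disjoint A B) : H.Matchable (A ∪ B) := by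
  obtain ⟨M, ⟨h1, h2, h3⟩, rfl⟩ := hA
  obtain ⟨N, ⟨k1, k2, k3⟩, rfl⟩ := hB
  have key : ∀ e ∈ M, ∀ f ∈ N, ∀ i j, e i ≠ f j := by
    intro e he f hf i j hij
    refine disjoint_left.1 hAB (mem_biUnion.2 ⟨e, he, mem_image_of_mem e (mem_univ i)⟩) ?_
    rw [hij]
    exact mem_biUnion.2 ⟨f, hf, mem_image_of_mem f (mem_univ j)⟩
  refine ⟨M ∪ N, ⟨union_subset h1 k1, ?_, ?_⟩, by rw [union_biUnion]⟩
  · intro e he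
    exact (mem_union.1 he).elim (h2 e) (k2 e)
  · intro e he f hf hef i j
    rcases mem_union.1 he with he | he <;> rcases mem_union.1 hf with hf | hf
    · exact h3 e he f hf hef i j
    · exact key e he f hf i j
    · exact (key f hf e he j i).symm
    · exact k3 e he f hf hef i j

theorem Matchable.biUnion {H : MDigraph m V} {ι : Type*} [DecidableEq ι] (J : Finset ι)
    (A : ι → Finset V) (hA : ∀ j ∈ J, H.Matchable (A j))
    (hd : ∀ i ∈ J, ∀ j ∈ J, i ≠ j → Disjoint (A i) (A j)) : H.Matchable (J.biUnion A) := by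
  induction J using Finset.induction_on with
  | empty => simpa using H.matchable_empty
  | insert a J ha ih =>
    rw [biUnion_insert]
    refine (hA a (mem_insert_self _ _)).union
      (ih (fun j hj => hA j (mem_insert_of_mem hj))
        fun i hi j hj => hd i (mem_insert_of_mem hi) j (mem_insert_of_mem hj)) ?_
    rw [disjoint_biUnion_right]
    exact fun j hj => hd a (mem_insert_self _ _) j (mem_insert_of_mem hj)
      (fun h => ha (h ▸ hj))

theorem Matchable.dvd_card {H : MDigraph m V} {A : Finset V} (hA : H.Matchable A) :
    m ∣ A.card := by
  obtain ⟨M, ⟨_, h2, h3⟩, rfl⟩ := hA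
  rw [card_biUnion]
  · refine dvd_sum fun e he => ?_
    rw [card_image_of_injective _ (h2 e he)]
    simp
  · intro e he f hf hef
    rw [Function.onFun, disjoint_left]
    rintro x hx hx'
    obtain ⟨i, _, rfl⟩ := mem_image.1 hx
    obtain ⟨j, _, h⟩ := mem_image.1 hx'
    exact h3 e he f hf hef i j h.symm

theorem Matchable.subset {H : MDigraph m V} {A : Finset V} (hA : H.Matchable A) :
    A ⊆ H.vertices := by
  obtain ⟨M, ⟨h1, _, _⟩, rfl⟩ := hA
  intro x hx
  obtain ⟨e, he, hx⟩ := mem_biUnion.1 hx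
  obtain ⟨i, _, rfl⟩ := mem_image.1 hx
  exact H.edge_mem e (h1 he) i

theorem Matchable.hasPerfectMatching {H : MDigraph m V} (h : H.Matchable H.vertices) :
    H.HasPerfectMatching := by
  obtain ⟨M, hM, h⟩ := h
  refine ⟨M, hM, fun v hv => ?_⟩
  rw [← h] at hv
  obtain ⟨e, he, hv⟩ := mem_biUnion.1 hv
  obtain ⟨i, _, hi⟩ := mem_image.1 hv
  exact ⟨e, he, i, hi⟩

/-! ### Blow-ups of patterns and the use of fissility. -/

/-- The sets `U i` are disjoint and all their transversals realise the pattern `E`. -/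
structure IsBlowup (H : MDigraph m V) (E : Finset (Fin m → Fin s)) (U : Fin s → Finset V) :
    Prop where
  subset : ∀ i, U i ⊆ H.vertices
  disj : ∀ i j, i ≠ j → Disjoint (U i) (U j)
  edge : ∀ u : Fin s → V, (∀ i, u i ∈ U i) → ∀ e ∈ E, u ∘ e ∈ H.edges

/-- Fissility is applied to the sets `T (e j)`, listed by position. A consistent choice from them
extends to a transversal `u` of the blow-up and therefore equals the edge `u ∘ e`, so the list is
suitable. The edge obtained covers the union of the `T i`, which has exactly `m` elements, so it
uses nothing else. -/
theorem IsBlowup.matchable_of_edge {H : MDigraph m V} (hH : H.IsFissile)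
    {E : Finset (Fin m → Fin s)} {U : Fin s → Finset V} (hU : H.IsBlowup E U)
    (hne : ∀ i, (U i).Nonempty) {e : Fin m → Fin s} (he : e ∈ E) {T : Fin s → Finset V}
    (hT : ∀ i, T i ⊆ U i) (hc : ∀ i, (T i).card = tupleMult i e) :
    H.Matchable (univ.biUnion T) := by
  have hpos : ∀ j, (T (e j)).Nonempty := by
    intro j
    rw [← card_pos, hc, tupleMult, card_pos]
    exact ⟨j, by simp⟩
  have hdT : ∀ i j, i ≠ j → Disjoint (T i) (T j) := fun i j hij =>
    disjoint_of_subset_left (hT i) (disjoint_of_subset_right (hT j) (hU.disj i j hij))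
  -- Suitability compares the sets themselves, not their indices. Disjoint sets of which one is
  -- nonempty cannot coincide, so equal sets come from equal indices.
  have hTinj : ∀ i j, T (e i) = T (j) → e i = j := by
    intro i j hij
    by_contra hne
    have := hdT _ _ hne
    rw [← hij, disjoint_self] at this
    exact (hpos i).ne_empty this
  have hcard : (univ.biUnion T).card = m := by
    rw [card_biUnion fun i _ j _ hij => hdT i j hij]
    simp only [hc]
    exact sum_tupleMult e
  have hsuit : H.IsSuitable (univ.image fun j => T (e j)) (fun j => T (e j)) := by
    refine ⟨?_, ?_, ?_, ?_, ?_, ?_⟩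
    · intro X hX
      obtain ⟨j, _, rfl⟩ := mem_image.1 hX
      exact (hT _).trans (hU.subset _)
    · intro X hX Y hY hXY
      obtain ⟨i, _, rfl⟩ := mem_image.1 hX
      obtain ⟨j, _, rfl⟩ := mem_image.1 hY
      exact hdT _ _ fun h => hXY (by rw [h])
    · have : (univ.image fun j => T (e j)) = (univ.image e).image T := by
        rw [image_image]; rfl
      rw [this, sum_image]
      · simp only [hc]
        conv_rhs => rw [← sum_tupleMult e]
        refine sum_subset (subset_univ _) fun i _ hi => ?_
        rw [tupleMult, card_eq_zero, filter_eq_empty_iff]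
        intro j _ hj
        exact hi (hj ▸ mem_image_of_mem e (mem_univ j))
      · intro i hi j _ hij
        obtain ⟨i', _, rfl⟩ := mem_image.1 hi
        exact hTinj i' j hij
    · intro i
      exact mem_image_of_mem (fun j => T (e j)) (mem_univ i)
    · intro X hX
      obtain ⟨j, _, rfl⟩ := mem_image.1 hX
      rw [hc, tupleMult, tupleMult]
      congr 1
      ext i
      simp only [mem_filter, mem_univ, true_and]
      exact ⟨fun h => by rw [h], hTinj i _⟩
    · intro f hf hcons
      choose w hw using hne
      classical
      -- Indices that do not occur in `e` are filled with arbitrary vertices; this is why all parts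
      -- must be nonempty.
      let u : Fin s → V := fun i => if h : ∃ j, e j = i then f h.choose else w i
      have hu : u ∘ e = f := by
        funext j
        have h : ∃ j', e j' = e j := ⟨j, rfl⟩
        simp only [Function.comp, u, dif_pos h]
        exact hcons _ _ (congrArg T h.choose_spec)
      rw [← hu]
      refine hU.edge u (fun i => ?_) e he
      by_cases h : ∃ j, e j = i
      · simp only [u, dif_pos h]
        have := hT _ (hf h.choose)
        rwa [h.choose_spec] at this
      · simp only [u, dif_neg h]
        exact hw i
  obtain ⟨f, hf, hinj, hcov⟩ := hH _ _ hsuit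
  have hsub : univ.biUnion T ⊆ univ.image f := by
    intro x hx
    obtain ⟨i, _, hx⟩ := mem_biUnion.1 hx
    have : ∃ j, e j = i := by
      have : 0 < tupleMult i e := by rw [← hc]; exact card_pos.2 ⟨x, hx⟩
      obtain ⟨j, hj⟩ := card_pos.1 this
      exact ⟨j, (mem_filter.1 hj).2⟩
    obtain ⟨j, rfl⟩ := this
    obtain ⟨j', hj'⟩ := hcov j x hx
    exact mem_image.2 ⟨j', mem_univ _, hj'⟩
  have : univ.biUnion T = univ.image f := by
    refine eq_of_subset_of_card_le hsub ?_
    rw [hcard, card_image_of_injective _ hinj]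
    simp
  rw [this]
  exact matchable_image hf hinj

/-- One edge is split off at a time. The blow-up `U` stays fixed while the target sets `T` shrink,
so the induction never runs out of transversals. -/
theorem IsBlowup.matchable_of_multiset {H : MDigraph m V} (hH : H.IsFissile)
    {E : Finset (Fin m → Fin s)} {U : Fin s → Finset V} (hU : H.IsBlowup E U)
    (hne : ∀ i, (U i).Nonempty) (x : Multiset (Fin m → Fin s)) (hx : ∀ e ∈ x, e ∈ E) :
    ∀ T : Fin s → Finset V, (∀ i, T i ⊆ U i) →
      (∀ i, (T i).card = (x.map (tupleMult i)).sum) → H.Matchable (univ.biUnion T) := by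
  induction x using Multiset.induction_on with
  | empty =>
    intro T _ hc
    have : univ.biUnion T = ∅ := by
      rw [eq_empty_iff_forall_notMem]
      intro v hv
      obtain ⟨i, _, hv⟩ := mem_biUnion.1 hv
      have := hc i
      simp only [Multiset.map_zero, Multiset.sum_zero, card_eq_zero] at this
      simp [this] at hv
    rw [this]
    exact H.matchable_empty
  | cons e x ih =>
    intro T hT hc
    have hsplit : ∀ i, ∃ A ⊆ T i, A.card = tupleMult i e := fun i =>
      exists_subset_card_eq (by rw [hc]; simp)
    choose A hA hAc using hsplit
    have h1 : H.Matchable (univ.biUnion A) :=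
      hU.matchable_of_edge hH hne (hx e (Multiset.mem_cons_self _ _))
        (fun i => (hA i).trans (hT i)) hAc
    have h2 : H.Matchable (univ.biUnion fun i => T i \ A i) := by
      refine ih (fun f hf => hx f (Multiset.mem_cons_of_mem hf)) _
        (fun i => sdiff_subset.trans (hT i)) fun i => ?_
      rw [card_sdiff_of_subset (hA i), hc, hAc]
      simp
    have h3 : univ.biUnion T = univ.biUnion A ∪ univ.biUnion fun i => T i \ A i := by
      rw [← biUnion_union]
      refine biUnion_congr rfl fun i _ => ?_
      rw [union_sdiff_of_subset (hA i)]
    rw [h3]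
    refine h1.union h2 ?_
    rw [disjoint_biUnion_left]
    intro i _
    rw [disjoint_biUnion_right]
    intro j _
    by_cases hij : i = j
    · subst hij
      exact disjoint_sdiff
    · exact disjoint_of_subset_left ((hA i).trans (hT i))
        (disjoint_of_subset_right (sdiff_subset.trans (hT j)) (hU.disj i j hij))

theorem IsBlowup.matchable {H : MDigraph m V} (hH : H.IsFissile)
    {E : Finset (Fin m → Fin s)} {U : Fin s → Finset V} (hU : H.IsBlowup E U)
    (hne : ∀ i, (U i).Nonempty) (p : (Fin m → Fin s) → ℕ) {T : Fin s → Finset V}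
    (hT : ∀ i, T i ⊆ U i) (hc : ∀ i, (T i).card = ∑ e ∈ E, p e * tupleMult i e) :
    H.Matchable (univ.biUnion T) := by
  refine hU.matchable_of_multiset hH hne (∑ e ∈ E, Multiset.replicate (p e) e) ?_ T hT ?_
  · intro e he
    obtain ⟨f, hf, h⟩ := Multiset.mem_sum.1 he
    rwa [Multiset.eq_of_mem_replicate h]
  · intro i
    rw [hc]
    have : ∀ x : Multiset (Fin m → Fin s), (x.map (tupleMult i)).sum =
        (Multiset.sumAddMonoidHom.comp (Multiset.mapAddMonoidHom (tupleMult i))) x := fun x => rfl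
    rw [this, map_sum]
    refine sum_congr rfl fun e _ => ?_
    simp

end MDigraph

/-! ### Complete partite subgraphs in dense partite hypergraphs. -/

theorem card_piFinset_cons_fiber {V : Type*} [DecidableEq V] {k : ℕ} (W : Fin (k + 1) → Finset V)
    (E : Finset (Fin (k + 1) → V)) (hE : E ⊆ Fintype.piFinset W) :
    ∑ x ∈ W 0, ((Fintype.piFinset fun i => W (Fin.succ i)).filter
      fun y => (Fin.cons x y : Fin (k + 1) → V) ∈ E).card = E.card := by
  rw [← card_sigma]
  refine card_bij (fun p _ => (Fin.cons p.1 p.2 : Fin (k + 1) → V)) ?_ ?_ ?_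
  · rintro ⟨x, y⟩ h
    simp only [mem_sigma, mem_filter] at h
    exact h.2.2
  · rintro ⟨x, y⟩ _ ⟨x', y'⟩ _ h
    have := Fin.cons_inj.1 h
    simp only at this
    rw [this.1, this.2]
  · intro v hv
    have hv' := Fintype.mem_piFinset.1 (hE hv)
    refine ⟨⟨v 0, Fin.tail v⟩, ?_, Fin.cons_self_tail v⟩
    simp only [mem_sigma, mem_filter, Fintype.mem_piFinset, Fin.cons_self_tail]
    exact ⟨hv' 0, fun i => hv' i.succ, hv⟩

/-- Erdős's theorem: a `k`-partite `k`-graph of positive density contains a large complete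
`k`-partite `k`-graph. -/
theorem exists_complete_partite (k c : ℕ) : ∀ α : ℝ, 0 < α → ∃ b₀ : ℕ, 0 < b₀ ∧
    ∀ (V : Type u) [DecidableEq V] (W : Fin k → Finset V) (E : Finset (Fin k → V)),
      E ⊆ Fintype.piFinset W → (∀ i, b₀ ≤ (W i).card) →
      α * ∏ i, ((W i).card : ℝ) ≤ E.card →
      ∃ U : Fin k → Finset V, (∀ i, U i ⊆ W i) ∧ (∀ i, (U i).card = c) ∧
        Fintype.piFinset U ⊆ E := by
  induction k with
  | zero =>
    intro α hα
    refine ⟨1, one_pos, fun V _ W E _ _ h => ⟨fun _ => ∅, fun i => i.elim0, fun i => i.elim0, ?_⟩⟩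
    simp only [univ_eq_empty, prod_empty, mul_one] at h
    have : 0 < E.card := by exact_mod_cast hα.trans_le h
    obtain ⟨e, he⟩ := card_pos.1 this
    intro x _
    rwa [Subsingleton.elim x e]
  | succ k ih =>
    intro α hα
    -- Vertices of the first part are heavy if their link has density at least `a`. The light ones
    -- account for at most half of the edges.
    set a := α / 2 with ha
    have ha0 : 0 < a := by positivity
    -- `M` heavy vertices are sampled, with `M * a - c ≥ M * a / 2`; the extra 1 keeps `M` positive
    -- when `c = 0`.
    obtain ⟨M, hM⟩ := exists_nat_ge ((c + 1) / (a / 2))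
    rw [div_le_iff₀ (by positivity)] at hM
    have hMpos : (0 : ℝ) < M := by
      rcases Nat.eq_zero_or_pos M with h | h
      · subst h
        have : (0 : ℝ) ≤ c := by positivity
        simp at hM
        linarith
      · exact_mod_cast h
    obtain ⟨b₁, hb₁, hb⟩ := ih (a / 2 / 2 ^ M) (by positivity)
    -- There are at least `a * (W 0).card` heavy vertices, so parts of size `M / a` provide the
    -- sample.
    obtain ⟨b₂, hb₂⟩ := exists_nat_ge (M / a)
    rw [div_le_iff₀ ha0] at hb₂
    refine ⟨max b₁ b₂, lt_max_of_lt_left hb₁, fun V _ W E hE hW hd => ?_⟩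
    set W' : Fin k → Finset V := fun i => W i.succ with hW'
    set P : ℝ := ∏ i, ((W' i).card : ℝ) with hP
    have hPc : P = ((Fintype.piFinset W').card : ℝ) := by
      rw [Fintype.card_piFinset]; push_cast; rfl
    have hPpos : 0 < P := prod_pos fun i _ => by
      have := (le_max_left b₁ b₂).trans (hW i.succ)
      exact_mod_cast hb₁.trans_le this
    set L : V → Finset (Fin k → V) := fun x => (Fintype.piFinset W').filter
      fun y => (Fin.cons x y : Fin (k + 1) → V) ∈ E with hL
    have hLle : ∀ x, ((L x).card : ℝ) ≤ P := fun x => by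
      rw [hPc]; exact_mod_cast card_filter_le _ _
    have hsum : ∑ x ∈ W 0, ((L x).card : ℝ) = E.card := by
      exact_mod_cast card_piFinset_cons_fiber W E hE
    rw [Fin.prod_univ_succ] at hd
    have hW0 : (b₂ : ℝ) ≤ (W 0).card := by exact_mod_cast (le_max_right b₁ b₂).trans (hW 0)
    set G := (W 0).filter fun x => a * P ≤ (L x).card with hG
    have hGc : (M : ℝ) ≤ G.card := by
      have h1 : ∑ x ∈ W 0, ((L x).card : ℝ) ≤ G.card * P + (W 0).card * (a * P) := by
        rw [← sum_filter_add_sum_filter_not (W 0) fun x => a * P ≤ (L x).card]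
        refine add_le_add ?_ ?_
        · rw [← nsmul_eq_mul]
          exact sum_le_card_nsmul _ _ _ fun x _ => hLle x
        · refine (sum_le_card_nsmul _ _ (a * P) fun x hx => ?_).trans ?_
          · exact (not_le.1 (mem_filter.1 hx).2).le
          · rw [nsmul_eq_mul]
            refine mul_le_mul_of_nonneg_right ?_ (mul_pos ha0 hPpos).le
            exact_mod_cast card_filter_le _ _
      have h2 : a * (W 0).card * P ≤ G.card * P := by
        have h3 : α * ((W 0).card * P) ≤ G.card * P + (W 0).card * (a * P) :=
          hd.trans (hsum.ge.trans h1)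
        have h4 : α = a + a := by rw [ha]; ring
        rw [h4] at h3
        linarith
      have h3 := le_of_mul_le_mul_right h2 hPpos
      have h4 := mul_le_mul_of_nonneg_left hW0 ha0.le
      linarith
    obtain ⟨A, hAG, hAM⟩ := exists_subset_card_eq (show M ≤ G.card by exact_mod_cast hGc)
    set F : (Fin k → V) → Finset V := fun y =>
      A.filter fun x => (Fin.cons x y : Fin (k + 1) → V) ∈ E with hF
    have hdc : ∑ y ∈ Fintype.piFinset W', ((F y).card : ℝ) = ∑ x ∈ A, ((L x).card : ℝ) := by
      exact_mod_cast (sum_card_bipartiteAbove_eq_sum_card_bipartiteBelow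
        (fun (x : V) (y : Fin k → V) => (Fin.cons x y : Fin (k + 1) → V) ∈ E)
        (s := A) (t := Fintype.piFinset W')).symm
    have hAsum : M * (a * P) ≤ ∑ x ∈ A, ((L x).card : ℝ) := by
      rw [← hAM, ← nsmul_eq_mul]
      exact card_nsmul_le_sum _ _ _ fun x hx => (mem_filter.1 (hAG hx)).2
    -- On average a tuple `y` has at least `a * M` neighbours in the sample. Hence a proportion of
    -- at least `a / 2` of them has `c` or more.
    set Y := (Fintype.piFinset W').filter fun y => c ≤ (F y).card with hY
    have hYc : a / 2 * P ≤ Y.card := by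
      have h1 : ∑ y ∈ Fintype.piFinset W', ((F y).card : ℝ) ≤ Y.card * M + P * c := by
        rw [← sum_filter_add_sum_filter_not (Fintype.piFinset W') fun y => c ≤ (F y).card]
        refine add_le_add ?_ ?_
        · rw [← nsmul_eq_mul]
          refine sum_le_card_nsmul _ _ _ fun y _ => ?_
          rw [← hAM]
          exact_mod_cast card_filter_le _ _
        · refine (sum_le_card_nsmul _ _ (c : ℝ) fun x hx => ?_).trans ?_
          · exact_mod_cast (not_le.1 (mem_filter.1 hx).2).le
          · rw [nsmul_eq_mul, hPc]
            refine mul_le_mul_of_nonneg_right ?_ (by positivity)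
            exact_mod_cast card_filter_le _ _
      have h2 : (a / 2 * P) * M ≤ Y.card * M := by
        have h3 : P * c ≤ P * (M * (a / 2)) :=
          mul_le_mul_of_nonneg_left (by linarith) hPpos.le
        have h4 := hAsum.trans (hdc.ge.trans h1)
        linarith
      exact le_of_mul_le_mul_right h2 hMpos
    have hmaps : ∀ y ∈ Y, F y ∈ A.powerset := fun y _ => mem_powerset.2 (filter_subset _ _)
    -- The sample has only `2 ^ M` subsets, so some `A₀` is the neighbourhood of a positive
    -- proportion of the tuples. The induction hypothesis is applied to these.
    obtain ⟨A₀, _, hA₀⟩ := exists_le_card_fiber_of_nsmul_le_card_of_maps_to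
      (b := a / 2 / 2 ^ M * P) hmaps ⟨∅, by simp⟩ (by
        rw [card_powerset, hAM, nsmul_eq_mul]
        refine le_trans (le_of_eq ?_) hYc
        push_cast
        field_simp)
    obtain ⟨U', hU'W, hU'c, hU'E⟩ := hb V W' (Y.filter fun y => F y = A₀)
      ((filter_subset _ _).trans (filter_subset _ _))
      (fun i => (le_max_left _ _).trans (hW i.succ)) hA₀
    have hqP : 0 < a / 2 / 2 ^ M * P :=
      mul_pos (div_pos (div_pos ha0 two_pos) (pow_pos two_pos M)) hPpos
    have hcA : c ≤ A₀.card := by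
      have : (0 : ℝ) < (Y.filter fun y => F y = A₀).card := lt_of_lt_of_le hqP hA₀
      obtain ⟨y, hy⟩ := card_pos.1 (by exact_mod_cast this)
      rw [mem_filter] at hy
      rw [← hy.2]
      exact (mem_filter.1 hy.1).2
    have hA₀A : A₀ ⊆ A := by
      have : (0 : ℝ) < (Y.filter fun y => F y = A₀).card := lt_of_lt_of_le hqP hA₀
      obtain ⟨y, hy⟩ := card_pos.1 (by exact_mod_cast this)
      rw [mem_filter] at hy
      rw [← hy.2]
      exact filter_subset _ _
    obtain ⟨U₀, hU₀, hU₀c⟩ := exists_subset_card_eq hcA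
    refine ⟨Fin.cons U₀ U', ?_, ?_, ?_⟩
    · intro i
      refine Fin.cases ?_ (fun i => ?_) i
      · exact hU₀.trans (hA₀A.trans (hAG.trans (filter_subset _ _)))
      · exact hU'W i
    · intro i
      refine Fin.cases ?_ (fun i => ?_) i
      · exact hU₀c
      · exact hU'c i
    · intro x hx
      rw [Fintype.mem_piFinset] at hx
      have h1 : Fin.tail x ∈ Fintype.piFinset U' :=
        Fintype.mem_piFinset.2 fun i => hx i.succ
      have h2 := (mem_filter.1 (hU'E h1)).2
      have h3 : x 0 ∈ A₀ := hU₀ (hx 0)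
      rw [← h2] at h3
      have := (mem_filter.1 h3).2
      rwa [Fin.cons_self_tail] at this

/-- The coloured version of `exists_complete_partite`. -/
theorem exists_monochromatic_partite (k c : ℕ) (χ : Type) [Fintype χ] [DecidableEq χ] (α : ℝ)
    (hα : 0 < α) : ∃ b₀ : ℕ, 0 < b₀ ∧
    ∀ (V : Type u) [DecidableEq V] (W : Fin k → Finset V) (E : Finset (Fin k → V))
      (col : (Fin k → V) → χ), E ⊆ Fintype.piFinset W → (∀ i, b₀ ≤ (W i).card) →
      α * ∏ i, ((W i).card : ℝ) ≤ E.card →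
      ∃ U : Fin k → Finset V, (∀ i, U i ⊆ W i) ∧ (∀ i, (U i).card = c) ∧
        ∃ x, ∀ u ∈ Fintype.piFinset U, u ∈ E ∧ col u = x := by
  -- The most frequent colour has at least this density; the added 1 avoids a zero denominator.
  obtain ⟨b₀, hb₀, h⟩ := exists_complete_partite.{u} k c (α / (Fintype.card χ + 1)) (by positivity)
  refine ⟨b₀, hb₀, fun V _ W E col hE hW hd => ?_⟩
  have hP : (0 : ℝ) < ∏ i, ((W i).card : ℝ) := prod_pos fun i _ => by
    exact_mod_cast hb₀.trans_le (hW i)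
  have hEpos : (0 : ℝ) < E.card := lt_of_lt_of_le (by positivity) hd
  obtain ⟨e, he⟩ := card_pos.1 (by exact_mod_cast hEpos : 0 < E.card)
  obtain ⟨x, _, hx⟩ := exists_le_card_fiber_of_nsmul_le_card_of_maps_to
    (b := α / (Fintype.card χ + 1) * ∏ i, ((W i).card : ℝ)) (s := E) (t := univ) (f := col)
    (fun _ _ => mem_univ _) ⟨col e, mem_univ _⟩ (by
      refine le_trans ?_ hd
      rw [card_univ, nsmul_eq_mul, ← mul_assoc]
      refine mul_le_mul_of_nonneg_right ?_ hP.le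
      rw [mul_div_assoc', div_le_iff₀ (by positivity)]
      nlinarith)
  obtain ⟨U, h1, h2, h3⟩ := h V W (E.filter fun u => col u = x) ((filter_subset _ _).trans hE) hW hx
  exact ⟨U, h1, h2, x, fun u hu => mem_filter.1 (h3 hu)⟩

/-! ### Blow-ups from many good tuples. -/

namespace MDigraph

open Classical in
/-- A positive density of good tuples gives a blow-up of a good pattern. -/
theorem exists_isBlowup (m s c : ℕ) (hc : 0 < c) (α : ℝ) (hα : 0 < α) : ∃ b₀ : ℕ, 0 < b₀ ∧
    ∀ (V : Type u) [DecidableEq V] (H : MDigraph m V) (W : Fin s → Finset V),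
      (∀ i, b₀ ≤ (W i).card) →
      α * ∏ i, ((W i).card : ℝ) ≤ ((Fintype.piFinset W).filter fun u => H.IsGoodTuple u).card →
      ∃ U : Fin s → Finset V, (∀ i, U i ⊆ W i) ∧ (∀ i, (U i).card = c) ∧
        ∃ E, IsGoodPattern E ∧ H.IsBlowup E U := by
  obtain ⟨b₀, hb₀, h⟩ := exists_monochromatic_partite.{u} s c (Finset (Fin m → Fin s)) α hα
  refine ⟨b₀, hb₀, fun V _ H W hW hd => ?_⟩
  obtain ⟨U, h1, h2, E, h3⟩ := h V W _ H.pattern (filter_subset _ _) hW hd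
  have hne : ∀ i, (U i).Nonempty := fun i => card_pos.1 (by rw [h2]; exact hc)
  choose w hw using hne
  have hg : ∀ u : Fin s → V, (∀ i, u i ∈ U i) → H.IsGoodTuple u ∧ H.pattern u = E := fun u hu =>
    ⟨(mem_filter.1 (h3 u (Fintype.mem_piFinset.2 hu)).1).2, (h3 u (Fintype.mem_piFinset.2 hu)).2⟩
  -- Changing one coordinate keeps a transversal. A vertex common to two parts could then be placed
  -- in both coordinates, contradicting that good tuples are one-to-one.
  have hupd : ∀ i x, x ∈ U i → ∀ u : Fin s → V, (∀ j, u j ∈ U j) →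
      ∀ j, Function.update u i x j ∈ U j := by
    intro i x hx u hu j
    by_cases hj : j = i
    · subst hj; simpa using hx
    · simpa [hj] using hu j
  refine ⟨U, h1, h2, E, (hg w hw).2 ▸ (hg w hw).1.good, ?_, ?_, ?_⟩
  · intro i x hx
    have := (hg _ (hupd i x hx w hw)).1.mem i
    simpa using this
  · intro i j hij
    rw [disjoint_left]
    intro x hi hj
    have h := (hg _ (hupd j x hj _ (hupd i x hi w hw))).1.inj
    exact hij (h (by simp [hij]))
  · intro u hu e he
    rw [← (hg u hu).2] at he
    exact (mem_filter.1 he).2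

open Classical in
/-- A vertex with a positive density of good tuples extends to a blow-up of a good pattern. -/
theorem exists_isBlowup_cons (m k c : ℕ) (hc : 0 < c) (α : ℝ) (hα : 0 < α) : ∃ b₀ : ℕ, 0 < b₀ ∧
    ∀ (V : Type u) [DecidableEq V] (H : MDigraph m V) (v : V) (W : Fin k → Finset V),
      (∀ i, b₀ ≤ (W i).card) →
      α * ∏ i, ((W i).card : ℝ) ≤ ((Fintype.piFinset W).filter
        fun z => H.IsGoodTuple (Fin.cons v z : Fin (k + 1) → V)).card →
      ∃ U : Fin k → Finset V, (∀ i, U i ⊆ W i) ∧ (∀ i, (U i).card = c) ∧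
        ∃ E, IsGoodPattern E ∧ H.IsBlowup E (Fin.cons {v} U : Fin (k + 1) → Finset V) := by
  obtain ⟨b₀, hb₀, h⟩ :=
    exists_monochromatic_partite.{u} k c (Finset (Fin m → Fin (k + 1))) α hα
  refine ⟨b₀, hb₀, fun V _ H v W hW hd => ?_⟩
  -- The first vertex stays fixed: only the remaining `k` entries are coloured, by the pattern of
  -- the whole tuple, so the first part is a singleton.
  obtain ⟨U, h1, h2, E, h3⟩ := h V W _
    (fun z => H.pattern (Fin.cons v z : Fin (k + 1) → V)) (filter_subset _ _) hW hd
  set U' : Fin (k + 1) → Finset V := Fin.cons {v} U with hU'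
  have hne : ∀ i, (U' i).Nonempty := fun i => by
    refine Fin.cases ?_ (fun i => ?_) i
    · simp [hU']
    · simp only [hU', Fin.cons_succ]
      exact card_pos.1 (by rw [h2]; exact hc)
  choose w hw using hne
  have hg : ∀ u : Fin (k + 1) → V, (∀ i, u i ∈ U' i) → H.IsGoodTuple u ∧ H.pattern u = E := by
    intro u hu
    have h0 : u 0 = v := by simpa [hU'] using hu 0
    have ht : Fin.tail u ∈ Fintype.piFinset U :=
      Fintype.mem_piFinset.2 fun i => by simpa [hU', Fin.tail] using hu i.succ
    have hcons : (Fin.cons v (Fin.tail u) : Fin (k + 1) → V) = u := by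
      rw [← h0, Fin.cons_self_tail]
    have := h3 _ ht
    rw [mem_filter, hcons] at this
    exact ⟨this.1.2, this.2⟩
  have hupd : ∀ i x, x ∈ U' i → ∀ u : Fin (k + 1) → V, (∀ j, u j ∈ U' j) →
      ∀ j, Function.update u i x j ∈ U' j := by
    intro i x hx u hu j
    by_cases hj : j = i
    · subst hj; simpa using hx
    · simpa [hj] using hu j
  refine ⟨U, h1, h2, E, (hg w hw).2 ▸ (hg w hw).1.good, ?_, ?_, ?_⟩
  · intro i x hx
    have := (hg _ (hupd i x hx w hw)).1.mem i
    simpa using this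
  · intro i j hij
    rw [disjoint_left]
    intro x hi hj
    have h := (hg _ (hupd j x hj _ (hupd i x hi w hw))).1.inj
    exact hij (h (by simp [hij]))
  · intro u hu e he
    rw [← (hg u hu).2] at he
    exact (mem_filter.1 he).2

end MDigraph

/-! ### Counting injective tuples and sets through a vertex. -/

section Counting

theorem card_injective_piFinset {V : Type*} [DecidableEq V] (k : ℕ) (U : Finset V) :
    ((Fintype.piFinset fun _ : Fin k => U).filter fun z => Function.Injective z).card =
      U.card.descFactorial k := by
  have h := Fintype.card_embedding_eq (α := Fin k) (β := U)
  rw [Fintype.card_fin, Fintype.card_coe] at h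
  rw [← h, ← card_univ]
  symm
  refine card_bij (fun f _ i => (f i : V)) ?_ ?_ ?_
  · intro f _
    simp only [mem_filter, Fintype.mem_piFinset]
    exact ⟨fun i => (f i).2, Subtype.val_injective.comp f.injective⟩
  · intro f _ g _ hfg
    ext i
    exact congrFun hfg i
  · intro z hz
    simp only [mem_filter, Fintype.mem_piFinset] at hz
    refine ⟨⟨fun i => ⟨z i, hz.1 i⟩, fun i j hij => hz.2 ?_⟩, mem_univ _, rfl⟩
    simpa using hij

theorem choose_le_card_powersetCard_filter {V : Type*} [DecidableEq V] (k : ℕ) (U : Finset V)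
    {v : V} (hv : v ∈ U) :
    (U.card - 1).choose k ≤ ((U.powersetCard (k + 1)).filter fun S => {v} ⊆ S).card := by
  rw [← card_erase_of_mem hv, ← card_powersetCard]
  refine card_le_card_of_injOn (insert v) ?_ ?_
  · intro T hT
    have hT := mem_powersetCard.1 hT
    have hvT : v ∉ T := fun h => notMem_erase v U (hT.1 h)
    simp only [coe_filter, mem_powersetCard, Set.mem_ofPred_eq, singleton_subset_iff,
      mem_insert_self, and_true]
    refine ⟨insert_subset hv (hT.1.trans (erase_subset _ _)), ?_⟩
    rw [card_insert_of_notMem hvT, hT.2]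
  · intro T hT T' hT' h
    have hT := mem_powersetCard.1 hT
    have hT' := mem_powersetCard.1 hT'
    have h1 : v ∉ T := fun h => notMem_erase v U (hT.1 h)
    have h2 : v ∉ T' := fun h => notMem_erase v U (hT'.1 h)
    rw [← erase_insert h1, ← erase_insert h2, h]

theorem card_powersetCard_filter_le {V : Type*} [DecidableEq V] (k : ℕ) (U : Finset V)
    {v : V} (hv : v ∈ U) :
    ((U.powersetCard (k + 1)).filter fun S => {v} ⊆ S).card ≤ (U.card - 1).choose k := by
  rw [← card_erase_of_mem hv, ← card_powersetCard]
  refine card_le_card_of_injOn (fun S => S.erase v) ?_ ?_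
  · intro S hS
    simp only [coe_filter, mem_powersetCard, Set.mem_ofPred_eq, singleton_subset_iff] at hS
    simp only [mem_coe, mem_powersetCard]
    exact ⟨erase_subset_erase _ hS.1.1, by rw [card_erase_of_mem hS.2, hS.1.2]; rfl⟩
  · intro S hS T hT h
    simp only [coe_filter, mem_powersetCard, Set.mem_ofPred_eq, singleton_subset_iff] at hS hT
    rw [← insert_erase hS.2, ← insert_erase hT.2]
    exact congrArg (insert v) h

end Counting

/-! ### Minimum vertex degree. -/

namespace UniformGraph

variable {s : ℕ} {V : Type*} [DecidableEq V]

theorem minDegree_one_set_bddAbove (P : UniformGraph s V) {v : V} (hv : v ∈ P.vertices) :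
    ∀ l ∈ {l : ℕ | ∀ D : Finset V, D ⊆ P.vertices → D.card = 1 → l ≤ P.degree D},
      l ≤ P.degree {v} := fun _ hl => hl {v} (by simpa) (by simp)

theorem minDegree_one_le (P : UniformGraph s V) {v : V} (hv : v ∈ P.vertices) :
    P.minDegree 1 ≤ P.degree {v} :=
  csSup_le ⟨0, fun _ _ _ => Nat.zero_le _⟩ (P.minDegree_one_set_bddAbove hv)

/-- Without vertices every `l` would be admissible and the supremum in `ℕ` would take its default
value 0; hence the nonemptiness assumption. -/
theorem le_minDegree_one (P : UniformGraph s V) (hne : P.vertices.Nonempty) {l : ℕ}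
    (h : ∀ v ∈ P.vertices, l ≤ P.degree {v}) : l ≤ P.minDegree 1 := by
  obtain ⟨v, hv⟩ := hne
  refine le_csSup ⟨_, P.minDegree_one_set_bddAbove hv⟩ fun D hD hc => ?_
  obtain ⟨w, rfl⟩ := card_eq_one.1 hc
  exact h w (by simpa using hD)

theorem exists_degree_eq_minDegree_one (P : UniformGraph s V) (hne : P.vertices.Nonempty) :
    ∃ v ∈ P.vertices, P.degree {v} ≤ P.minDegree 1 := by
  obtain ⟨v, hv, h⟩ := exists_min_image P.vertices (fun v => P.degree {v}) hne
  exact ⟨v, hv, P.le_minDegree_one hne h⟩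

end UniformGraph

/-! ### The matching threshold: basic properties and a lower bound. -/

section Threshold

/-- The densities whose infimum is `matchingThreshold s`. -/
def matchingDensities (s : ℕ) : Set ℝ :=
  {δ : ℝ | δ ∈ Set.Icc (0 : ℝ) 1 ∧ ∀ μ : ℝ, 0 < μ → ∃ n₀ : ℕ, ∀ n : ℕ, n₀ ≤ n → s ∣ n →
    ∀ (V : Type) [DecidableEq V] (P : UniformGraph s V), P.vertices.card = n →
      (δ + μ) * ((n - 1).choose (s - 1) : ℝ) ≤ (P.minDegree 1 : ℝ) → P.HasPerfectMatching}

theorem matchingThreshold_eq (s : ℕ) : matchingThreshold s = sInf (matchingDensities s) := rfl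

/-- The degree condition for density `1 + μ` exceeds the number of all possible edges at a vertex,
so it is never met once `n ≥ k + 1`. This makes the infimum one over a nonempty set. -/
theorem one_mem_matchingDensities (k : ℕ) : (1 : ℝ) ∈ matchingDensities (k + 1) := by
  refine ⟨by simp, fun μ hμ => ⟨k + 1, fun n hn _ V _ P hP h => ?_⟩⟩
  exfalso
  obtain ⟨v, hv⟩ : P.vertices.Nonempty := card_pos.1 (by omega)
  have h1 : P.degree {v} ≤ (n - 1).choose k := by
    rw [← hP]
    refine le_trans (card_le_card (filter_subset_filter _ fun S hS => ?_))
      (card_powersetCard_filter_le k P.vertices hv)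
    exact mem_powersetCard.2 ⟨P.edge_subset S hS, P.edge_card S hS⟩
  have h2 : (P.minDegree 1 : ℝ) ≤ (n - 1).choose k := by
    exact_mod_cast (P.minDegree_one_le hv).trans h1
  have h3 : (0 : ℝ) < (n - 1).choose k := by exact_mod_cast Nat.choose_pos (by omega)
  rw [Nat.add_sub_cancel] at h
  nlinarith

theorem matchingDensities_bddBelow (s : ℕ) : BddBelow (matchingDensities s) :=
  ⟨0, fun _ h => h.1.1⟩

theorem matchingThreshold_nonneg (s : ℕ) : 0 ≤ matchingThreshold s :=
  Real.sInf_nonneg fun _ h => h.1.1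

theorem matchingThreshold_le_one (k : ℕ) : matchingThreshold (k + 1) ≤ 1 :=
  csInf_le (matchingDensities_bddBelow _) (one_mem_matchingDensities k)

/-- The infimum need not be attained: a density below threshold plus `μ` is chosen, and the
remaining gap serves as its error term. -/
theorem exists_perfectMatching_of_threshold (k : ℕ) {μ : ℝ} (hμ : 0 < μ) :
    ∃ n₀ : ℕ, ∀ n : ℕ, n₀ ≤ n → (k + 1) ∣ n → ∀ (V : Type) [DecidableEq V]
      (P : UniformGraph (k + 1) V), P.vertices.card = n →
      (matchingThreshold (k + 1) + μ) * ((n - 1).choose k : ℝ) ≤ (P.minDegree 1 : ℝ) →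
      P.HasPerfectMatching := by
  obtain ⟨δ, hδ, hlt⟩ := exists_lt_of_csInf_lt ⟨1, one_mem_matchingDensities k⟩
    (show sInf (matchingDensities (k + 1)) < matchingThreshold (k + 1) + μ by
      rw [← matchingThreshold_eq]; linarith)
  obtain ⟨n₀, h⟩ := hδ.2 (matchingThreshold (k + 1) + μ - δ) (by linarith)
  refine ⟨n₀, fun n hn hd V _ P hP hdeg => h n hn hd V P hP ?_⟩
  rw [Nat.add_sub_cancel]
  convert hdeg using 2
  ring

/-- The disjoint union of two complete `s`-graphs on the vertex set `range n`. -/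
def twoCliques (s a n : ℕ) (han : a ≤ n) : UniformGraph s ℕ where
  vertices := range n
  edges := (range a).powersetCard s ∪ (Ico a n).powersetCard s
  edge_subset := by
    intro S hS
    rcases mem_union.1 hS with h | h
    · exact (mem_powersetCard.1 h).1.trans (range_subset_range.2 han)
    · refine (mem_powersetCard.1 h).1.trans fun x hx => ?_
      rw [mem_range]
      exact (mem_Ico.1 hx).2
  edge_card := by
    intro S hS
    rcases mem_union.1 hS with h | h <;> exact (mem_powersetCard.1 h).2

/-- An edge that meets the first clique lies inside it, so a perfect matching would cut `a` vertices
into blocks of size `s`. -/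
theorem twoCliques_not_hasPerfectMatching {s a n : ℕ} (han : a ≤ n) (hs : ¬ s ∣ a) :
    ¬ (twoCliques s a n han).HasPerfectMatching := by
  rintro ⟨M, h1, h2, h3⟩
  have hA : ∀ S ∈ M, ∀ v ∈ S, v < a → S ⊆ range a := by
    intro S hS v hv hva
    rcases mem_union.1 (h1 hS) with h | h
    · exact (mem_powersetCard.1 h).1
    · have := mem_Ico.1 ((mem_powersetCard.1 h).1 hv)
      omega
  have : range a = (M.filter fun S => S ⊆ range a).biUnion id := by
    ext v
    simp only [mem_range, mem_biUnion, mem_filter, id]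
    constructor
    · intro hv
      obtain ⟨S, hS, hvS⟩ := h3 v (by simp only [twoCliques, mem_range]; omega)
      exact ⟨S, ⟨hS, hA S hS v hvS hv⟩, hvS⟩
    · rintro ⟨S, ⟨_, hS⟩, hv⟩
      exact mem_range.1 (hS hv)
  apply hs
  rw [← card_range a, this, card_biUnion]
  · refine dvd_sum fun S hS => ?_
    rw [id, (twoCliques s a n han).edge_card S (h1 (mem_filter.1 hS).1)]
  · intro S hS T hT hST
    exact h2 S (mem_filter.1 hS).1 T (mem_filter.1 hT).1 hST

theorem le_minDegree_twoCliques {k a n b : ℕ} (han : a < n) (hba : b + 1 ≤ a)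
    (hbn : b + 1 ≤ n - a) : b.choose k ≤ (twoCliques (k + 1) a n han.le).minDegree 1 := by
  refine UniformGraph.le_minDegree_one _ ⟨a, by simp [twoCliques, han]⟩ fun v hv => ?_
  have hv : v < n := mem_range.1 hv
  by_cases hva : v < a
  · calc b.choose k ≤ ((range a).card - 1).choose k :=
          Nat.choose_le_choose k (by rw [card_range]; omega)
      _ ≤ _ := choose_le_card_powersetCard_filter k (range a) (mem_range.2 hva)
      _ ≤ _ := card_le_card (filter_subset_filter _ subset_union_left)
  · calc b.choose k ≤ ((Ico a n).card - 1).choose k :=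
          Nat.choose_le_choose k (by rw [Nat.card_Ico]; omega)
      _ ≤ _ := choose_le_card_powersetCard_filter k (Ico a n) (mem_Ico.2 ⟨by omega, hv⟩)
      _ ≤ _ := card_le_card (filter_subset_filter _ subset_union_right)

/-- Two disjoint cliques of nearly equal size, the first of size not divisible by `k + 1`, have no
perfect matching, yet every degree is about `2 ^ (-k)` of the maximum. The bound later ensures that
two clusters always have a common neighbour. -/
theorem half_pow_le_matchingThreshold (k : ℕ) (hk : 1 ≤ k) :
    (1 / 2 : ℝ) ^ k ≤ matchingThreshold (k + 1) := by
  refine le_csInf ⟨1, one_mem_matchingDensities k⟩ fun δ hδ => ?_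
  by_contra! hlt
  obtain ⟨n₀, h⟩ := hδ.2 (((1 / 2 : ℝ) ^ k - δ) / 2) (by linarith)
  set ρ : ℝ := δ + ((1 / 2 : ℝ) ^ k - δ) / 2 with hρ
  have hρlt : ρ < (1 / 2 : ℝ) ^ k := by rw [hρ]; linarith
  have hρ0 : 0 ≤ ρ := by
    have := hδ.1.1
    rw [hρ]; linarith
  -- The base equals `(j - 2) / (2 * (j + 1))`. Multiplied by `2 * j + 1` it is at most `j - 1`,
  -- which is the comparison needed at the end.
  have ht : Filter.Tendsto (fun j : ℕ => (1 / 2 - 3 / 2 * (1 / ((j : ℝ) + 1))) ^ k)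
      Filter.atTop (nhds ((1 / 2 : ℝ) ^ k)) := by
    have := ((tendsto_one_div_add_atTop_nhds_zero_nat (𝕜 := ℝ)).const_mul (3 / 2 : ℝ)).const_sub
      (1 / 2 : ℝ)
    simpa using this.pow k
  obtain ⟨j, hj, hjn⟩ := ((ht.eventually (lt_mem_nhds hρlt)).and
    (Filter.eventually_ge_atTop (n₀ + 3))).exists
  have hd : (k + 1) ∣ (k + 1) * (2 * j + 1) := dvd_mul_right _ _
  have hjj : j ≤ (k + 1) * j := Nat.le_mul_of_pos_left j (by omega)
  have hlt' : (k + 1) * j + 1 < (k + 1) * (2 * j + 1) := by nlinarith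
  -- The first clique has `(k + 1) * j + 1` vertices, which is 1 modulo `k + 1`; the second has `(k
  -- + 1) * j + k`. Since `1 ≤ k`, every vertex has at least `(k + 1) * j` others in its clique.
  refine twoCliques_not_hasPerfectMatching hlt'.le ?_
    (h ((k + 1) * (2 * j + 1)) (by nlinarith) hd ℕ (twoCliques (k + 1) _ _ hlt'.le)
      (by simp [twoCliques]) ?_)
  · intro hdvd
    have := (Nat.dvd_add_right (dvd_mul_right (k + 1) j)).1 hdvd
    have := Nat.le_of_dvd one_pos this
    omega
  · have h1 : ((k + 1) * j).choose k ≤ (twoCliques (k + 1) _ _ hlt'.le).minDegree 1 :=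
      le_minDegree_twoCliques hlt' le_rfl (by
        have : (k + 1) * (2 * j + 1) = (k + 1) * j + (k + 1) * j + (k + 1) := by ring
        omega)
    refine le_trans ?_ (Nat.cast_le.2 h1)
    rw [Nat.add_sub_cancel]
    have hfac : (0 : ℝ) < k.factorial := by exact_mod_cast k.factorial_pos
    have h2 : (((k + 1) * (2 * j + 1) - 1).choose k : ℝ) ≤
        (((k + 1) * (2 * j + 1) : ℕ) : ℝ) ^ k / k.factorial := by
      refine (Nat.choose_le_pow_div k _).trans ?_
      gcongr
      omega
    have h3 : (((k + 1) * (j - 1) : ℕ) : ℝ) ^ k / k.factorial ≤ ((k + 1) * j).choose k := by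
      rw [div_le_iff₀ hfac]
      have := Nat.pow_sub_le_descFactorial ((k + 1) * j) k
      rw [Nat.descFactorial_eq_factorial_mul_choose] at this
      have h4 : (k + 1) * (j - 1) ≤ (k + 1) * j + 1 - k := by
        rw [Nat.mul_sub]; omega
      have := (Nat.pow_le_pow_left h4 k).trans this
      rw [mul_comm (Nat.choose _ _ : ℝ)]
      exact_mod_cast this
    refine (mul_le_mul_of_nonneg_left h2 hρ0).trans (le_trans ?_ h3)
    rw [mul_div_assoc']
    refine div_le_div_of_nonneg_right ?_ hfac.le
    have hj1 : ((j - 1 : ℕ) : ℝ) = (j : ℝ) - 1 := by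
      rw [Nat.cast_sub (by omega)]; simp
    push_cast
    rw [hj1, mul_pow, mul_pow, mul_left_comm]
    refine mul_le_mul_of_nonneg_left ?_ (by positivity)
    refine (mul_le_mul_of_nonneg_right hj.le (by positivity)).trans ?_
    rw [← mul_pow]
    have hj3 : (3 : ℝ) ≤ j := by exact_mod_cast (by omega : 3 ≤ j)
    have hpos : 1 / ((j : ℝ) + 1) ≤ 1 / 4 := by
      apply one_div_le_one_div_of_le <;> linarith
    refine pow_le_pow_left₀ (mul_nonneg (by linarith) (by linarith)) ?_ k
    have : ((j : ℝ) + 1) * (1 / ((j : ℝ) + 1)) = 1 := by field_simp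
    nlinarith

end Threshold

/-! ### From the threshold to coverings with prescribed loads. -/

section ReducedMatching

open Classical in
/-- The blow-up of a relation `R` on `ι`, in which `X` is replaced by `d X` copies. -/
noncomputable def blowupGraph {ι : Type} [Fintype ι] [DecidableEq ι] (k : ℕ)
    (R : (Fin (k + 1) → ι) → Prop) (d : ι → ℕ) : UniformGraph (k + 1) (ι × ℕ) where
  vertices := univ.biUnion fun X => (range (d X)).image (Prod.mk X)
  edges := ((univ.biUnion fun X => (range (d X)).image (Prod.mk X)).powersetCard (k + 1)).filter
    fun S => ∃ t : Fin (k + 1) → ι × ℕ, univ.image t = S ∧ R (fun i => (t i).1)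
  edge_subset := fun _ hS => (mem_powersetCard.1 (mem_filter.1 hS).1).1
  edge_card := fun _ hS => (mem_powersetCard.1 (mem_filter.1 hS).1).2

variable {ι : Type} [Fintype ι] [DecidableEq ι] {k : ℕ} {R : (Fin (k + 1) → ι) → Prop} {d : ι → ℕ}

theorem mem_blowupGraph_vertices {p : ι × ℕ} :
    p ∈ (blowupGraph k R d).vertices ↔ p.2 < d p.1 := by
  obtain ⟨X, j⟩ := p
  simp [blowupGraph]

theorem card_blowupGraph_vertices : (blowupGraph k R d).vertices.card = ∑ X, d X := by
  rw [blowupGraph, card_biUnion]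
  · refine sum_congr rfl fun X _ => ?_
    rw [card_image_of_injective _ (Prod.mk_right_injective X), card_range]
  · intro X _ Y _ hXY
    rw [Function.onFun, disjoint_left]
    rintro p hp hp'
    obtain ⟨i, _, rfl⟩ := mem_image.1 hp
    obtain ⟨j, _, h⟩ := mem_image.1 hp'
    exact hXY (congrArg Prod.fst h).symm

-- Tuples over `ι` are lifted to tuples of copies. Those satisfying `R` after prefixing `v` are
-- one-to-one, and an edge through `v` arises from at most `k!` orderings of its other vertices.
open Classical in
theorem sum_prod_le_degree_blowupGraph (hR : ∀ t, R t → Function.Injective t) {v : ι × ℕ}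
    (hv : v ∈ (blowupGraph k R d).vertices) :
    ∑ y : Fin k → ι with R (Fin.cons v.1 y), ∏ i, d (y i) ≤
      k.factorial * (blowupGraph k R d).degree {v} := by
  set P := blowupGraph k R d with hP
  set Z := (Fintype.piFinset fun _ : Fin k => P.vertices).filter
    fun z => R (Fin.cons v.1 fun i => (z i).1) with hZ
  have hcons : ∀ z : Fin k → ι × ℕ, (fun i => ((Fin.cons v z : Fin (k + 1) → ι × ℕ) i).1) =
      (Fin.cons v.1 fun i => (z i).1 : Fin (k + 1) → ι) := by
    intro z
    funext i
    refine Fin.cases ?_ (fun i => ?_) i <;> simp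
  have hinj : ∀ z ∈ Z, Function.Injective (Fin.cons v z : Fin (k + 1) → ι × ℕ) := by
    intro z hz
    have h := hR _ (mem_filter.1 hz).2
    rw [← hcons] at h
    exact Function.Injective.of_comp (f := Prod.fst) h
  have h1 : ∑ y : Fin k → ι with R (Fin.cons v.1 y), ∏ i, d (y i) ≤ Z.card := by
    rw [card_eq_sum_card_fiberwise (f := fun z i => (z i).1) (s := Z)
      (t := univ.filter fun y : Fin k → ι => R (Fin.cons v.1 y))
      (fun z hz => by simpa using (mem_filter.1 hz).2)]
    refine sum_le_sum fun y hy => ?_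
    have : ∏ i, d (y i) = (Fintype.piFinset fun i => (range (d (y i))).image (Prod.mk (y i))).card := by
      rw [Fintype.card_piFinset]
      refine prod_congr rfl fun i _ => ?_
      rw [card_image_of_injective _ (Prod.mk_right_injective _), card_range]
    rw [this]
    refine card_le_card fun z hz => ?_
    have hz' : ∀ i, (z i).1 = y i ∧ (z i).2 < d (y i) := by
      intro i
      have := Fintype.mem_piFinset.1 hz i
      obtain ⟨j, hj, h⟩ := mem_image.1 this
      rw [← h]
      exact ⟨rfl, mem_range.1 hj⟩
    have hzy : (fun i => (z i).1) = y := funext fun i => (hz' i).1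
    simp only [hZ, mem_filter, Fintype.mem_piFinset]
    refine ⟨⟨fun i => ?_, ?_⟩, hzy⟩
    · rw [hP, mem_blowupGraph_vertices, (hz' i).1]
      exact (hz' i).2
    · rw [hzy]
      exact (mem_filter.1 hy).2
  have himage : Z.image (fun z => univ.image (Fin.cons v z : Fin (k + 1) → ι × ℕ)) ⊆
      P.edges.filter fun S => {v} ⊆ S := by
    intro S hS
    obtain ⟨z, hz, rfl⟩ := mem_image.1 hS
    rw [mem_filter, singleton_subset_iff]
    refine ⟨?_, mem_image.2 ⟨0, mem_univ _, rfl⟩⟩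
    rw [hP, blowupGraph, mem_filter, mem_powersetCard]
    refine ⟨⟨?_, ?_⟩, Fin.cons v z, rfl, ?_⟩
    · intro x hx
      obtain ⟨i, _, rfl⟩ := mem_image.1 hx
      change _ ∈ P.vertices
      refine Fin.cases ?_ (fun i => ?_) i
      · exact hv
      · exact Fintype.mem_piFinset.1 (mem_filter.1 hz).1 i
    · rw [card_image_of_injective _ (hinj z hz)]
      simp
    · rw [hcons]
      exact (mem_filter.1 hz).2
  refine h1.trans ((card_le_mul_card_image Z k.factorial ?_).trans
    (Nat.mul_le_mul_left _ (card_le_card himage)))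
  intro S hS
  have hS' := mem_filter.1 (himage hS)
  have hSc : (S.erase v).card = k := by
    rw [card_erase_of_mem (singleton_subset_iff.1 hS'.2), P.edge_card S hS'.1]
    rfl
  have := card_injective_piFinset k (S.erase v)
  rw [hSc, Nat.descFactorial_self] at this
  rw [← this]
  refine card_le_card fun z hz => ?_
  obtain ⟨hzZ, hzS⟩ := mem_filter.1 hz
  have hi := hinj z hzZ
  rw [Fin.cons_injective_iff] at hi
  rw [mem_filter, Fintype.mem_piFinset]
  refine ⟨fun i => mem_erase.2 ⟨fun h => hi.1 ⟨i, h⟩, ?_⟩, hi.2⟩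
  rw [← hzS]
  exact mem_image.2 ⟨i.succ, mem_univ _, by simp⟩

/-- Each matching edge projects to a tuple in `R`. Every copy of `X` is covered exactly once, so the
positions with value `X` correspond to its `d X` copies. -/
theorem exists_cover_of_perfectMatching (hR : ∀ t, R t → Function.Injective t)
    (h : (blowupGraph k R d).HasPerfectMatching) :
    ∃ (J : Type) (_ : Fintype J) (_ : DecidableEq J) (τ : J → Fin (k + 1) → ι), (∀ j, R (τ j)) ∧
      ∀ X, (univ.filter fun p : J × Fin (k + 1) => τ p.1 p.2 = X).card = d X := by
  classical
  obtain ⟨M, h1, h2, h3⟩ := h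
  have hex : ∀ S : M, ∃ t : Fin (k + 1) → ι × ℕ, univ.image t = S.1 ∧ R (fun i => (t i).1) :=
    fun S => (mem_filter.1 (h1 S.2)).2
  choose t ht htR using hex
  have hmem : ∀ (S : M) i, t S i ∈ S.1 := fun S i => by
    rw [← ht S]; exact mem_image_of_mem _ (mem_univ i)
  refine ⟨M, inferInstance, inferInstance, fun S i => (t S i).1, htR, fun X => ?_⟩
  have hd : d X = ((range (d X)).image (Prod.mk X)).card := by
    rw [card_image_of_injective _ (Prod.mk_right_injective X), card_range]
  rw [hd]
  refine card_bij (fun p _ => t p.1 p.2) ?_ ?_ ?_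
  · rintro ⟨S, i⟩ hp
    have hX : (t S i).1 = X := (mem_filter.1 hp).2
    have := (blowupGraph k R d).edge_subset _ (h1 S.2) (hmem S i)
    rw [mem_blowupGraph_vertices, hX] at this
    refine mem_image.2 ⟨(t S i).2, mem_range.2 this, ?_⟩
    rw [← hX]
  · rintro ⟨S, i⟩ _ ⟨T, j⟩ _ hij
    have hij : t S i = t T j := hij
    have hST : S = T := by
      by_contra hne
      have := h2 S.1 S.2 T.1 T.2 fun h => hne (Subtype.ext h)
      exact disjoint_left.1 this (hmem S i) (hij ▸ hmem T j)
    subst hST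
    have : i = j := hR _ (htR S) (by simp only [hij])
    rw [this]
  · intro p hp
    obtain ⟨j, hj, rfl⟩ := mem_image.1 hp
    obtain ⟨S, hS, hpS⟩ := h3 (X, j) (by
      rw [mem_blowupGraph_vertices]; exact mem_range.1 hj)
    replace hpS : (X, j) ∈ univ.image (t ⟨S, hS⟩) := by rwa [ht ⟨S, hS⟩]
    obtain ⟨i, _, hi⟩ := mem_image.1 hpS
    exact ⟨(⟨S, hS⟩, i), by simp [hi], hi⟩

open Classical in
/-- A relation whose degrees exceed the matching threshold has, for nearly constant weights,
a family of tuples covering every element as often as its weight. -/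
theorem exists_cover_of_degree (k : ℕ) {μ : ℝ} (hμ : 0 < μ) : ∃ ε : ℝ, 0 < ε ∧ ∃ N₀ : ℕ,
    ∀ (ι : Type) [Fintype ι] [DecidableEq ι] (R : (Fin (k + 1) → ι) → Prop) (d : ι → ℕ) (D : ℕ),
      N₀ ≤ Fintype.card ι → (∀ t, R t → Function.Injective t) → 0 < D →
      (∀ X, (matchingThreshold (k + 1) + μ) * (Fintype.card ι : ℝ) ^ k ≤
        (univ.filter fun y : Fin k → ι => R (Fin.cons X y)).card) →
      (∀ X, d X ≤ D) → (∀ X, (1 - ε) * D ≤ d X) → (k + 1) ∣ ∑ X, d X →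
      ∃ (J : Type) (_ : Fintype J) (_ : DecidableEq J) (τ : J → Fin (k + 1) → ι),
        (∀ j, R (τ j)) ∧
        ∀ X, (univ.filter fun p : J × Fin (k + 1) => τ p.1 p.2 = X).card = d X := by
  obtain ⟨n₀, hn₀⟩ := exists_perfectMatching_of_threshold k (half_pos hμ)
  set θ := matchingThreshold (k + 1) with hθ
  have hθ0 : 0 ≤ θ := matchingThreshold_nonneg _
  have hθ1 : θ ≤ 1 := matchingThreshold_le_one _
  -- The bound `1 / 2` keeps the blow-up large. The other bound gives, by Bernoulli's inequality and
  -- `θ ≤ 1`, that shrinking all loads by `1 - ε` costs at most `μ / 2` of the degree.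
  set ε : ℝ := min (1 / 2) (μ / (2 * (1 + μ) * (k + 1))) with hε
  have hε0 : 0 < ε := lt_min (by norm_num) (by positivity)
  have hε1 : ε ≤ 1 / 2 := min_le_left _ _
  have hε2 : θ + μ / 2 ≤ (θ + μ) * (1 - ε) ^ k := by
    have hb : 1 - k * ε ≤ (1 - ε) ^ k := by
      have := one_add_mul_le_pow (show (-2 : ℝ) ≤ -ε by linarith) k
      rw [← sub_eq_add_neg] at this
      linarith
    have hk : k * ε * (1 + μ) ≤ μ / 2 := by
      have h1 : ε ≤ μ / (2 * (1 + μ) * (k + 1)) := min_le_right _ _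
      rw [le_div_iff₀ (by positivity)] at h1
      have : 0 ≤ ε * (1 + μ) := by positivity
      nlinarith
    have hk0 : 0 ≤ k * ε := by positivity
    nlinarith
  refine ⟨ε, hε0, 2 * n₀ + 1, fun ι _ _ R d D hN hR hD hdeg hdD hdε hdvd => ?_⟩
  refine exists_cover_of_perfectMatching hR ?_
  have hNpos : (0 : ℝ) < Fintype.card ι := by exact_mod_cast (by omega : 0 < Fintype.card ι)
  have hD1 : (1 : ℝ) ≤ D := by exact_mod_cast hD
  have hlow : ∀ X, 1 / 2 * (D : ℝ) ≤ d X := fun X =>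
    le_trans (mul_le_mul_of_nonneg_right (by linarith) (by linarith)) (hdε X)
  have hsum : (Fintype.card ι : ℝ) * (1 / 2) ≤ ((∑ X, d X : ℕ) : ℝ) := by
    push_cast
    rw [← nsmul_eq_mul, ← card_univ]
    exact card_nsmul_le_sum _ _ _ fun X _ => le_trans (by linarith) (hlow X)
  have hsum' : ((∑ X, d X : ℕ) : ℝ) ≤ Fintype.card ι * D := by
    push_cast
    rw [← nsmul_eq_mul, ← card_univ]
    exact sum_le_card_nsmul _ _ _ fun X _ => by exact_mod_cast hdD X
  have hn : n₀ ≤ ∑ X, d X := by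
    have h1 : (2 * n₀ + 1 : ℝ) ≤ Fintype.card ι := by exact_mod_cast hN
    have : (n₀ : ℝ) ≤ ((∑ X, d X : ℕ) : ℝ) := by linarith
    exact_mod_cast this
  have hne : (blowupGraph k R d).vertices.Nonempty := by
    rw [← card_pos, card_blowupGraph_vertices]
    have : (0 : ℝ) < ((∑ X, d X : ℕ) : ℝ) := by linarith
    exact_mod_cast this
  -- The threshold is defined by graphs on types in the lowest universe, which is why cluster
  -- indices live in `Type` while the vertices of `H` need not.
  refine hn₀ _ hn hdvd (ι × ℕ) _ card_blowupGraph_vertices ?_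
  obtain ⟨v, hv, hvd⟩ := (blowupGraph k R d).exists_degree_eq_minDegree_one hne
  refine le_trans ?_ (Nat.cast_le.2 hvd)
  have hfac : (0 : ℝ) < k.factorial := by exact_mod_cast k.factorial_pos
  have h1 := sum_prod_le_degree_blowupGraph hR hv
  have h2 : (θ + μ) * (Fintype.card ι : ℝ) ^ k * ((1 - ε) * D) ^ k ≤
      k.factorial * (blowupGraph k R d).degree {v} := by
    calc (θ + μ) * (Fintype.card ι : ℝ) ^ k * ((1 - ε) * D) ^ k
        ≤ (univ.filter fun y : Fin k → ι => R (Fin.cons v.1 y)).card * ((1 - ε) * D) ^ k :=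
          mul_le_mul_of_nonneg_right (hdeg v.1)
            (pow_nonneg (mul_nonneg (by linarith) (by linarith)) k)
      _ ≤ ∑ y : Fin k → ι with R (Fin.cons v.1 y), ∏ i, (d (y i) : ℝ) := by
          rw [← nsmul_eq_mul]
          refine card_nsmul_le_sum _ _ _ fun y _ => ?_
          have : ((1 - ε) * D) ^ k = ∏ _i : Fin k, ((1 - ε) * D) := by simp
          rw [this]
          exact prod_le_prod (fun _ _ => mul_nonneg (by linarith) (by linarith))
            fun i _ => hdε (y i)
      _ ≤ _ := by exact_mod_cast h1
  rw [← mul_le_mul_iff_right₀ hfac]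
  refine le_trans ?_ h2
  have h3 : (((∑ X, d X) - 1).choose k : ℝ) ≤ (Fintype.card ι * D : ℝ) ^ k / k.factorial := by
    refine (Nat.choose_le_pow_div k _).trans ?_
    gcongr
    refine le_trans ?_ hsum'
    exact_mod_cast Nat.sub_le _ _
  rw [le_div_iff₀ hfac] at h3
  calc (k.factorial : ℝ) * ((θ + μ / 2) * (((∑ X, d X) - 1).choose k : ℝ))
      = (θ + μ / 2) * ((((∑ X, d X) - 1).choose k : ℝ) * k.factorial) := by ring
    _ ≤ ((θ + μ) * (1 - ε) ^ k) * (Fintype.card ι * D : ℝ) ^ k :=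
        mul_le_mul hε2 h3 (by positivity) (by
          have : 0 ≤ 1 - ε := by linarith
          positivity)
    _ = _ := by rw [mul_pow, mul_pow]; ring

end ReducedMatching

/-! ### Falling factorials and disjoint pieces. -/

theorem exists_le_descFactorial (k : ℕ) {ε : ℝ} (hε : 0 < ε) : ∃ N₀ : ℕ, 0 < N₀ ∧ ∀ N : ℕ, N₀ ≤ N →
    (1 - ε) * (N : ℝ) ^ k ≤ ((N - 1).descFactorial k : ℝ) := by
  obtain ⟨N₀, hN₀⟩ := exists_nat_ge ((k : ℝ) * k / ε)
  rw [div_le_iff₀ hε] at hN₀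
  refine ⟨N₀ + k + 1, by omega, fun N hN => ?_⟩
  have hNk : k ≤ N := by omega
  have hN0 : (0 : ℝ) < N := by exact_mod_cast (by omega : 0 < N)
  have h1 : ((N - k : ℕ) : ℝ) ^ k ≤ ((N - 1).descFactorial k : ℝ) := by
    have := Nat.pow_sub_le_descFactorial (N - 1) k
    rw [Nat.sub_add_cancel (by omega)] at this
    exact_mod_cast this
  refine le_trans ?_ h1
  rw [Nat.cast_sub hNk]
  have h2 : (N : ℝ) - k = N * (1 + -(k / N)) := by field_simp; ring
  rw [h2, mul_pow, mul_comm]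
  refine mul_le_mul_of_nonneg_left ?_ (by positivity)
  have h3 : (k : ℝ) / N ≤ 1 := by
    rw [div_le_one hN0]; exact_mod_cast hNk
  refine le_trans ?_ (one_add_mul_le_pow (by linarith) k)
  have h4 : (k : ℝ) * (k / N) ≤ ε := by
    rw [mul_div_assoc', div_le_iff₀ hN0]
    have : (N₀ : ℝ) ≤ N := by exact_mod_cast (by omega : N₀ ≤ N)
    nlinarith
  linarith

theorem one_sub_mul_le_pow {x : ℝ} (hx : x ≤ 1) (k : ℕ) : 1 - k * x ≤ (1 - x) ^ k := by
  have := one_add_mul_le_pow (show (-2 : ℝ) ≤ -x by linarith) k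
  rw [← sub_eq_add_neg] at this
  linarith

/-- A large set contains disjoint pieces of prescribed size. -/
theorem exists_disjoint_pieces {V : Type*} [DecidableEq V] {ι : Type*} [Fintype ι]
    [DecidableEq ι] (c : ℕ) (A : Finset V) (h : Fintype.card ι * c ≤ A.card) :
    ∃ f : ι → Finset V, (∀ i, f i ⊆ A) ∧ (∀ i, (f i).card = c) ∧
      ∀ i j, i ≠ j → Disjoint (f i) (f j) := by
  suffices ∀ I : Finset ι, I.card * c ≤ A.card → ∃ f : ι → Finset V, (∀ i ∈ I, f i ⊆ A) ∧
      (∀ i ∈ I, (f i).card = c) ∧ ∀ i ∈ I, ∀ j ∈ I, i ≠ j → Disjoint (f i) (f j) by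
    obtain ⟨f, h1, h2, h3⟩ := this univ (by rwa [card_univ])
    exact ⟨f, fun i => h1 i (mem_univ i), fun i => h2 i (mem_univ i),
      fun i j => h3 i (mem_univ i) j (mem_univ j)⟩
  intro I
  induction I using Finset.induction_on with
  | empty => exact fun _ => ⟨fun _ => ∅, by simp, by simp, by simp⟩
  | insert a I ha ih =>
    intro hI
    rw [card_insert_of_notMem ha, add_mul, one_mul] at hI
    obtain ⟨f, h1, h2, h3⟩ := ih (by omega)
    have hU : (I.biUnion f).card = I.card * c := by
      rw [card_biUnion fun i hi j hj hij => h3 i hi j hj hij, sum_congr rfl h2, sum_const,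
        smul_eq_mul]
    obtain ⟨B, hB, hBc⟩ := exists_subset_card_eq (s := A \ I.biUnion f) (n := c) (by
      have := le_card_sdiff (I.biUnion f) A
      omega)
    have hBd : ∀ i ∈ I, Disjoint B (f i) := fun i hi =>
      disjoint_of_subset_left hB (disjoint_of_subset_right (subset_biUnion_of_mem f hi)
        sdiff_disjoint)
    have hne : ∀ i ∈ I, i ≠ a := fun i hi h => ha (h ▸ hi)
    refine ⟨Function.update f a B, ?_, ?_, ?_⟩
    · intro i hi
      rcases mem_insert.1 hi with rfl | hi
      · simpa using hB.trans sdiff_subset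
      · simpa [hne i hi] using h1 i hi
    · intro i hi
      rcases mem_insert.1 hi with rfl | hi
      · simpa using hBc
      · simpa [hne i hi] using h2 i hi
    · intro i hi j hj hij
      rcases mem_insert.1 hi with rfl | hi <;> rcases mem_insert.1 hj with rfl | hj
      · exact absurd rfl hij
      · simpa [hne j hj] using hBd j hj
      · simpa [hne i ‹_›] using (hBd i ‹_›).symm
      · simpa [hne i hi, hne j hj] using h3 i hi j hj hij

/-! ### Good degree, clusters and the reduced structure. -/

namespace MDigraph

variable {m k : ℕ} {V : Type u} [DecidableEq V] {ι : Type}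

open Classical in
/-- Every vertex is the first entry of at least `δ * n ^ k` good `(k + 1)`-tuples. -/
def GoodDegree (H : MDigraph m V) (k : ℕ) (δ : ℝ) : Prop :=
  ∀ v ∈ H.vertices, δ * (H.vertices.card : ℝ) ^ k ≤
    ((Fintype.piFinset fun _ : Fin k => H.vertices).filter
      fun z => H.IsGoodTuple (Fin.cons v z : Fin (k + 1) → V)).card

theorem mem_propertyGraph_edges {H : MDigraph m V} {Q : Set (MDigraph m V)} {s : ℕ}
    {S : Finset V} : S ∈ (H.propertyGraph Q s).edges ↔
      S ⊆ H.vertices ∧ S.card = s ∧ H.induce S ∈ Q := by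
  simp only [propertyGraph, mem_filter, mem_powersetCard, and_assoc]

-- Each edge of the property graph through `v` yields `k!` orderings of its other vertices, all good
-- after prefixing `v`. Distinct edges give distinct tuples, since a tuple determines the edge as
-- its image.
open Classical in
theorem factorial_mul_minDegree_le (hm : 0 < m) (H : MDigraph m V) (k : ℕ) {v : V}
    (hv : v ∈ H.vertices) :
    k.factorial * (H.propertyGraph (Spa m V ∩ Div m V ∩ Cov m V) (k + 1)).minDegree 1 ≤
      ((Fintype.piFinset fun _ : Fin k => H.vertices).filter
        fun z => H.IsGoodTuple (Fin.cons v z : Fin (k + 1) → V)).card := by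
  set P := H.propertyGraph (Spa m V ∩ Div m V ∩ Cov m V) (k + 1) with hP
  refine (Nat.mul_le_mul_left _ (P.minDegree_one_le (v := v) hv)).trans ?_
  set Q : Finset V → Finset (Fin k → V) := fun S =>
    (Fintype.piFinset fun _ : Fin k => S.erase v).filter fun z => Function.Injective z with hQ
  have himage : ∀ S, v ∈ S → S.card = k + 1 → ∀ z ∈ Q S,
      Function.Injective (Fin.cons v z : Fin (k + 1) → V) ∧
        univ.image (Fin.cons v z : Fin (k + 1) → V) = S := by
    intro S hvS hS z hz
    have hz' := mem_filter.1 hz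
    have hz1 := Fintype.mem_piFinset.1 hz'.1
    have hinj : Function.Injective (Fin.cons v z : Fin (k + 1) → V) := by
      rw [Fin.cons_injective_iff]
      refine ⟨?_, hz'.2⟩
      rintro ⟨i, hi⟩
      exact notMem_erase v S (hi ▸ hz1 i)
    refine ⟨hinj, eq_of_subset_of_card_le ?_ ?_⟩
    · intro x hx
      obtain ⟨i, _, rfl⟩ := mem_image.1 hx
      refine Fin.cases ?_ (fun i => ?_) i
      · exact hvS
      · exact mem_of_mem_erase (hz1 i)
    · rw [card_image_of_injective _ hinj, hS]
      simp
  have hS : ∀ S ∈ P.edges.filter fun S => {v} ⊆ S, v ∈ S ∧ S.card = k + 1 := fun S hS =>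
    ⟨singleton_subset_iff.1 (mem_filter.1 hS).2, P.edge_card S (mem_filter.1 hS).1⟩
  have hcard : ∀ S ∈ P.edges.filter fun S => {v} ⊆ S, (Q S).card = k.factorial := by
    intro S hSm
    rw [hQ, card_injective_piFinset, card_erase_of_mem (hS S hSm).1, (hS S hSm).2]
    exact Nat.descFactorial_self k
  calc k.factorial * P.degree {v}
      = ∑ S ∈ P.edges.filter fun S => {v} ⊆ S, (Q S).card := by
        rw [sum_congr rfl hcard, sum_const, smul_eq_mul, mul_comm]; rfl
    _ = ((P.edges.filter fun S => {v} ⊆ S).biUnion Q).card := by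
        rw [card_biUnion]
        intro S hSm T hTm hST
        rw [Function.onFun, disjoint_left]
        intro z hzS hzT
        exact hST ((himage S (hS S hSm).1 (hS S hSm).2 z hzS).2.symm.trans
          (himage T (hS T hTm).1 (hS T hTm).2 z hzT).2)
    _ ≤ _ := by
        refine card_le_card fun z hz => ?_
        obtain ⟨S, hSm, hz⟩ := mem_biUnion.1 hz
        obtain ⟨h1, h2⟩ := himage S (hS S hSm).1 (hS S hSm).2 z hz
        have hSP := mem_propertyGraph_edges.1 (mem_filter.1 hSm).1
        have hmem : ∀ i, (Fin.cons v z : Fin (k + 1) → V) i ∈ H.vertices := fun i =>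
          hSP.1 (h2 ▸ mem_image_of_mem _ (mem_univ i))
        refine mem_filter.2 ⟨Fintype.mem_piFinset.2 fun i => by simpa using hmem i.succ, ?_⟩
        refine isGoodTuple_of_induce hm H h1 hmem ?_
        rw [h2]
        exact hSP.2.2

theorem exists_goodDegree (k : ℕ) (hm : 0 < m) {μ : ℝ} (hμ : 0 < μ) : ∃ n₀ : ℕ, 0 < n₀ ∧
    ∀ (V : Type u) [DecidableEq V] (H : MDigraph m V), n₀ ≤ H.vertices.card →
      (matchingThreshold (k + 1) + μ) * ((H.vertices.card - 1).choose k : ℝ) ≤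
        ((H.propertyGraph (Spa m V ∩ Div m V ∩ Cov m V) (k + 1)).minDegree 1 : ℝ) →
      H.GoodDegree k (matchingThreshold (k + 1) + μ / 2) := by
  set θ := matchingThreshold (k + 1)
  have hθ0 : 0 ≤ θ := matchingThreshold_nonneg _
  have hθ1 : θ ≤ 1 := matchingThreshold_le_one _
  -- As `θ ≤ 1`, a relative loss of `μ / (2 * (1 + μ))` lowers `θ + μ` by at most `μ / 2`.
  obtain ⟨n₀, hpos, hn₀⟩ := exists_le_descFactorial k
    (show 0 < μ / (2 * (1 + μ)) by positivity)
  refine ⟨n₀, hpos, fun V _ H hn hdeg v hv => ?_⟩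
  have h1 := hn₀ _ hn
  have h2 := Nat.cast_le (α := ℝ).2 (factorial_mul_minDegree_le hm H k hv)
  rw [Nat.cast_mul] at h2
  refine le_trans ?_ h2
  have h3 := mul_le_mul_of_nonneg_left hdeg (Nat.cast_nonneg (α := ℝ) k.factorial)
  refine le_trans ?_ h3
  rw [mul_left_comm, ← Nat.cast_mul, ← Nat.descFactorial_eq_factorial_mul_choose]
  refine le_trans ?_ (mul_le_mul_of_nonneg_left h1 (by positivity))
  rw [← mul_assoc]
  refine mul_le_mul_of_nonneg_right ?_ (by positivity)
  have : μ / (2 * (1 + μ)) * (1 + μ) = μ / 2 := by field_simp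
  have h4 : 0 < μ / (2 * (1 + μ)) := by positivity
  nlinarith

/-- Disjoint sets of `b` vertices each. -/
structure IsClustering (H : MDigraph m V) (W : ι → Finset V) (b : ℕ) : Prop where
  subset : ∀ X, W X ⊆ H.vertices
  disj : ∀ X Y, X ≠ Y → Disjoint (W X) (W Y)
  card : ∀ X, (W X).card = b

theorem IsClustering.card_biUnion [Fintype ι] {H : MDigraph m V} {W : ι → Finset V} {b : ℕ}
    (hW : H.IsClustering W b) : (univ.biUnion W).card = Fintype.card ι * b := by
  rw [Finset.card_biUnion fun X _ Y _ h => hW.disj X Y h, sum_congr rfl fun X _ => hW.card X]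
  simp

theorem IsClustering.card_mul_le [Fintype ι] {H : MDigraph m V} {W : ι → Finset V} {b : ℕ}
    (hW : H.IsClustering W b) : Fintype.card ι * b ≤ H.vertices.card := by
  rw [← hW.card_biUnion]
  exact card_le_card (biUnion_subset.2 fun X _ => hW.subset X)

open Classical in
/-- One-to-one tuples of clusters with a proportion of at least `α` good transversals. -/
def IsDense (H : MDigraph m V) (W : ι → Finset V) (b : ℕ) (α : ℝ) (τ : Fin (k + 1) → ι) : Prop :=
  Function.Injective τ ∧ α * (b : ℝ) ^ (k + 1) ≤
    ((Fintype.piFinset fun i => W (τ i)).filter fun u => H.IsGoodTuple u).card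

open Classical in
theorem GoodDegree.mul_le_card {H : MDigraph m V} {δ : ℝ} (hH : H.GoodDegree k δ)
    {W : ι → Finset V} {b : ℕ} (hW : H.IsClustering W b) (X : ι) :
    b * (δ * (H.vertices.card : ℝ) ^ k) ≤ ((Fintype.piFinset
      (Fin.cons (W X) fun _ => H.vertices : Fin (k + 1) → Finset V)).filter
        fun u => H.IsGoodTuple u).card := by
  rw [← card_piFinset_cons_fiber _ _ (filter_subset _ _)]
  push_cast
  rw [← hW.card X, ← nsmul_eq_mul]
  refine card_nsmul_le_sum _ _ _ fun v hv => (hH v (hW.subset X hv)).trans ?_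
  refine Nat.cast_le.2 (card_le_card fun z hz => ?_)
  obtain ⟨h1, h2⟩ := mem_filter.1 hz
  refine mem_filter.2 ⟨by simpa using h1, mem_filter.2 ⟨?_, h2⟩⟩
  rw [Fintype.mem_piFinset]
  intro i
  refine Fin.cases ?_ (fun i => ?_) i
  · exact hv
  · exact Fintype.mem_piFinset.1 h1 i

open Classical in
theorem card_not_injective_cons [Fintype ι] [DecidableEq ι] (X : ι) {ε : ℝ}
    (h : (1 - ε) * (Fintype.card ι : ℝ) ^ k ≤ ((Fintype.card ι - 1).descFactorial k : ℝ)) :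
    ((univ.filter fun y : Fin k → ι =>
      ¬ Function.Injective (Fin.cons X y : Fin (k + 1) → ι)).card : ℝ) ≤
      ε * (Fintype.card ι : ℝ) ^ k := by
  have h1 : (Fintype.card ι - 1).descFactorial k ≤ (univ.filter fun y : Fin k → ι =>
      Function.Injective (Fin.cons X y : Fin (k + 1) → ι)).card := by
    have := card_injective_piFinset k ((univ : Finset ι).erase X)
    rw [card_erase_of_mem (mem_univ X), card_univ] at this
    rw [← this]
    refine card_le_card fun y hy => ?_
    obtain ⟨h1, h2⟩ := mem_filter.1 hy
    rw [mem_filter, Fin.cons_injective_iff]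
    refine ⟨mem_univ _, ?_, h2⟩
    rintro ⟨i, hi⟩
    exact notMem_erase X univ (hi ▸ Fintype.mem_piFinset.1 h1 i)
  have h2 := card_filter_add_card_filter_not (s := (univ : Finset (Fin k → ι)))
    (fun y => Function.Injective (Fin.cons X y : Fin (k + 1) → ι))
  rw [card_univ, Fintype.card_fun, Fintype.card_fin] at h2
  have h3 : ((univ.filter fun y : Fin k → ι =>
      Function.Injective (Fin.cons X y : Fin (k + 1) → ι)).card : ℝ) +
      ((univ.filter fun y : Fin k → ι =>
      ¬ Function.Injective (Fin.cons X y : Fin (k + 1) → ι)).card : ℝ) =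
      (Fintype.card ι : ℝ) ^ k := by exact_mod_cast h2
  have h4 : ((Fintype.card ι - 1).descFactorial k : ℝ) ≤ ((univ.filter fun y : Fin k → ι =>
      Function.Injective (Fin.cons X y : Fin (k + 1) → ι)).card : ℝ) := by exact_mod_cast h1
  linarith

open Classical in
/-- The reduced structure inherits the degree condition. -/
theorem exists_degree_isDense (k : ℕ) {μ : ℝ} (hμ : 0 < μ) (hμ1 : μ ≤ 1) : ∃ N₀ : ℕ,
    ∀ (m : ℕ) (V : Type u) [DecidableEq V] (H : MDigraph m V) (ι : Type) [Fintype ι]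
      [DecidableEq ι] (W : ι → Finset V) (b : ℕ) (δ : ℝ), 0 ≤ δ → 0 < b → H.IsClustering W b →
      N₀ ≤ Fintype.card ι → H.GoodDegree k (δ + μ) →
      (1 - μ / (8 * (k + 1))) * (H.vertices.card : ℝ) ≤ Fintype.card ι * b →
      ∀ X, (δ + μ / 2) * (Fintype.card ι : ℝ) ^ k ≤
        (univ.filter fun y : Fin k → ι =>
          H.IsDense W b (μ / 8) (Fin.cons X y : Fin (k + 1) → ι)).card := by
  obtain ⟨N₀, _, hN₀⟩ := exists_le_descFactorial k (show 0 < μ / 8 by positivity)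
  refine ⟨N₀, fun m V _ H ι _ _ W b δ hδ hb hW hN hdeg hcov X => ?_⟩
  set n : ℝ := (H.vertices.card : ℝ) with hn
  set N : ℝ := (Fintype.card ι : ℝ) with hNdef
  have hbR : (0 : ℝ) < b := by exact_mod_cast hb
  have hNbn : N * b ≤ n := by
    rw [hNdef, hn]; exact_mod_cast hW.card_mul_le
  have hnoninj := card_not_injective_cons (k := k) X (hN₀ _ hN)
  set dn := univ.filter fun y : Fin k → ι =>
    H.IsDense W b (μ / 8) (Fin.cons X y : Fin (k + 1) → ι) with hdn
  set ni := univ.filter fun y : Fin k → ι =>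
    ¬ Function.Injective (Fin.cons X y : Fin (k + 1) → ι) with hni
  set g : (Fin k → ι) → Finset (Fin (k + 1) → V) := fun y =>
    (Fintype.piFinset fun i => W ((Fin.cons X y : Fin (k + 1) → ι) i)).filter
      fun u => H.IsGoodTuple u with hg
  set B₁ := Fintype.piFinset (Fin.cons (W X) fun _ => H.vertices : Fin (k + 1) → Finset V)
  set B₂ := Fintype.piFinset (Fin.cons (W X) fun _ => univ.biUnion W : Fin (k + 1) → Finset V)
    with hB₂
  have hB21 : B₂ ⊆ B₁ := by
    refine Fintype.piFinset_subset _ _ fun i => ?_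
    refine Fin.cases ?_ (fun i => ?_) i
    · simp
    · simpa using fun X => hW.subset X
  have hB₁c : (B₁.card : ℝ) = b * n ^ k := by
    rw [Fintype.card_piFinset, Fin.prod_univ_succ]
    simp [hW.card, hn]
  have hB₂c : (B₂.card : ℝ) = b * (N * b) ^ k := by
    rw [Fintype.card_piFinset, Fin.prod_univ_succ]
    simp [hW.card, hW.card_biUnion, hNdef]
  -- A good tuple starting in `W X` either has all its entries in clusters, and so is a transversal
  -- of some cluster tuple, or has an entry outside of all clusters.
  have hsub : B₁.filter (fun u => H.IsGoodTuple u) ⊆ univ.biUnion g ∪ (B₁ \ B₂) := by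
    intro u hu
    obtain ⟨hu1, hu2⟩ := mem_filter.1 hu
    by_cases h : u ∈ B₂
    · refine mem_union_left _ (mem_biUnion.2 ?_)
      rw [hB₂, Fintype.mem_piFinset] at h
      have h' : ∀ i : Fin k, ∃ Y, u i.succ ∈ W Y := fun i => by simpa using h i.succ
      choose y hy using h'
      refine ⟨y, mem_univ _, mem_filter.2 ⟨Fintype.mem_piFinset.2 fun i => ?_, hu2⟩⟩
      refine Fin.cases ?_ (fun i => ?_) i
      · exact h 0
      · exact hy i
    · exact mem_union_right _ (mem_sdiff.2 ⟨hu1, h⟩)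
  -- A dense cluster tuple may contribute everything, a one-to-one tuple that is not dense at most
  -- the proportion `μ / 8`. Tuples with a repeated cluster are bounded trivially, being rare.
  have hgle : ∀ y, ((g y).card : ℝ) ≤ (b : ℝ) ^ (k + 1) * ((if y ∈ dn then 1 else 0) + μ / 8 +
      (if y ∈ ni then 1 else 0)) := by
    intro y
    have hb' : (0 : ℝ) ≤ (b : ℝ) ^ (k + 1) := by positivity
    have htriv : ((g y).card : ℝ) ≤ (b : ℝ) ^ (k + 1) := by
      have : (g y).card ≤ b ^ (k + 1) := by
        refine (card_filter_le _ _).trans ?_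
        rw [Fintype.card_piFinset, prod_congr rfl fun i _ => hW.card _]
        simp
      exact_mod_cast this
    by_cases h1 : y ∈ dn
    · rw [if_pos h1]
      split_ifs <;> nlinarith
    · by_cases h2 : y ∈ ni
      · rw [if_neg h1, if_pos h2]
        nlinarith
      · rw [if_neg h1, if_neg h2]
        have hinj : Function.Injective (Fin.cons X y : Fin (k + 1) → ι) := by
          by_contra h
          exact h2 (mem_filter.2 ⟨mem_univ _, h⟩)
        have : ¬ μ / 8 * (b : ℝ) ^ (k + 1) ≤ (g y).card := fun h =>
          h1 (mem_filter.2 ⟨mem_univ _, hinj, h⟩)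
        linarith
  have hsumg : ∑ y, ((g y).card : ℝ) ≤ (b : ℝ) ^ (k + 1) * (dn.card + μ / 8 * N ^ k + ni.card) := by
    refine (sum_le_sum fun y _ => hgle y).trans (le_of_eq ?_)
    rw [← mul_sum, sum_add_distrib, sum_add_distrib]
    congr 1
    simp [hNdef, mul_comm]
  have hupper : (((B₁.filter fun u => H.IsGoodTuple u).card : ℕ) : ℝ) ≤
      (b : ℝ) ^ (k + 1) * (dn.card + μ / 8 * N ^ k + ni.card) + (b * n ^ k - b * (N * b) ^ k) := by
    have h1 : (B₁.filter fun u => H.IsGoodTuple u).card ≤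
        (∑ y, (g y).card) + (B₁ \ B₂).card :=
      (card_le_card hsub).trans ((card_union_le _ _).trans
        (Nat.add_le_add_right card_biUnion_le _))
    have h2 : ((B₁ \ B₂).card : ℝ) = b * n ^ k - b * (N * b) ^ k := by
      rw [cast_card_sdiff hB21, hB₁c, hB₂c]
    have h3 : (((B₁.filter fun u => H.IsGoodTuple u).card : ℕ) : ℝ) ≤
        (∑ y, ((g y).card : ℝ)) + ((B₁ \ B₂).card : ℝ) := by exact_mod_cast h1
    rw [h2] at h3
    linarith
  have hlower := hdeg.mul_le_card hW X
  have hpow : (1 - μ / 8) * n ^ k ≤ (N * b) ^ k := by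
    have hη : μ / (8 * (k + 1)) ≤ 1 := by
      rw [div_le_one (by positivity)]
      have : (0 : ℝ) ≤ k := by positivity
      nlinarith
    have h1 := one_sub_mul_le_pow hη k
    have h2 : (k : ℝ) * (μ / (8 * (k + 1))) ≤ μ / 8 := by
      rw [mul_div_assoc', div_le_div_iff₀ (by positivity) (by positivity)]
      nlinarith
    have hn0 : (0 : ℝ) ≤ n := by positivity
    calc (1 - μ / 8) * n ^ k ≤ (1 - μ / (8 * (k + 1))) ^ k * n ^ k :=
          mul_le_mul_of_nonneg_right (by linarith) (by positivity)
      _ = ((1 - μ / (8 * (k + 1))) * n) ^ k := by rw [mul_pow]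
      _ ≤ _ := pow_le_pow_left₀ (mul_nonneg (by linarith) hn0) hcov k
  have hpow2 : (N * b) ^ k ≤ n ^ k := pow_le_pow_left₀ (by positivity) hNbn k
  -- Uncovered vertices cost `μ / 8`. Subtracting another `μ / 8` each for sparse and for repeated
  -- tuples leaves `δ + 5 * μ / 8`.
  have hfin : (b : ℝ) ^ (k + 1) * ((δ + 7 * μ / 8) * N ^ k) ≤
      (b : ℝ) ^ (k + 1) * (dn.card + μ / 8 * N ^ k + ni.card) := by
    have h1 : (b : ℝ) ^ (k + 1) * ((δ + 7 * μ / 8) * N ^ k) =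
        b * ((δ + 7 * μ / 8) * (N * b) ^ k) := by rw [mul_pow]; ring
    rw [h1]
    have h2 : (b : ℝ) * ((δ + 7 * μ / 8) * (N * b) ^ k) ≤ b * ((δ + 7 * μ / 8) * n ^ k) := by
      gcongr
    have h3 := mul_le_mul_of_nonneg_left hpow hbR.le
    linarith
  have := le_of_mul_le_mul_left hfin (by positivity)
  have hNk : 0 ≤ N ^ k := by positivity
  linarith

-- Deleting a proportion `α / (2 * (k + 1))` from each of the `k + 1` clusters destroys at most a
-- proportion `α / 2` of all transversals, hence at most half of the guaranteed good ones.
open Classical in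
theorem IsDense.card_filter_sdiff {H : MDigraph m V} {W : ι → Finset V} {b : ℕ} {α : ℝ}
    (hα : 0 < α) (hα1 : α ≤ 1) (hW : H.IsClustering W b) {τ : Fin (k + 1) → ι}
    (hτ : H.IsDense W b α τ) {A : Finset V}
    (hA : ∀ i, ((W (τ i) ∩ A).card : ℝ) ≤ α / (2 * (k + 1)) * b) :
    α / 2 * ∏ i, ((W (τ i) \ A).card : ℝ) ≤
      ((Fintype.piFinset fun i => W (τ i) \ A).filter fun u => H.IsGoodTuple u).card := by
  set ε := α / (2 * (k + 1)) with hε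
  have hεk : (k + 1) * ε = α / 2 := by rw [hε]; field_simp
  have hε0 : 0 < ε := by positivity
  have hε1 : ε ≤ 1 := by
    rw [hε, div_le_one (by positivity)]
    have : (0 : ℝ) ≤ k := by positivity
    linarith
  have hc : ∀ i, ((W (τ i) \ A).card : ℝ) = b - (W (τ i) ∩ A).card := by
    intro i
    have := card_sdiff_add_card_inter (W (τ i)) A
    rw [hW.card] at this
    rw [← this]; push_cast; ring
  have hP1 : (1 - α / 2) * (b : ℝ) ^ (k + 1) ≤ ∏ i, ((W (τ i) \ A).card : ℝ) := by
    have h1 : ((1 - ε) * b) ^ (k + 1) ≤ ∏ i, ((W (τ i) \ A).card : ℝ) := by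
      have : ((1 - ε) * b) ^ (k + 1) = ∏ _i : Fin (k + 1), ((1 - ε) * b) := by simp
      rw [this]
      refine prod_le_prod (fun i _ => mul_nonneg (by linarith) (by positivity)) fun i _ => ?_
      rw [hc]
      have := hA i
      linarith
    refine le_trans ?_ h1
    rw [mul_pow]
    refine mul_le_mul_of_nonneg_right ?_ (by positivity)
    have := one_sub_mul_le_pow hε1 (k + 1)
    push_cast at this
    rw [hεk] at this
    exact this
  have hP2 : ∏ i, ((W (τ i) \ A).card : ℝ) ≤ (b : ℝ) ^ (k + 1) := by
    have : (b : ℝ) ^ (k + 1) = ∏ _i : Fin (k + 1), (b : ℝ) := by simp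
    rw [this]
    refine prod_le_prod (fun i _ => by positivity) fun i _ => ?_
    rw [hc]
    have : (0 : ℝ) ≤ (W (τ i) ∩ A).card := by positivity
    linarith
  set F₁ := Fintype.piFinset fun i => W (τ i) with hF₁
  set F₂ := Fintype.piFinset fun i => W (τ i) \ A with hF₂
  have hF21 : F₂ ⊆ F₁ := Fintype.piFinset_subset _ _ fun i => sdiff_subset
  have hF₁c : (F₁.card : ℝ) = (b : ℝ) ^ (k + 1) := by
    rw [Fintype.card_piFinset, prod_congr rfl fun i _ => hW.card _]
    simp
  have hF₂c : (F₂.card : ℝ) = ∏ i, ((W (τ i) \ A).card : ℝ) := by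
    rw [Fintype.card_piFinset]; push_cast; rfl
  have hsub : F₁.filter (fun u => H.IsGoodTuple u) ⊆
      F₂.filter (fun u => H.IsGoodTuple u) ∪ (F₁ \ F₂) := by
    intro u hu
    obtain ⟨h1, h2⟩ := mem_filter.1 hu
    by_cases h : u ∈ F₂
    · exact mem_union_left _ (mem_filter.2 ⟨h, h2⟩)
    · exact mem_union_right _ (mem_sdiff.2 ⟨h1, h⟩)
  have h1 : ((F₁.filter fun u => H.IsGoodTuple u).card : ℝ) ≤
      (F₂.filter fun u => H.IsGoodTuple u).card + (F₁ \ F₂).card := by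
    exact_mod_cast (card_le_card hsub).trans (card_union_le _ _)
  rw [cast_card_sdiff hF21, hF₁c, hF₂c] at h1
  have h2 := hτ.2
  nlinarith

/-- A dense tuple of clusters of which only a small part is forbidden contains a blow-up. -/
theorem exists_isBlowup_of_isDense (m k c : ℕ) (hc : 0 < c) {α : ℝ} (hα : 0 < α) (hα1 : α ≤ 1) :
    ∃ b₀ : ℕ, 0 < b₀ ∧ ∀ (V : Type u) [DecidableEq V] (H : MDigraph m V) (ι : Type)
      (W : ι → Finset V) (b : ℕ) (τ : Fin (k + 1) → ι) (A : Finset V), b₀ ≤ b →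
      H.IsClustering W b → H.IsDense W b α τ →
      (∀ i, ((W (τ i) ∩ A).card : ℝ) ≤ α / (2 * (k + 1)) * b) →
      ∃ U : Fin (k + 1) → Finset V, (∀ i, U i ⊆ W (τ i) \ A) ∧ (∀ i, (U i).card = c) ∧
        ∃ E, IsGoodPattern E ∧ H.IsBlowup E U := by
  obtain ⟨b₀, hb₀, h⟩ := exists_isBlowup.{u} m (k + 1) c hc (α / 2) (by positivity)
  -- At least half of each cluster survives the deletion of `A`.
  refine ⟨2 * b₀, by omega, fun V _ H ι W b τ A hb hW hτ hA => ?_⟩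
  refine h V H (fun i => W (τ i) \ A) (fun i => ?_) ?_
  · have h1 := card_sdiff_add_card_inter (W (τ i)) A
    rw [hW.card] at h1
    have h2 := hA i
    have h3 : α / (2 * (k + 1)) ≤ 1 / 2 := by
      rw [div_le_div_iff₀ (by positivity) (by positivity)]
      have : (0 : ℝ) ≤ k := by positivity
      linarith
    have h4 : α / (2 * (k + 1)) * b ≤ 1 / 2 * b :=
      mul_le_mul_of_nonneg_right h3 (by positivity)
    have h5 : 2 * (W (τ i) ∩ A).card ≤ b := by
      have : (2 : ℝ) * (W (τ i) ∩ A).card ≤ b := by linarith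
      exact_mod_cast this
    omega
  · convert hτ.card_filter_sdiff hα hα1 hW hA

/-- Disjoint blow-ups in a family of dense tuples that loads no cluster too much. -/
theorem exists_disjoint_blowups (m k c : ℕ) (hc : 0 < c) {α : ℝ} (hα : 0 < α) (hα1 : α ≤ 1) :
    ∃ b₀ : ℕ, 0 < b₀ ∧ ∀ (V : Type u) [DecidableEq V] (H : MDigraph m V) (ι : Type)
      [DecidableEq ι] (W : ι → Finset V) (b : ℕ) (A : Finset V) (J : Type) [Fintype J]
      [DecidableEq J] (τ : J → Fin (k + 1) → ι), b₀ ≤ b →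
      H.IsClustering W b → (∀ j, H.IsDense W b α (τ j)) →
      (∀ X, ((W X ∩ A).card : ℝ) +
        c * (univ.filter fun p : J × Fin (k + 1) => τ p.1 p.2 = X).card ≤
          α / (2 * (k + 1)) * b) →
      ∃ K : J × Fin (k + 1) → Finset V, (∀ p, K p ⊆ W (τ p.1 p.2) \ A) ∧ (∀ p, (K p).card = c) ∧
        (∀ j, ∃ E, IsGoodPattern E ∧ H.IsBlowup E fun i => K (j, i)) ∧
        ∀ p q, p ≠ q → Disjoint (K p) (K q) := by
  obtain ⟨b₀, hb₀, h⟩ := exists_isBlowup_of_isDense.{u} m k c hc hα hα1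
  refine ⟨b₀, hb₀, fun V _ H ι _ W b A J _ _ τ hb hW hτ hA => ?_⟩
  suffices ∀ I : Finset J, ∃ K : J × Fin (k + 1) → Finset V,
      (∀ p, p.1 ∈ I → K p ⊆ W (τ p.1 p.2) \ A) ∧ (∀ p, p.1 ∈ I → (K p).card = c) ∧
      (∀ j ∈ I, ∃ E, IsGoodPattern E ∧ H.IsBlowup E fun i => K (j, i)) ∧
      ∀ p q, p.1 ∈ I → q.1 ∈ I → p ≠ q → Disjoint (K p) (K q) by
    obtain ⟨K, h1, h2, h3, h4⟩ := this univ
    exact ⟨K, fun p => h1 p (mem_univ _), fun p => h2 p (mem_univ _),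
      fun j => h3 j (mem_univ _), fun p q => h4 p q (mem_univ _) (mem_univ _)⟩
  intro I
  induction I using Finset.induction_on with
  | empty => exact ⟨fun _ => ∅, by simp, by simp, by simp, by simp⟩
  | insert a I ha ih =>
    obtain ⟨K, h1, h2, h3, h4⟩ := ih
    -- The blow-ups are chosen greedily and `B` collects the vertices already used. The assumed load
    -- bound counts all of `J`, so it applies at every stage.
    set B := (univ.filter fun p : J × Fin (k + 1) => p.1 ∈ I).biUnion K with hB
    have hload : ∀ X, (W X ∩ (A ∪ B)).card ≤
        (W X ∩ A).card + c * (univ.filter fun p : J × Fin (k + 1) => τ p.1 p.2 = X).card := by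
      intro X
      have hsub : W X ∩ (A ∪ B) ⊆ (W X ∩ A) ∪
          ((univ.filter fun p : J × Fin (k + 1) => p.1 ∈ I).filter
            fun p => τ p.1 p.2 = X).biUnion K := by
        intro x hx
        obtain ⟨hxW, hx⟩ := mem_inter.1 hx
        rcases mem_union.1 hx with hx | hx
        · exact mem_union_left _ (mem_inter.2 ⟨hxW, hx⟩)
        · obtain ⟨p, hp, hxp⟩ := mem_biUnion.1 hx
          refine mem_union_right _ (mem_biUnion.2 ⟨p, mem_filter.2 ⟨hp, ?_⟩, hxp⟩)
          by_contra hne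
          have := (mem_sdiff.1 (h1 p (mem_filter.1 hp).2 hxp)).1
          exact disjoint_left.1 (hW.disj _ _ hne) this hxW
      refine (card_le_card hsub).trans ((card_union_le _ _).trans (Nat.add_le_add_left ?_ _))
      refine card_biUnion_le.trans ?_
      rw [sum_congr rfl fun p hp => h2 p (mem_filter.1 (mem_filter.1 hp).1).2, sum_const,
        smul_eq_mul, mul_comm]
      refine Nat.mul_le_mul_left _ (card_le_card fun p hp => ?_)
      exact mem_filter.2 ⟨mem_univ _, (mem_filter.1 hp).2⟩
    obtain ⟨U, hU1, hU2, E, hE, hU3⟩ := h V H ι W b (τ a) (A ∪ B) hb hW (hτ a) fun i =>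
      le_trans (by exact_mod_cast hload (τ a i)) (hA (τ a i))
    have hUK : ∀ i p, p.1 ∈ I → Disjoint (U i) (K p) := by
      intro i p hp
      refine disjoint_of_subset_left (hU1 i) (disjoint_of_subset_right ?_ sdiff_disjoint)
      exact (subset_biUnion_of_mem K (mem_filter.2 ⟨mem_univ p, hp⟩)).trans subset_union_right
    have hne : ∀ j ∈ I, j ≠ a := fun j hj h => ha (h ▸ hj)
    refine ⟨fun p => if p.1 = a then U p.2 else K p, ?_, ?_, ?_, ?_⟩
    · rintro ⟨j, i⟩ hp
      rcases mem_insert.1 hp with hj | hj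
      · simp only at hj
        subst hj
        simp only [if_true]
        exact (hU1 i).trans (sdiff_subset_sdiff le_rfl subset_union_left)
      · simp only [hne j hj, if_false]
        exact h1 _ hj
    · rintro ⟨j, i⟩ hp
      rcases mem_insert.1 hp with hj | hj
      · simp only at hj
        subst hj
        simpa using hU2 i
      · simp only [hne j hj, if_false]
        exact h2 _ hj
    · intro j hj
      rcases mem_insert.1 hj with rfl | hj
      · exact ⟨E, hE, by simpa using hU3⟩
      · simpa [hne j hj] using h3 j hj
    · rintro ⟨j, i⟩ ⟨j', i'⟩ hp hq hpq
      rcases mem_insert.1 hp with hj | hj <;> rcases mem_insert.1 hq with hj' | hj'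
      · simp only at hj hj'
        subst hj
        subst hj'
        simpa using hU3.disj i i' fun h => hpq (by rw [h])
      · simp only at hj
        subst hj
        simpa [hne j' hj'] using hUK i (j', i') hj'
      · simp only at hj'
        subst hj'
        simpa [hne j hj] using (hUK i' (j, i) hj).symm
      · simpa [hne j hj, hne j' hj'] using h4 (j, i) (j', i') hj hj' hpq

end MDigraph

/-! ### Almost perfect tilings by blow-ups. -/

namespace MDigraph

variable {m k : ℕ} {V : Type u}

theorem IsBlowup.mono {s : ℕ} {H : MDigraph m V} {E : Finset (Fin m → Fin s)}
    {U U' : Fin s → Finset V} (hU : H.IsBlowup E U) (h : ∀ i, U' i ⊆ U i) : H.IsBlowup E U' :=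
  ⟨fun i => (h i).trans (hU.subset i),
    fun i j hij => disjoint_of_subset_left (h i) (disjoint_of_subset_right (h j) (hU.disj i j hij)),
    fun u hu => hU.edge u fun i => h i (hu i)⟩

/-- Disjoint blow-ups of good patterns with parts of size `b`. -/
structure IsTiling {ι : Type} (H : MDigraph m V) (W : ι → Fin (k + 1) → Finset V) (b : ℕ) :
    Prop where
  clustering : H.IsClustering (fun p : ι × Fin (k + 1) => W p.1 p.2) b
  tile : ∀ t, ∃ E, IsGoodPattern E ∧ H.IsBlowup E (W t)

/-- The tilings of large `m`-digraphs with large good degree cover a proportion `r` of the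
vertices. -/
def TilingProportion (m k : ℕ) (δ r : ℝ) : Prop :=
  ∀ b : ℕ, 0 < b → ∃ n₀ : ℕ, ∀ (V : Type u) [DecidableEq V] (H : MDigraph m V),
    n₀ ≤ H.vertices.card → H.GoodDegree k δ →
    ∃ (ι : Type) (_ : Fintype ι) (_ : DecidableEq ι) (W : ι → Fin (k + 1) → Finset V),
      H.IsTiling W b ∧ r * (H.vertices.card : ℝ) ≤ Fintype.card ι * ((k + 1) * b)

theorem tilingProportion_zero (m k : ℕ) (δ : ℝ) : TilingProportion.{u} m k δ 0 := by
  intro b _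
  refine ⟨0, fun V _ H _ _ => ⟨Empty, inferInstance, inferInstance, fun t => t.elim, ⟨⟨?_, ?_, ?_⟩, ?_⟩, ?_⟩⟩
  · exact fun p => p.1.elim
  · exact fun p => p.1.elim
  · exact fun p => p.1.elim
  · exact fun t => t.elim
  · simp

theorem TilingProportion.mono {δ r r' : ℝ} (h : TilingProportion.{u} m k δ r) (hr : r' ≤ r) :
    TilingProportion.{u} m k δ r' := by
  intro b hb
  obtain ⟨n₀, h⟩ := h b hb
  refine ⟨n₀, fun V _ H hn hdeg => ?_⟩
  obtain ⟨ι, i1, i2, W, hW, hc⟩ := h V H hn hdeg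
  exact ⟨ι, i1, i2, W, hW, le_trans (by gcongr) hc⟩

/-- A tiling together with disjoint pieces of the uncovered part form a clustering. -/
theorem IsTiling.sum_pieces {ι : Type} {H : MDigraph m V} {W : ι → Fin (k + 1) → Finset V} {b : ℕ}
    (hW : H.IsTiling W b) {κ : Type} {f : κ × Fin (k + 1) → Finset V}
    (hsub : ∀ p, f p ⊆ H.vertices) (hf : ∀ p t i, Disjoint (f p) (W t i))
    (hcard : ∀ p, (f p).card = b) (hdisj : ∀ p q, p ≠ q → Disjoint (f p) (f q)) :
    H.IsClustering (fun p : (ι ⊕ κ) × Fin (k + 1) =>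
      Sum.elim (fun t => W t p.2) (fun q => f (q, p.2)) p.1) b := by
  refine ⟨?_, ?_, ?_⟩
  · rintro ⟨t | q, i⟩
    · exact hW.clustering.subset (t, i)
    · exact hsub _
  · rintro ⟨t | q, i⟩ ⟨t' | q', i'⟩ hne
    · exact hW.clustering.disj (t, i) (t', i') fun h => hne (by
        simp only [Prod.mk.injEq] at h; rw [h.1, h.2])
    · exact (hf _ _ _).symm
    · exact hf _ _ _
    · exact hdisj _ _ fun h => hne (by
        simp only [Prod.mk.injEq] at h; rw [h.1, h.2])
  · rintro ⟨t | q, i⟩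
    · exact hW.clustering.card (t, i)
    · exact hcard _

variable [DecidableEq V]

/-- New blow-ups that take the same number of vertices from each part of a tiling, together with
the remainder of the tiling cut into blow-ups, form a finer tiling. -/
theorem IsTiling.refine {ι : Type} [DecidableEq ι] {H : MDigraph m V}
    {W : ι → Fin (k + 1) → Finset V} {b c r : ℕ} (hW : H.IsTiling W b) {J : Type} [Fintype J]
    {K : J × Fin (k + 1) → Finset V}
    (hK : ∀ p, (K p).card = c) (hKb : ∀ j, ∃ E, IsGoodPattern E ∧ H.IsBlowup E fun i => K (j, i))
    (hKd : ∀ p q, p ≠ q → Disjoint (K p) (K q))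
    (hrest : ∀ t i, r * c ≤ (W t i \ univ.biUnion K).card) :
    ∃ W' : J ⊕ ι × Fin r → Fin (k + 1) → Finset V, H.IsTiling W' c := by
  have hpieces : ∀ t i, ∃ f : Fin r → Finset V, (∀ x, f x ⊆ W t i \ univ.biUnion K) ∧
      (∀ x, (f x).card = c) ∧ ∀ x y, x ≠ y → Disjoint (f x) (f y) := fun t i =>
    exists_disjoint_pieces c _ (by simpa using hrest t i)
  choose F hF1 hF2 hF3 using hpieces
  have hKF : ∀ p t i x, Disjoint (K p) (F t i x) := fun p t i x =>
    disjoint_of_subset_right (hF1 t i x) (disjoint_of_subset_left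
      (subset_biUnion_of_mem K (mem_univ p)) disjoint_sdiff)
  have hFW : ∀ t i x, F t i x ⊆ W t i := fun t i x => (hF1 t i x).trans sdiff_subset
  refine ⟨Sum.elim (fun j i => K (j, i)) (fun q i => F q.1 i q.2), ⟨⟨?_, ?_, ?_⟩, ?_⟩⟩
  · rintro ⟨j | ⟨t, x⟩, i⟩
    · obtain ⟨E, _, h⟩ := hKb j
      exact h.subset i
    · exact (hFW t i x).trans (hW.clustering.subset (t, i))
  · rintro ⟨j | ⟨t, x⟩, i⟩ ⟨j' | ⟨t', x'⟩, i'⟩ hne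
    · exact hKd _ _ fun h => hne (by simp only [Prod.mk.injEq] at h; rw [h.1, h.2])
    · exact hKF _ _ _ _
    · exact (hKF _ _ _ _).symm
    · change Disjoint (F t i x) (F t' i' x')
      by_cases h : (t, i) = (t', i')
      · simp only [Prod.mk.injEq] at h
        obtain ⟨rfl, rfl⟩ := h
        exact hF3 t i x x' fun h => hne (by rw [h])
      · exact disjoint_of_subset_left (hFW t i x) (disjoint_of_subset_right (hFW t' i' x')
          (hW.clustering.disj (t, i) (t', i') h))
  · rintro ⟨j | ⟨t, x⟩, i⟩
    · exact hK _
    · exact hF2 _ _ _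
  · rintro (j | ⟨t, x⟩)
    · exact hKb j
    · obtain ⟨E, hE, h⟩ := hW.tile t
      exact ⟨E, hE, h.mono fun i => hFW t i x⟩

/-- The number of vertices that sets of size `c`, placed in the clusters of a family of tuples,
take from a given cluster. -/
theorem card_inter_biUnion_eq {ι : Type} [DecidableEq ι] {H : MDigraph m V} {W : ι → Finset V}
    {b c : ℕ} (hW : H.IsClustering W b) {J : Type} [Fintype J] {τ : J → Fin (k + 1) → ι}
    {K : J × Fin (k + 1) → Finset V} (hKW : ∀ p, K p ⊆ W (τ p.1 p.2)) (hK : ∀ p, (K p).card = c)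
    (hKd : ∀ p q, p ≠ q → Disjoint (K p) (K q)) (X : ι) :
    (W X ∩ univ.biUnion K).card =
      c * (univ.filter fun p : J × Fin (k + 1) => τ p.1 p.2 = X).card := by
  have : W X ∩ univ.biUnion K =
      (univ.filter fun p : J × Fin (k + 1) => τ p.1 p.2 = X).biUnion K := by
    ext x
    simp only [mem_inter, mem_biUnion, mem_univ, true_and, mem_filter]
    constructor
    · rintro ⟨hxW, p, hp⟩
      refine ⟨p, ?_, hp⟩
      by_contra hne
      exact disjoint_left.1 (hW.disj _ _ hne) (hKW p hp) hxW
    · rintro ⟨p, hpX, hp⟩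
      exact ⟨hpX ▸ hKW p hp, p, hp⟩
  rw [this, card_biUnion fun p _ q _ h => hKd p q h, sum_congr rfl fun p _ => hK p, sum_const,
    smul_eq_mul, mul_comm]

/-- A tiling with large parts `b = c * g * b₀` is taken and the uncovered vertices are cut into
clusters of size `b` too. A cover of all clusters with constant load `b₀` yields new blow-ups with
parts of size `c` that consume exactly the fraction `1 / g` of each cluster. What remains of an old
tile has equal parts and is cut into tiles again. Nothing old is lost, and a fraction `1 / g` of the
new clusters is gained; rounding is paid for by the factor 2. The gain is uniform because `g` does
not depend on `r`. -/
theorem tilingProportion_step (m k : ℕ) {μ : ℝ} (hμ : 0 < μ) (hμ1 : μ ≤ 1) : ∃ g : ℕ, 0 < g ∧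
    ∀ r : ℝ, 0 ≤ r → r < 1 → TilingProportion.{u} m k (matchingThreshold (k + 1) + μ) r →
      TilingProportion.{u} m k (matchingThreshold (k + 1) + μ) (r + (1 - r) / (2 * g)) := by
  classical
  have hk0 : (0 : ℝ) ≤ k := by positivity
  -- The fraction `1 / g` is small enough for dense cluster tuples to remain usable throughout.
  obtain ⟨g, hg⟩ := exists_nat_ge (1 / (μ / 8 / (2 * (k + 1))))
  have hgpos : 0 < g := by
    have : (0 : ℝ) < g := lt_of_lt_of_le (by positivity) hg
    exact_mod_cast this
  have hgR : (1 : ℝ) ≤ g := by exact_mod_cast hgpos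
  rw [div_le_iff₀ (by positivity)] at hg
  refine ⟨g, hgpos, fun r hr0 hr1 hr c hc => ?_⟩
  obtain ⟨ε, hε, N₁, hcover⟩ := exists_cover_of_degree k (half_pos hμ)
  obtain ⟨N₂, hdense⟩ := exists_degree_isDense.{u} k hμ hμ1
  obtain ⟨b₀, hb₀, hblow⟩ := exists_disjoint_blowups.{u} m k c hc
    (show 0 < μ / 8 by positivity) (by linarith)
  set b : ℕ := c * g * b₀ with hb
  have hbpos : 0 < b := by positivity
  have hb₀b : b₀ ≤ b := Nat.le_mul_of_pos_left _ (by positivity)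
  have hbR : (0 : ℝ) < b := by exact_mod_cast hbpos
  obtain ⟨n₁, hn₁⟩ := hr b hbpos
  -- Fewer than `(k + 1) * b` vertices fall outside of all clusters. For large `n` this is below
  -- both the loss allowed for the reduced degrees and half of the uncovered proportion.
  obtain ⟨n₂, hn₂⟩ := exists_nat_ge (((k + 1) * b : ℝ) / (μ / (8 * (k + 1))))
  obtain ⟨n₃, hn₃⟩ := exists_nat_ge (((k + 1) * b : ℝ) / ((1 - r) / 2))
  rw [div_le_iff₀ (by positivity)] at hn₂
  rw [div_le_iff₀ (by linarith)] at hn₃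
  refine ⟨n₁ + n₂ + n₃ + (N₁ + N₂ + (k + 1)) * b, fun V _ H hn hdeg => ?_⟩
  set n : ℕ := H.vertices.card with hndef
  have hnn₂ : (n₂ : ℝ) ≤ n := by exact_mod_cast (by omega : n₂ ≤ n)
  have hnn₃ : (n₃ : ℝ) ≤ n := by exact_mod_cast (by omega : n₃ ≤ n)
  obtain ⟨ι, _, _, W, hW, hWc⟩ := hn₁ V H (by omega) hdeg
  have hUc : (univ.biUnion fun p : ι × Fin (k + 1) => W p.1 p.2).card =
      Fintype.card ι * (k + 1) * b := by
    rw [hW.clustering.card_biUnion, Fintype.card_prod, Fintype.card_fin]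
  set L := H.vertices \ univ.biUnion fun p : ι × Fin (k + 1) => W p.1 p.2 with hL
  have hLc : L.card + Fintype.card ι * (k + 1) * b = n := by
    rw [← hUc, hL]
    exact card_sdiff_add_card_eq_card (biUnion_subset.2 fun p _ => hW.clustering.subset p)
  set q := L.card / ((k + 1) * b) with hq
  have hq1 : q * ((k + 1) * b) ≤ L.card := Nat.div_mul_le_self _ _
  have hq2 : L.card < q * ((k + 1) * b) + (k + 1) * b := by
    rw [hq]; exact Nat.lt_div_mul_add (by positivity)
  obtain ⟨f, hf1, hf2, hf3⟩ := exists_disjoint_pieces (ι := Fin q × Fin (k + 1)) b L (by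
    rw [Fintype.card_prod, Fintype.card_fin, Fintype.card_fin]; linarith)
  set C : (ι ⊕ Fin q) × Fin (k + 1) → Finset V := fun p =>
      Sum.elim (fun t => W t p.2) (fun x => f (x, p.2)) p.1 with hC
  have hCl : H.IsClustering C b := hW.sum_pieces (fun p => (hf1 p).trans sdiff_subset)
    (fun p t i => disjoint_of_subset_left (hf1 p) (disjoint_of_subset_right
      (subset_biUnion_of_mem (fun p : ι × Fin (k + 1) => W p.1 p.2) (mem_univ (t, i)))
      sdiff_disjoint)) hf2 hf3
  have hN : Fintype.card ((ι ⊕ Fin q) × Fin (k + 1)) = (Fintype.card ι + q) * (k + 1) := by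
    simp
  have hNb : n < (Fintype.card ι + q) * (k + 1) * b + (k + 1) * b := by
    have : (Fintype.card ι + q) * (k + 1) * b =
      Fintype.card ι * (k + 1) * b + q * ((k + 1) * b) := by ring
    omega
  have hN12 : N₁ + N₂ ≤ (Fintype.card ι + q) * (k + 1) := by
    by_contra! h
    have h1 : (Fintype.card ι + q) * (k + 1) * b ≤ (N₁ + N₂) * b := Nat.mul_le_mul_right _ h.le
    have h2 : (N₁ + N₂ + (k + 1)) * b = (N₁ + N₂) * b + (k + 1) * b := by ring
    omega
  have hNbR : (n : ℝ) ≤ (Fintype.card ι + q) * (k + 1) * b + (k + 1) * b := by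
    exact_mod_cast hNb.le
  have hdeg' := hdense m V H _ C b (matchingThreshold (k + 1)) (matchingThreshold_nonneg _) hbpos
    hCl (by rw [hN]; omega) hdeg (by
      rw [hN]; push_cast
      rw [← hndef]
      have : (n₂ : ℝ) * (μ / (8 * (k + 1))) ≤ n * (μ / (8 * (k + 1))) := by gcongr
      linarith)
  obtain ⟨J, _, _, τ, hτ, hτc⟩ := hcover _ (fun t => H.IsDense C b (μ / 8) t) (fun _ => b₀) b₀
    (by rw [hN]; omega) (fun t ht => ht.1) hb₀ (fun X => by convert hdeg' X)
    (fun _ => le_rfl)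
    (fun _ => by
      have : (0 : ℝ) ≤ ε * b₀ := by positivity
      linarith)
    (by
      rw [sum_const, card_univ, hN, smul_eq_mul]
      exact ((dvd_mul_left (k + 1) _).mul_right b₀))
  obtain ⟨K, hK1, hK2, hK3, hK4⟩ := hblow V H _ C b ∅ J τ hb₀b hCl hτ fun X => by
    rw [hτc X]
    simp only [inter_empty, card_empty, Nat.cast_zero, zero_add]
    have h1 : (b : ℝ) = (c * b₀) * g := by rw [hb]; push_cast; ring
    rw [h1]
    have h2 : (0 : ℝ) ≤ c * b₀ := by positivity
    have h3 := mul_le_mul_of_nonneg_left hg h2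
    linarith
  have hCK := card_inter_biUnion_eq hCl (fun p => (hK1 p).trans sdiff_subset) hK2 hK4
  obtain ⟨W', hW'⟩ := hW.refine (r := (g - 1) * b₀) hK2 hK3 hK4 fun t i => by
    have h1 := hCK (Sum.inl t, i)
    rw [hτc] at h1
    have h2 := card_sdiff_add_card_inter (C (Sum.inl t, i)) (univ.biUnion K)
    rw [hCl.card, h1] at h2
    have h3 : (g - 1) * b₀ * c + c * b₀ = b := by
      obtain ⟨g', rfl⟩ : ∃ g', g = g' + 1 := ⟨g - 1, by omega⟩
      rw [hb, Nat.add_sub_cancel]; ring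
    change (g - 1) * b₀ * c ≤ (C (Sum.inl t, i) \ univ.biUnion K).card
    omega
  refine ⟨J ⊕ ι × Fin ((g - 1) * b₀), inferInstance, inferInstance, W', hW', ?_⟩
  have hJ : Fintype.card J * (k + 1) = (Fintype.card ι + q) * (k + 1) * b₀ := by
    have h1 : Fintype.card (J × Fin (k + 1)) = ∑ X, (univ.filter fun p : J × Fin (k + 1) =>
        τ p.1 p.2 = X).card := by
      rw [← card_univ]
      exact card_eq_sum_card_fiberwise (by simp)
    rw [sum_congr rfl fun X _ => hτc X, sum_const, card_univ, hN, Fintype.card_prod,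
      Fintype.card_fin, smul_eq_mul] at h1
    exact h1
  -- After multiplication by `g`: the old tiles count in full, the `q` new groups of clusters once.
  have hcnt : (Fintype.card (J ⊕ ι × Fin ((g - 1) * b₀)) : ℝ) * ((k + 1) * c) * g =
      Fintype.card ι * ((k + 1) * b) * g + q * ((k + 1) * b) := by
    have hJR : (Fintype.card J : ℝ) * (k + 1) = (Fintype.card ι + q) * (k + 1) * b₀ := by
      exact_mod_cast hJ
    have hg1 : ((g - 1 : ℕ) : ℝ) = g - 1 := by rw [Nat.cast_sub hgpos]; simp
    rw [Fintype.card_sum, Fintype.card_prod, Fintype.card_fin]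
    push_cast
    rw [hg1, hb]
    push_cast
    linear_combination (c * g : ℝ) * hJR
  refine le_of_mul_le_mul_right ?_ (by linarith : (0 : ℝ) < g)
  rw [hcnt]
  have h1 : (r + (1 - r) / (2 * g)) * n * g = r * n * g + (1 - r) / 2 * n := by
    field_simp
  rw [h1]
  have h2 : (n₃ : ℝ) * ((1 - r) / 2) ≤ n * ((1 - r) / 2) :=
    mul_le_mul_of_nonneg_right hnn₃ (by linarith)
  have h3 : r * n * (g - 1) ≤ (Fintype.card ι * ((k + 1) * b)) * (g - 1) :=
    mul_le_mul_of_nonneg_right hWc (by linarith)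
  nlinarith

/-- Almost all vertices can be covered by disjoint blow-ups of good patterns. -/
theorem tilingProportion (m k : ℕ) {μ η : ℝ} (hμ : 0 < μ) (hμ1 : μ ≤ 1) (hη : 0 < η) :
    TilingProportion.{u} m k (matchingThreshold (k + 1) + μ) (1 - η) := by
  obtain ⟨g, hg, hstep⟩ := tilingProportion_step.{u} m k hμ hμ1
  have hgR : (1 : ℝ) ≤ g := by exact_mod_cast hg
  -- Each step multiplies the uncovered proportion by `x`.
  set x : ℝ := 1 - 1 / (2 * g) with hx
  have hx1 : 1 / (2 * (g : ℝ)) ≤ 1 / 2 := by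
    apply one_div_le_one_div_of_le <;> linarith
  have hx2 : 0 < 1 / (2 * (g : ℝ)) := by positivity
  have hall : ∀ i : ℕ,
      TilingProportion.{u} m k (matchingThreshold (k + 1) + μ) (1 - x ^ i) := by
    intro i
    induction i with
    | zero => simpa using tilingProportion_zero m k _
    | succ i ih =>
      have h0 : 0 < x ^ i := pow_pos (by linarith) i
      have h1 : x ^ i ≤ 1 := pow_le_one₀ (by linarith) (by linarith)
      have := hstep (1 - x ^ i) (by linarith) (by linarith) ih
      convert this using 1
      rw [pow_succ, hx]
      ring
  obtain ⟨i, hi⟩ := exists_pow_lt_of_lt_one hη (show x < 1 by linarith)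
  exact (hall i).mono (by linarith)

end MDigraph

/-! ### Moving residues between clusters. -/

namespace MDigraph

section Clusters

variable {m k : ℕ} {V : Type u} [DecidableEq V] {ι : Type} [Fintype ι]

theorem IsClustering.sum_card_inter {H : MDigraph m V} {W : ι → Finset V} {b : ℕ}
    (hW : H.IsClustering W b) (B : Finset V) :
    ∑ X, (W X ∩ B).card = (univ.biUnion W ∩ B).card := by
  rw [biUnion_inter, Finset.card_biUnion]
  exact fun X _ Y _ h => disjoint_of_subset_left inter_subset_left
    (disjoint_of_subset_right inter_subset_left (hW.disj X Y h))

theorem IsClustering.card_mul_le_card {H : MDigraph m V} {W : ι → Finset V} {b : ℕ}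
    (hW : H.IsClustering W b) (B : Finset V) (t : ℕ) :
    (univ.filter fun X => t ≤ (W X ∩ B).card).card * t ≤ B.card := by
  calc (univ.filter fun X => t ≤ (W X ∩ B).card).card * t
      ≤ ∑ X ∈ univ.filter (fun X => t ≤ (W X ∩ B).card), (W X ∩ B).card :=
        card_nsmul_le_sum _ _ _ fun X hX => (mem_filter.1 hX).2
    _ ≤ ∑ X, (W X ∩ B).card := sum_le_sum_of_subset (filter_subset _ _)
    _ ≤ B.card := by
        rw [hW.sum_card_inter]
        exact card_le_card inter_subset_right

/-- Inside a blow-up contained in a tuple of clusters, an integral combination of pattern edges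
is realised by a matchable set. -/
theorem IsBlowup.exists_matchable_inter {H : MDigraph m V} (hH : H.IsFissile)
    {E : Finset (Fin m → Fin (k + 1))} {U : Fin (k + 1) → Finset V} (hU : H.IsBlowup E U) {c : ℕ}
    (hc : 0 < c) (hUc : ∀ i, (U i).card = c) {W : ι → Finset V} {b : ℕ} (hW : H.IsClustering W b)
    {τ : Fin (k + 1) → ι} (hτ : Function.Injective τ) {A : Finset V}
    (hUW : ∀ i, U i ⊆ W (τ i) \ A) (p : (Fin m → Fin (k + 1)) → ℕ)
    (hp : ∀ i, ∑ e ∈ E, p e * tupleMult i e ≤ c) :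
    ∃ B, H.Matchable B ∧ Disjoint A B ∧ B ⊆ univ.biUnion W ∧
      (∀ i, (W (τ i) ∩ B).card = ∑ e ∈ E, p e * tupleMult i e) ∧
      B.card = ∑ i, ∑ e ∈ E, p e * tupleMult i e ∧
      ∀ Z, Z ∉ Set.range τ → W Z ∩ B = ∅ := by
  have hT : ∀ i, ∃ T ⊆ U i, T.card = ∑ e ∈ E, p e * tupleMult i e := fun i =>
    exists_subset_card_eq (by rw [hUc]; exact hp i)
  choose T hTU hTc using hT
  have hTW : ∀ i, T i ⊆ W (τ i) := fun i => (hTU i).trans ((hUW i).trans sdiff_subset)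
  have hinter : ∀ Z i, Z ≠ τ i → Disjoint (W Z) (T i) := fun Z i h =>
    disjoint_of_subset_right (hTW i) (hW.disj _ _ h)
  refine ⟨univ.biUnion T, hU.matchable hH (fun i => card_pos.1 (by rw [hUc]; exact hc)) p hTU hTc,
    ?_, ?_, ?_, ?_, ?_⟩
  · rw [disjoint_biUnion_right]
    exact fun i _ => disjoint_of_subset_right ((hTU i).trans (hUW i)) disjoint_sdiff
  · exact biUnion_subset.2 fun i _ => (hTW i).trans (subset_biUnion_of_mem W (mem_univ _))
  · intro i
    rw [← hTc i]
    congr 1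
    ext x
    simp only [mem_inter, mem_biUnion, mem_univ, true_and]
    constructor
    · rintro ⟨hx, j, hj⟩
      by_cases hij : i = j
      · rwa [hij]
      · exact absurd hj (disjoint_left.1 (hinter _ j fun h => hij (hτ h)) hx)
    · exact fun hx => ⟨hTW i hx, i, hx⟩
  · rw [card_biUnion, sum_congr rfl fun i _ => hTc i]
    exact fun i _ j _ hij => disjoint_of_subset_left (hTU i)
      (disjoint_of_subset_right (hTU j) (hU.disj i j hij))
  · intro Z hZ
    rw [← disjoint_iff_inter_eq_empty, disjoint_biUnion_right]
    exact fun i _ => hinter Z i fun h => hZ ⟨i, h.symm⟩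

open Classical in
/-- Any two clusters have a common neighbour in the reduced structure, even when few clusters
are forbidden. -/
theorem exists_common_neighbour [DecidableEq ι] {R : (Fin (k + 1) → ι) → Prop} {θ μ ζ : ℝ}
    (hk : 1 ≤ k) (hθ : (1 / 2 : ℝ) ^ k ≤ θ) (hζ : k * ζ < μ)
    (hdeg : ∀ X, (θ + μ) * (Fintype.card ι : ℝ) ^ k ≤
      (univ.filter fun y : Fin k → ι => R (Fin.cons X y)).card) {S : Finset ι}
    (hS : (S.card : ℝ) ≤ ζ * Fintype.card ι) (X Y : ι) :
    ∃ y y' : Fin k → ι, R (Fin.cons X y) ∧ R (Fin.cons Y y') ∧ (∀ i, y i ∉ S) ∧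
      (∀ i, y' i ∉ S) ∧ ∃ i i', y i = y' i' := by
  set N : ℝ := (Fintype.card ι : ℝ) with hN
  have hNpos : 0 < N := by
    have : 0 < Fintype.card ι := Fintype.card_pos_iff.2 ⟨X⟩
    rw [hN]; exact_mod_cast this
  set G : ι → Finset (Fin k → ι) := fun X =>
    univ.filter fun y : Fin k → ι => R (Fin.cons X y) ∧ ∀ i, y i ∉ S with hG
  -- Since `G X` consists of tuples over `nb X`, the degree bound gives `(nb X).card ^ k > (N / 2) ^
  -- k`. Two sets with more than half of all clusters intersect.
  set nb : ι → Finset ι := fun X => univ.filter fun Z => ∃ y ∈ G X, ∃ i, y i = Z with hnb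
  have key : ∀ X, N / 2 < (nb X).card := by
    intro X
    have h1 : (univ.filter fun y : Fin k → ι => R (Fin.cons X y)) ⊆
        G X ∪ (univ \ Fintype.piFinset fun _ : Fin k => univ \ S) := by
      intro y hy
      by_cases h : ∀ i, y i ∉ S
      · exact mem_union_left _ (mem_filter.2 ⟨mem_univ _, (mem_filter.1 hy).2, h⟩)
      · refine mem_union_right _ (mem_sdiff.2 ⟨mem_univ _, fun h' => h fun i => ?_⟩)
        exact (mem_sdiff.1 (Fintype.mem_piFinset.1 h' i)).2
    have h2 : ((univ \ Fintype.piFinset fun _ : Fin k => univ \ S).card : ℝ) ≤ k * ζ * N ^ k := by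
      rw [cast_card_sdiff (subset_univ _), card_univ, Fintype.card_piFinset, Fintype.card_fun]
      simp only [prod_const, card_univ, Fintype.card_fin]
      push_cast
      rw [cast_card_sdiff (subset_univ _), card_univ, ← hN]
      have hS1 : (S.card : ℝ) / N ≤ 1 := by
        rw [div_le_one hNpos, hN]
        exact_mod_cast card_le_univ S
      have h3 := one_sub_mul_le_pow hS1 k
      have h4 : N - S.card = N * (1 - S.card / N) := by field_simp
      rw [h4, mul_pow]
      have h5 : (S.card : ℝ) / N ≤ ζ := by rwa [div_le_iff₀ hNpos]
      have h6 : (k : ℝ) * (S.card / N) ≤ k * ζ := by gcongr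
      have h7 : 0 < N ^ k := by positivity
      nlinarith
    have h3 : (G X).card ≤ (nb X).card ^ k := by
      have : G X ⊆ Fintype.piFinset fun _ : Fin k => nb X := by
        intro y hy
        rw [Fintype.mem_piFinset]
        exact fun i => mem_filter.2 ⟨mem_univ _, y, hy, i, rfl⟩
      refine (card_le_card this).trans ?_
      simp
    have h4 : (θ + μ) * N ^ k ≤ ((nb X).card : ℝ) ^ k + k * ζ * N ^ k := by
      refine (hdeg X).trans ?_
      have := (card_le_card h1).trans (card_union_le _ _)
      have h5 : ((univ.filter fun y : Fin k → ι => R (Fin.cons X y)).card : ℝ) ≤ (G X).card +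
        ((univ \ Fintype.piFinset fun _ : Fin k => univ \ S).card : ℝ) := by exact_mod_cast this
      have h6 : ((G X).card : ℝ) ≤ ((nb X).card : ℝ) ^ k := by exact_mod_cast h3
      linarith
    have h5 : (N / 2) ^ k < ((nb X).card : ℝ) ^ k := by
      have h6 : (N / 2) ^ k = (1 / 2) ^ k * N ^ k := by rw [← mul_pow]; ring
      rw [h6]
      have h7 : 0 < N ^ k := by positivity
      nlinarith
    exact lt_of_pow_lt_pow_left₀ k (by positivity) h5
  obtain ⟨Z, hZ⟩ : (nb X ∩ nb Y).Nonempty := by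
    refine inter_nonempty_of_card_lt_card_add_card (subset_univ _) (subset_univ _) ?_
    have h1 := key X
    have h2 := key Y
    have : N < (nb X).card + (nb Y).card := by linarith
    rw [card_univ]
    rw [hN] at this
    exact_mod_cast this
  obtain ⟨h1, h2⟩ := mem_inter.1 hZ
  obtain ⟨y, hy, i, hi⟩ := (mem_filter.1 h1).2
  obtain ⟨y', hy', i', hi'⟩ := (mem_filter.1 h2).2
  have hy := (mem_filter.1 hy).2
  have hy' := (mem_filter.1 hy').2
  exact ⟨y, y', hy.1, hy'.1, hy.2, hy'.2, i, i', hi.trans hi'.symm⟩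

end Clusters

/-- A bound for the number of vertices per cluster used by one transfer. -/
def transferCost (m k M : ℕ) : ℕ := (k + 1) ^ m * (M * m)

/-- The divisibility property of the pattern, with its coefficients reduced modulo `M`, is realised
by a matching in a bounded blow-up. Its vertex counts are `r` in cluster `τ i`, `-r` in cluster `τ
j` and 0 elsewhere, modulo `M`. -/
theorem exists_transfer_of_isDense (m k M : ℕ) (hM : 0 < M) {α : ℝ} (hα : 0 < α) (hα1 : α ≤ 1) :
    ∃ b₀ : ℕ, ∀ (V : Type u) [DecidableEq V] (H : MDigraph m V) (ι : Type) [Fintype ι]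
      [DecidableEq ι] (W : ι → Finset V) (b : ℕ) (τ : Fin (k + 1) → ι) (A : Finset V),
      H.IsFissile → b₀ ≤ b → H.IsClustering W b → H.IsDense W b α τ →
      (∀ i, ((W (τ i) ∩ A).card : ℝ) ≤ α / (2 * (k + 1)) * b) → ∀ (r : ℤ) (i j : Fin (k + 1)),
      ∃ B, H.Matchable B ∧ Disjoint A B ∧ B ⊆ univ.biUnion W ∧
        (∀ Z, (W Z ∩ B).card ≤ transferCost m k M) ∧
        (∀ Z, ((W Z ∩ B).card : ℤ) ≡
          r * ((if Z = τ i then 1 else 0) - (if Z = τ j then 1 else 0)) [ZMOD M]) ∧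
        B.card ≤ (k + 1) * transferCost m k M ∧
        ∀ Z, Z ∉ Set.range τ → W Z ∩ B = ∅ := by
  obtain ⟨b₀, hb₀, h⟩ := exists_isBlowup_of_isDense.{u} m k (transferCost m k M + 1)
    (Nat.succ_pos _) hα hα1
  refine ⟨b₀, fun V _ H ι _ _ W b τ A hH hb hW hτ hA r i j => ?_⟩
  obtain ⟨U, hU1, hU2, E, hE, hU3⟩ := h V H ι W b τ A hb hW hτ hA
  obtain ⟨p, hp⟩ := hE.exists_residue_weights hM r i j
  obtain ⟨B, h1, h2, h3, h4, h5, h6⟩ := hU3.exists_matchable_inter hH (Nat.succ_pos _) hU2 hW hτ.1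
    hU1 p fun i => ((hp i).1.trans (Nat.le_succ _))
  refine ⟨B, h1, h2, h3, ?_, ?_, ?_, h6⟩
  · intro Z
    by_cases hZ : Z ∈ Set.range τ
    · obtain ⟨i', rfl⟩ := hZ
      rw [h4]
      exact (hp i').1
    · rw [h6 Z hZ]
      simp
  · intro Z
    by_cases hZ : Z ∈ Set.range τ
    · obtain ⟨i', rfl⟩ := hZ
      rw [h4]
      simpa only [hτ.1.eq_iff] using (hp i').2
    · have hi : ∀ i', Z ≠ τ i' := fun i' h => hZ ⟨i', h.symm⟩
      rw [h6 Z hZ, if_neg (hi i), if_neg (hi j)]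
      simp
  · rw [h5]
    refine (sum_le_card_nsmul _ _ _ fun i _ => (hp i).1).trans ?_
    simp [transferCost]

open Classical in
/-- A residue modulo `M` can be moved from one cluster to another while avoiding few forbidden
clusters. -/
theorem exists_transfer (m k M : ℕ) (hM : 0 < M) (hk : 1 ≤ k) {α μ : ℝ} (hα : 0 < α)
    (hα1 : α ≤ 1) (hμ : 0 < μ) :
    ∃ b₀ : ℕ, ∀ (V : Type u) [DecidableEq V] (H : MDigraph m V) (ι : Type) [Fintype ι]
      [DecidableEq ι] (W : ι → Finset V) (b : ℕ) (A : Finset V) (S : Finset ι),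
      H.IsFissile → b₀ ≤ b → H.IsClustering W b →
      (∀ X, (matchingThreshold (k + 1) + μ) * (Fintype.card ι : ℝ) ^ k ≤
        (univ.filter fun y : Fin k → ι =>
          H.IsDense W b α (Fin.cons X y : Fin (k + 1) → ι)).card) →
      (S.card : ℝ) ≤ μ / (k + 1) * Fintype.card ι → ∀ X Y : ι,
      (∀ Z, Z ∉ S ∨ Z = X ∨ Z = Y → ((W Z ∩ A).card : ℝ) + transferCost m k M ≤
        α / (2 * (k + 1)) * b) → ∀ r : ℤ,
      ∃ B, H.Matchable B ∧ Disjoint A B ∧ B ⊆ univ.biUnion W ∧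
        (∀ Z, (W Z ∩ B).card ≤ 2 * transferCost m k M) ∧
        (∀ Z, ((W Z ∩ B).card : ℤ) ≡
          r * ((if Z = X then 1 else 0) - (if Z = Y then 1 else 0)) [ZMOD M]) ∧
        B.card ≤ 2 * ((k + 1) * transferCost m k M) ∧
        ∀ Z ∈ S, Z ≠ X → Z ≠ Y → W Z ∩ B = ∅ := by
  obtain ⟨b₀, h⟩ := exists_transfer_of_isDense.{u} m k M hM hα hα1
  refine ⟨b₀, fun V _ H ι _ _ W b A S hH hb hW hdeg hS X Y hA r => ?_⟩
  have hζ : (k : ℝ) * (μ / (k + 1)) < μ := by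
    rw [mul_div_assoc', div_lt_iff₀ (by positivity)]
    nlinarith
  obtain ⟨y, y', hy, hy', hyS, hyS', i, i', hii⟩ := exists_common_neighbour hk
    (half_pow_le_matchingThreshold k hk) hζ hdeg hS X Y
  have hr1 : ∀ Z, Z ∈ Set.range (Fin.cons X y : Fin (k + 1) → ι) → Z ∉ S ∨ Z = X ∨ Z = Y := by
    rintro _ ⟨l, rfl⟩
    refine Fin.cases ?_ (fun l => ?_) l
    · right; left; rfl
    · left; exact hyS l
  have hr2 : ∀ Z, Z ∈ Set.range (Fin.cons Y y' : Fin (k + 1) → ι) → Z ∉ S ∨ Z = X ∨ Z = Y := by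
    rintro _ ⟨l, rfl⟩
    refine Fin.cases ?_ (fun l => ?_) l
    · right; right; rfl
    · left; exact hyS' l
  -- Two transfers pass through a common neighbour, where their contributions cancel modulo `M`. The
  -- second avoids the first, which is why one extra `transferCost` of room is assumed.
  obtain ⟨B₁, p1, p2, p3, p4, p5, p6, p7⟩ := h V H ι W b _ A hH hb hW hy
    (fun l => le_trans (by
      have : (0 : ℝ) ≤ transferCost m k M := by positivity
      linarith) (hA _ (hr1 _ ⟨l, rfl⟩))) r 0 i.succ
  have hload : ∀ Z, (W Z ∩ (A ∪ B₁)).card ≤ (W Z ∩ A).card + transferCost m k M := fun Z => by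
    rw [inter_union_distrib_left]
    exact (card_union_le _ _).trans (Nat.add_le_add_left (p4 Z) _)
  obtain ⟨B₂, q1, q2, q3, q4, q5, q6, q7⟩ := h V H ι W b _ (A ∪ B₁) hH hb hW hy'
    (fun l => le_trans (by exact_mod_cast hload _) (hA _ (hr2 _ ⟨l, rfl⟩))) r i'.succ 0
  rw [disjoint_union_left] at q2
  simp only [Fin.cons_zero, Fin.cons_succ] at p5 q5
  refine ⟨B₁ ∪ B₂, p1.union q1 q2.2, disjoint_union_right.2 ⟨p2, q2.1⟩, union_subset p3 q3,
    ?_, ?_, ?_, ?_⟩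
  · intro Z
    rw [inter_union_distrib_left, two_mul]
    exact (card_union_le _ _).trans (Nat.add_le_add (p4 Z) (q4 Z))
  · intro Z
    rw [inter_union_distrib_left, card_union_of_disjoint (disjoint_of_subset_left inter_subset_right
      (disjoint_of_subset_right inter_subset_right q2.2))]
    push_cast
    convert (p5 Z).add (q5 Z) using 1
    rw [hii]
    ring
  · exact (card_union_le _ _).trans (by omega)
  · intro Z hZ hZX hZY
    rw [inter_union_distrib_left, p7 Z, q7 Z, empty_union]
    · intro hZ'
      rcases hr2 Z hZ' with h | h | h
      · exact h hZ
      · exact hZX h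
      · exact hZY h
    · intro hZ'
      rcases hr1 Z hZ' with h | h | h
      · exact h hZ
      · exact hZX h
      · exact hZY h

end MDigraph

/-! ### Covering leftover vertices. -/

namespace MDigraph

open Classical in
/-- The vertices outside of a clustering that misses few vertices can be covered by a matching
that takes at most `m` vertices from each cluster. -/
theorem exists_matchable_cover (m k : ℕ) (hm : 0 < m) {δ μ : ℝ} (hδ : 0 ≤ δ) (hμ : 0 < μ)
    (hμ1 : μ ≤ 1) (b : ℕ) : ∃ η : ℝ, 0 < η ∧ ∃ n₀ : ℕ,
    ∀ (V : Type u) [DecidableEq V] (H : MDigraph m V) (ι : Type) [Fintype ι] [DecidableEq ι]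
      (W : ι → Finset V), n₀ ≤ H.vertices.card → H.IsFissile → H.GoodDegree k (δ + μ) →
      H.IsClustering W b →
      ((H.vertices \ univ.biUnion W).card : ℝ) ≤ η * H.vertices.card →
      ∃ A, H.Matchable A ∧ H.vertices \ univ.biUnion W ⊆ A ∧
        A.card ≤ m * (H.vertices \ univ.biUnion W).card ∧ ∀ X, (W X ∩ A).card ≤ m := by
  obtain ⟨b₀, hb₀, hblow⟩ := exists_isBlowup_cons.{u} m k m hm (μ / 2) (half_pos hμ)
  set ε : ℝ := μ / (2 * (k + 1)) with hε
  have hε0 : 0 < ε := by positivity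
  have hkε : k * ε ≤ μ / 2 := by
    rw [hε, mul_div_assoc', div_le_div_iff₀ (by positivity) (by positivity)]
    nlinarith
  have hε1 : ε ≤ 1 / 2 := by
    rw [hε, div_le_div_iff₀ (by positivity) (by positivity)]
    have : (0 : ℝ) ≤ k := by positivity
    nlinarith
  -- At each stage the forbidden set consists of the leftover vertices, the at most `m` times as
  -- many matched ones, and all clusters these touch. With this constant it has at most `ε * n`
  -- elements.
  refine ⟨ε / (1 + m + b * m), by positivity, 2 * b₀, fun V _ H ι _ _ W hn hH hdeg hW hL => ?_⟩
  set n := H.vertices.card with hndef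
  set L := H.vertices \ univ.biUnion W with hLdef
  rw [div_mul_eq_mul_div, le_div_iff₀ (by positivity)] at hL
  have hnpos : (0 : ℝ) < n := by exact_mod_cast (by omega : 0 < n)
  -- The condition `A ∩ L ⊆ I` keeps the leftover vertices still to be treated unmatched.
  suffices ∀ I ⊆ L, ∃ A, H.Matchable A ∧ I ⊆ A ∧ A ∩ L ⊆ I ∧ A.card ≤ m * I.card ∧
      ∀ X, (W X ∩ A).card ≤ m by
    obtain ⟨A, h1, h2, _, h4, h5⟩ := this L Subset.rfl
    exact ⟨A, h1, h2, h4, h5⟩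
  intro I
  induction I using Finset.induction_on with
  | empty => exact fun _ => ⟨∅, H.matchable_empty, by simp, by simp, by simp, by simp⟩
  | insert v I hv ih =>
    intro hI
    obtain ⟨A, h1, h2, h3, h4, h5⟩ := ih ((subset_insert _ _).trans hI)
    have hvL : v ∈ L := hI (mem_insert_self _ _)
    have hvA : v ∉ A := fun h => hv (h3 (mem_inter.2 ⟨h, hvL⟩))
    have hvW : ∀ X, v ∉ W X := fun X h => (mem_sdiff.1 hvL).2 (mem_biUnion.2 ⟨X, mem_univ _, h⟩)
    have hAc : A.card ≤ m * L.card :=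
      h4.trans (Nat.mul_le_mul_left _ (card_le_card ((subset_insert _ _).trans hI)))
    -- Clusters touched before are avoided altogether, so each cluster meets at most one of the
    -- edges and loses at most `m` vertices.
    set S := univ.filter fun X => 1 ≤ (W X ∩ A).card with hS
    have hSc : S.card ≤ m * L.card := by
      have := hW.card_mul_le_card A 1
      rw [mul_one] at this
      exact this.trans hAc
    set F := L ∪ A ∪ S.biUnion W with hF
    have hFc : F.card ≤ (1 + m + b * m) * L.card := by
      have e1 : (S.biUnion W).card ≤ S.card * b :=
        card_biUnion_le.trans (le_of_eq (by rw [sum_congr rfl fun X _ => hW.card X]; simp))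
      have e2 : S.card * b ≤ m * L.card * b := Nat.mul_le_mul_right _ hSc
      have e3 : F.card ≤ L.card + A.card + (S.biUnion W).card :=
        (card_union_le (L ∪ A) (S.biUnion W)).trans (Nat.add_le_add_right (card_union_le L A) _)
      have e4 : (1 + m + b * m) * L.card = L.card + m * L.card + m * L.card * b := by ring
      omega
    have hFn : (F.card : ℝ) ≤ ε * n := by
      have : (F.card : ℝ) ≤ (1 + m + b * m) * L.card := by exact_mod_cast hFc
      linarith
    set U := H.vertices \ F with hU
    have hFv : F ⊆ H.vertices := by
      refine union_subset (union_subset sdiff_subset h1.subset) (biUnion_subset.2 fun X _ => hW.subset X)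
    have hUc : (U.card : ℝ) = n - F.card := by rw [hU, cast_card_sdiff hFv]
    have hUlow : (1 - ε) * n ≤ U.card := by rw [hUc]; linarith
    have hUb : b₀ ≤ U.card := by
      have e1 : (2 : ℝ) * b₀ ≤ n := by exact_mod_cast hn
      have e2 : (b₀ : ℝ) ≤ U.card := by nlinarith
      exact_mod_cast e2
    have hUle : (U.card : ℝ) ≤ n := by exact_mod_cast card_le_card sdiff_subset
    have hdense : μ / 2 * ∏ _i : Fin k, (U.card : ℝ) ≤
        ((Fintype.piFinset fun _ : Fin k => U).filter
          fun z => H.IsGoodTuple (Fin.cons v z : Fin (k + 1) → V)).card := by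
      have d1 := hdeg v (mem_sdiff.1 hvL).1
      have hsub : (Fintype.piFinset fun _ : Fin k => H.vertices).filter
          (fun z => H.IsGoodTuple (Fin.cons v z : Fin (k + 1) → V)) ⊆
          ((Fintype.piFinset fun _ : Fin k => U).filter
            fun z => H.IsGoodTuple (Fin.cons v z : Fin (k + 1) → V)) ∪
          ((Fintype.piFinset fun _ : Fin k => H.vertices) \ Fintype.piFinset fun _ : Fin k => U) := by
        intro z hz
        obtain ⟨z1, z2⟩ := mem_filter.1 hz
        by_cases h : z ∈ Fintype.piFinset fun _ : Fin k => U
        · exact mem_union_left _ (mem_filter.2 ⟨h, z2⟩)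
        · exact mem_union_right _ (mem_sdiff.2 ⟨z1, h⟩)
      have d2 : ((((Fintype.piFinset fun _ : Fin k => H.vertices) \
          Fintype.piFinset fun _ : Fin k => U).card : ℕ) : ℝ) = n ^ k - (U.card : ℝ) ^ k := by
        rw [cast_card_sdiff (Fintype.piFinset_subset _ _ fun _ => sdiff_subset),
          Fintype.card_piFinset, Fintype.card_piFinset]
        simp only [prod_const, card_univ, Fintype.card_fin, Nat.cast_pow]
        rfl
      have d3 : (((Fintype.piFinset fun _ : Fin k => H.vertices).filter
          fun z => H.IsGoodTuple (Fin.cons v z : Fin (k + 1) → V)).card : ℝ) ≤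
          ((Fintype.piFinset fun _ : Fin k => U).filter
            fun z => H.IsGoodTuple (Fin.cons v z : Fin (k + 1) → V)).card +
          (((Fintype.piFinset fun _ : Fin k => H.vertices) \
            Fintype.piFinset fun _ : Fin k => U).card : ℝ) := by
        exact_mod_cast (card_le_card hsub).trans (card_union_le _ _)
      rw [d2] at d3
      have d4 : (1 - μ / 2) * (n : ℝ) ^ k ≤ (U.card : ℝ) ^ k := by
        calc (1 - μ / 2) * (n : ℝ) ^ k ≤ (1 - ε) ^ k * (n : ℝ) ^ k := by
              have := one_sub_mul_le_pow (show ε ≤ 1 by linarith) k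
              exact mul_le_mul_of_nonneg_right (by linarith) (by positivity)
          _ = ((1 - ε) * n) ^ k := by rw [mul_pow]
          _ ≤ _ := pow_le_pow_left₀ (mul_nonneg (by linarith) hnpos.le) hUlow k
      have d5 : (U.card : ℝ) ^ k ≤ (n : ℝ) ^ k := pow_le_pow_left₀ (by positivity) hUle k
      have d6 : 0 ≤ δ * (n : ℝ) ^ k := by positivity
      rw [prod_const, card_univ, Fintype.card_fin]
      nlinarith
    obtain ⟨Y, hYU, hYc, E, hE, hB⟩ := hblow V H v (fun _ => U) (fun _ => hUb) (by convert hdense)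
    set Y' : Fin (k + 1) → Finset V := Fin.cons {v} Y with hY'
    -- The cover property: multiplicity one at index 0 fits the singleton part `{v}`.
    obtain ⟨e, he, hev⟩ := hE.cov 0
    have hT : ∀ i, ∃ T ⊆ Y' i, T.card = tupleMult i e := by
      intro i
      refine exists_subset_card_eq ?_
      refine Fin.cases ?_ (fun i => ?_) i
      · rw [hev]; simp [hY']
      · simpa [hY', hYc] using tupleMult_le i.succ e
    choose T hTY hTc using hT
    set B := univ.biUnion T with hBdef
    have hBm : H.Matchable B := hB.matchable_of_edge hH (fun i => by
      refine Fin.cases ?_ (fun i => ?_) i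
      · exact singleton_nonempty v
      · exact card_pos.1 (by change 0 < (Y i).card; rw [hYc]; exact hm)) he hTY hTc
    have hvB : v ∈ B := by
      refine mem_biUnion.2 ⟨0, mem_univ _, ?_⟩
      have h0 : T 0 ⊆ {v} := hTY 0
      have : T 0 = {v} := eq_of_subset_of_card_le h0 (by rw [hTc, hev]; simp)
      simp [this]
    have hBU : ∀ x ∈ B, x = v ∨ x ∈ U := by
      intro x hx
      obtain ⟨i, _, hx⟩ := mem_biUnion.1 hx
      have hx := hTY i hx
      revert hx
      refine Fin.cases ?_ (fun i => ?_) i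
      · intro hx; left; simpa [hY'] using hx
      · intro hx; right; exact hYU i hx
    have hUF : ∀ x ∈ U, x ∉ F := fun x hx => (mem_sdiff.1 hx).2
    have hBc : B.card ≤ m := by
      refine card_biUnion_le.trans (le_of_eq ?_)
      rw [sum_congr rfl fun i _ => hTc i, sum_tupleMult]
    have hAB : Disjoint A B := by
      rw [disjoint_right]
      intro x hx hxA
      rcases hBU x hx with rfl | hxU
      · exact hvA hxA
      · exact hUF x hxU (mem_union_left _ (mem_union_right _ hxA))
    refine ⟨A ∪ B, h1.union hBm hAB, ?_, ?_, ?_, ?_⟩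
    · exact insert_subset (mem_union_right _ hvB) (h2.trans subset_union_left)
    · intro x hx
      obtain ⟨hx, hxL⟩ := mem_inter.1 hx
      rcases mem_union.1 hx with hx | hx
      · exact mem_insert_of_mem (h3 (mem_inter.2 ⟨hx, hxL⟩))
      · rcases hBU x hx with rfl | hxU
        · exact mem_insert_self _ _
        · exact absurd (mem_union_left _ (mem_union_left _ hxL)) (hUF x hxU)
    · rw [card_insert_of_notMem hv, mul_add, mul_one]
      exact (card_union_le _ _).trans (Nat.add_le_add h4 hBc)
    · intro X
      rw [inter_union_distrib_left]
      by_cases hX : X ∈ S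
      · have : W X ∩ B = ∅ := by
          rw [eq_empty_iff_forall_notMem]
          intro x hx
          obtain ⟨hxW, hx⟩ := mem_inter.1 hx
          rcases hBU x hx with rfl | hxU
          · exact hvW X hxW
          · exact hUF x hxU (mem_union_right _ (mem_biUnion.2 ⟨X, hX, hxW⟩))
        rw [this, union_empty]
        exact h5 X
      · have : W X ∩ A = ∅ := by
          by_contra hne
          exact hX (mem_filter.2 ⟨mem_univ _, card_pos.2 (nonempty_iff_ne_empty.2 hne)⟩)
        rw [this, empty_union]
        exact (card_le_card inter_subset_right).trans hBc

/-- A bounded number of disjoint edges inside a dense tuple of clusters. -/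
theorem exists_matchable_of_isDense (m k R : ℕ) {α : ℝ} (hα : 0 < α) (hα1 : α ≤ 1) :
    ∃ b₀ : ℕ, ∀ (V : Type u) [DecidableEq V] (H : MDigraph m V) (ι : Type) [Fintype ι]
      (W : ι → Finset V) (b : ℕ) (τ : Fin (k + 1) → ι) (A : Finset V),
      H.IsFissile → b₀ ≤ b → H.IsClustering W b → H.IsDense W b α τ →
      (∀ i, ((W (τ i) ∩ A).card : ℝ) ≤ α / (2 * (k + 1)) * b) → ∀ r ≤ R,
      ∃ B, H.Matchable B ∧ Disjoint A B ∧ B.card = r * m := by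
  classical
  obtain ⟨b₀, hb₀, h⟩ := exists_isBlowup_of_isDense.{u} m k (R * m + 1) (Nat.succ_pos _) hα hα1
  refine ⟨b₀, fun V _ H ι _ W b τ A hH hb hW hτ hA r hr => ?_⟩
  obtain ⟨U, hU1, hU2, E, hE, hU3⟩ := h V H ι W b τ A hb hW hτ hA
  obtain ⟨e, he, _⟩ := hE.cov 0
  have hp : ∀ i, ∑ e' ∈ E, (if e' = e then r else 0) * tupleMult i e' = r * tupleMult i e := by
    intro i
    simp [ite_mul, he]
  obtain ⟨B, h1, h2, _, _, h5, _⟩ := hU3.exists_matchable_inter hH (Nat.succ_pos _) hU2 hW hτ.1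
    hU1 (fun e' => if e' = e then r else 0) fun i => by
      rw [hp]
      exact (Nat.mul_le_mul hr (tupleMult_le i e)).trans (Nat.le_succ _)
  refine ⟨B, h1, h2, ?_⟩
  rw [h5, sum_congr rfl fun i _ => hp i, ← mul_sum, sum_tupleMult]

end MDigraph

/-! ### Residue adjustment and the perfect matching. -/

namespace MDigraph

theorem card_sdiff_union_add_card_inter {V : Type*} [DecidableEq V] (W : Finset V)
    {A B : Finset V} (h : Disjoint A B) :
    (W \ (A ∪ B)).card + (W ∩ B).card = (W \ A).card := by
  have h1 : W \ (A ∪ B) = (W \ A) \ B := by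
    ext x; simp only [mem_sdiff, mem_union]; tauto
  have h2 : W ∩ B = (W \ A) ∩ B := by
    ext x
    simp only [mem_sdiff, mem_inter]
    have hx : x ∈ A → x ∉ B := fun hA => disjoint_left.1 h hA
    tauto
  rw [h1, h2]
  exact card_sdiff_add_card_inter _ _

open Classical in
/-- The clusters can be made divisible by `M` by removing a matchable set that is spread out. -/
theorem exists_residue_adjustment (m k M : ℕ) (hM : 0 < M) (hk : 1 ≤ k) {α μ : ℝ} (hα : 0 < α)
    (hα1 : α ≤ 1) (hμ : 0 < μ) :
    ∃ b₀ : ℕ, ∀ (V : Type u) [DecidableEq V] (H : MDigraph m V) (ι : Type) [Fintype ι]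
      [DecidableEq ι] (W : ι → Finset V) (b t : ℕ) (A₀ : Finset V),
      H.IsFissile → b₀ ≤ b → H.IsClustering W b →
      (∀ X, (matchingThreshold (k + 1) + μ) * (Fintype.card ι : ℝ) ^ k ≤
        (univ.filter fun y : Fin k → ι =>
          H.IsDense W b α (Fin.cons X y : Fin (k + 1) → ι)).card) →
      H.Matchable A₀ → (∀ X, (W X ∩ A₀).card ≤ t) → A₀.card ≤ Fintype.card ι →
      (1 + 2 * ((k + 1) * transferCost m k M) : ℝ) ≤ μ / (k + 1) * t →
      (t + 7 * transferCost m k M : ℝ) ≤ α / (2 * (k + 1)) * b →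
      M ∣ ∑ X, (W X \ A₀).card →
      ∃ A, H.Matchable A ∧ A₀ ⊆ A ∧ (∀ X, (W X ∩ A).card ≤ t + 6 * transferCost m k M) ∧
        ∀ X, M ∣ (W X \ A).card := by
  obtain ⟨b₀, h⟩ := exists_transfer.{u} m k M hM hk hα hα1 hμ
  refine ⟨b₀, fun V _ H ι _ _ W b t A₀ hH hb hW hdeg hA₀ hload hcard ht htb hdvd => ?_⟩
  set C := transferCost m k M with hC
  set N := Fintype.card ι with hN
  rcases Nat.eq_zero_or_pos N with hN0 | hNpos
  · have hemp : IsEmpty ι := Fintype.card_eq_zero_iff.1 hN0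
    exact ⟨A₀, hA₀, Subset.rfl, fun X => hemp.elim X, fun X => hemp.elim X⟩
  let e : ι ≃ Fin N := Fintype.equivFin ι
  have htpos : (0 : ℝ) < t := by
    have h0 : 0 < μ / (k + 1) := by positivity
    have h1 : (0 : ℝ) < μ / (k + 1) * t := lt_of_lt_of_le (by positivity) ht
    exact (mul_pos_iff_of_pos_left h0).1 h1
  -- The clusters are treated in a fixed order, each passing its residue to the next; the last one
  -- is divisible because the total is. A cluster loses at most `t + 2 * C` while it is neither
  -- source nor target, then up to `2 * C` as target and `2 * C` as source.
  suffices ∀ j, j < N → ∃ A, H.Matchable A ∧ A₀ ⊆ A ∧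
      A.card ≤ A₀.card + j * (2 * ((k + 1) * C)) ∧
      (∀ Z, (e Z).val < j → (M : ℤ) ∣ ((W Z \ A).card : ℤ)) ∧
      (M : ℤ) ∣ ∑ Z, ((W Z \ A).card : ℤ) ∧
      (∀ Z, j < (e Z).val → (W Z ∩ A).card ≤ t + 2 * C) ∧
      (∀ Z, j = (e Z).val → (W Z ∩ A).card ≤ t + 4 * C) ∧
      ∀ Z, (W Z ∩ A).card ≤ t + 6 * C by
    obtain ⟨A, h1, h2, _, h4, h5, _, _, h8⟩ := this (N - 1) (by omega)
    refine ⟨A, h1, h2, h8, fun X => ?_⟩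
    rw [← Int.natCast_dvd_natCast]
    by_cases hX : (e X).val < N - 1
    · exact h4 X hX
    · rw [← add_sum_erase univ _ (mem_univ X)] at h5
      refine (dvd_add_left (dvd_sum fun Z hZ => h4 Z ?_)).1 h5
      have h6 : (e Z).val ≠ (e X).val := fun h =>
        (mem_erase.1 hZ).1 (e.injective (Fin.ext h))
      have h7 := (e Z).isLt
      have h8 := (e X).isLt
      omega
  intro j
  induction j with
  | zero =>
    intro _
    refine ⟨A₀, hA₀, Subset.rfl, by simp, fun Z hZ => absurd hZ (Nat.not_lt_zero _), ?_,
      fun Z _ => (hload Z).trans (Nat.le_add_right _ _),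
      fun Z _ => (hload Z).trans (Nat.le_add_right _ _),
      fun Z => (hload Z).trans (Nat.le_add_right _ _)⟩
    exact_mod_cast Int.natCast_dvd_natCast.2 hdvd
  | succ j ih =>
    intro hj
    obtain ⟨A, h1, h2, h3, h4, h5, h6, h7, h8⟩ := ih (by omega)
    set X := e.symm ⟨j, by omega⟩ with hX
    set Y := e.symm ⟨j + 1, hj⟩ with hY
    have heX : (e X).val = j := by simp [hX]
    have heY : (e Y).val = j + 1 := by simp [hY]
    have hidx : ∀ Z Z', (e Z).val = (e Z').val → Z = Z' := fun Z Z' h => e.injective (Fin.ext h)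
    set S := univ.filter fun Z => t + 1 ≤ (W Z ∩ A).card with hS
    have hSn : ∀ Z, Z ∉ S → (W Z ∩ A).card ≤ t := by
      intro Z hZ
      by_contra hlt
      exact hZ (mem_filter.2 ⟨mem_univ _, by omega⟩)
    -- The removed set has at most `N * (1 + 2 * (k + 1) * C)` elements in all, so few clusters
    -- carry more than `t`. Avoiding them stops the small losses from accumulating.
    have hSc : (S.card : ℝ) ≤ μ / (k + 1) * N := by
      have e1 : S.card * (t + 1) ≤ A.card := hW.card_mul_le_card A (t + 1)
      have e2 : A.card ≤ N * (1 + 2 * ((k + 1) * C)) := by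
        have : j * (2 * ((k + 1) * C)) ≤ N * (2 * ((k + 1) * C)) :=
          Nat.mul_le_mul_right _ (by omega)
        linarith
      have e3 : S.card * t ≤ N * (1 + 2 * ((k + 1) * C)) :=
        (Nat.mul_le_mul_left _ (Nat.le_succ t)).trans (e1.trans e2)
      have e4 : (S.card : ℝ) * t ≤ N * (1 + 2 * ((k + 1) * C)) := by exact_mod_cast e3
      have e5 : (N : ℝ) * (1 + 2 * ((k + 1) * C)) ≤ N * (μ / (k + 1) * t) :=
        mul_le_mul_of_nonneg_left ht (by positivity)
      refine le_of_mul_le_mul_right ?_ htpos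
      linarith
    obtain ⟨B, p1, p2, p3, p4, p5, p6, p7⟩ := h V H ι W b A S hH hb hW hdeg hSc X Y (by
      intro Z hZ
      have e1 : (W Z ∩ A).card + C ≤ t + 7 * C := by
        rcases hZ with hZ | rfl | rfl
        · have := hSn Z hZ
          omega
        · have := h7 X heX.symm
          omega
        · have := h6 Y (by omega)
          omega
      exact le_trans (by exact_mod_cast e1) htb) ((W X \ A).card : ℤ)
    have hsd : ∀ Z, ((W Z \ (A ∪ B)).card : ℤ) = (W Z \ A).card - (W Z ∩ B).card := fun Z => by
      have := card_sdiff_union_add_card_inter (W Z) p2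
      omega
    have hld : ∀ Z, (W Z ∩ (A ∪ B)).card ≤ (W Z ∩ A).card + (W Z ∩ B).card := fun Z => by
      rw [inter_union_distrib_left]
      exact card_union_le _ _
    have hXY : X ≠ Y := fun h => by
      rw [h] at heX
      omega
    have hother : ∀ Z, Z ≠ X → Z ≠ Y → (W Z ∩ (A ∪ B)).card ≤ max (W Z ∩ A).card (t + 2 * C) := by
      intro Z hZX hZY
      by_cases hZ : Z ∈ S
      · have := hld Z
        rw [p7 Z hZ hZX hZY, card_empty] at this
        exact this.trans (le_max_left _ _)
      · have e1 := hld Z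
        have e2 := hSn Z hZ
        have e3 := p4 Z
        exact le_trans (by omega) (le_max_right _ _)
    refine ⟨A ∪ B, h1.union p1 p2, h2.trans subset_union_left, ?_, ?_, ?_, ?_, ?_, ?_⟩
    · refine (card_union_le _ _).trans ?_
      rw [add_mul, one_mul]
      omega
    · intro Z hZ
      rw [hsd]
      have hp := p5 Z
      have hZY : Z ≠ Y := fun h => by
        rw [h] at hZ
        omega
      by_cases hZX : Z = X
      · rw [if_pos hZX, if_neg hZY, hZX, sub_zero, mul_one] at hp
        rw [hZX]
        exact hp.dvd
      · rw [if_neg hZX, if_neg hZY, sub_zero, mul_zero] at hp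
        have hlt : (e Z).val < j := by
          have : (e Z).val ≠ j := fun h => hZX (hidx _ _ (h.trans heX.symm))
          omega
        exact dvd_sub (h4 Z hlt) (Int.modEq_zero_iff_dvd.1 hp)
    · simp only [hsd]
      rw [sum_sub_distrib]
      refine dvd_sub h5 ?_
      rw [← Int.modEq_zero_iff_dvd]
      -- The two unit terms cancel, so a transfer preserves the total modulo `M`.
      have hs := Int.ModEq.sum (s := univ) fun Z _ => p5 Z
      refine hs.trans ?_
      rw [← mul_sum, sum_sub_distrib]
      simp
    · intro Z hZ
      have hZX : Z ≠ X := fun h => by rw [h] at hZ; omega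
      have hZY : Z ≠ Y := fun h => by rw [h] at hZ; omega
      exact (hother Z hZX hZY).trans (max_le (h6 Z (by omega)) le_rfl)
    · intro Z hZ
      have hZY : Z = Y := hidx _ _ (hZ.symm.trans heY.symm)
      have e1 := hld Z
      have e2 := h6 Z (by omega)
      have e3 := p4 Z
      omega
    · intro Z
      by_cases hZX : Z = X
      · have e1 := hld Z
        have e2 := h7 Z (by rw [hZX, heX])
        have e3 := p4 Z
        omega
      · by_cases hZY : Z = Y
        · have e1 := hld Z
          have e2 := h6 Z (by rw [hZY, heY]; omega)
          have e3 := p4 Z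
          omega
        · exact (hother Z hZX hZY).trans (max_le (h8 Z) (by omega))

/-- A tiling together with a spread-out matchable set leaving parts of suitable size yields a
perfect matching. -/
theorem hasPerfectMatching_of_tiling {m k : ℕ} {V : Type u} [DecidableEq V] {H : MDigraph m V}
    (hH : H.IsFissile) {ι : Type} [Fintype ι] [DecidableEq ι] {W : ι → Fin (k + 1) → Finset V}
    {b Q : ℕ} (hb : 0 < b) (hW : H.IsTiling W b)
    (hQ : ∀ E : Finset (Fin m → Fin (k + 1)), IsGoodPattern E →
      ∃ p : (Fin m → Fin (k + 1)) → ℕ, ∀ i, ∑ e ∈ E, p e * tupleMult i e = Q)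
    {A : Finset V} (hA : H.Matchable A) (hcov : ∀ v ∈ H.vertices, v ∉ A → ∃ t i, v ∈ W t i)
    {x : ℕ} (hrest : ∀ t i, (W t i \ A).card = x * Q) : H.HasPerfectMatching := by
  have hd : ∀ t i t' i', (t, i) ≠ (t', i') → Disjoint (W t i \ A) (W t' i' \ A) :=
    fun t i t' i' h => disjoint_of_subset_left sdiff_subset
      (disjoint_of_subset_right sdiff_subset (hW.clustering.disj (t, i) (t', i') h))
  have htile : ∀ t ∈ (univ : Finset ι), H.Matchable (univ.biUnion fun i => W t i \ A) := by
    intro t _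
    obtain ⟨E, hE, hB⟩ := hW.tile t
    obtain ⟨p, hp⟩ := hQ E hE
    refine hB.matchable hH (fun i => ?_) (fun e => x * p e) (fun i => sdiff_subset) fun i => ?_
    · have hc : (W t i).card = b := hW.clustering.card (t, i)
      exact card_pos.1 (by omega)
    · rw [hrest]
      simp only [mul_assoc]
      rw [← mul_sum, hp]
  have hall := Matchable.biUnion univ _ htile fun t _ t' _ htt => by
    rw [disjoint_biUnion_left]
    intro i _
    rw [disjoint_biUnion_right]
    exact fun i' _ => hd t i t' i' fun h => htt (congrArg Prod.fst h)
  refine Matchable.hasPerfectMatching ?_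
  have heq : H.vertices = A ∪ univ.biUnion fun t => univ.biUnion fun i => W t i \ A := by
    refine Subset.antisymm (fun v hv => ?_) (union_subset hA.subset hall.subset)
    by_cases hvA : v ∈ A
    · exact mem_union_left _ hvA
    · obtain ⟨t, i, h⟩ := hcov v hv hvA
      exact mem_union_right _ (mem_biUnion.2 ⟨t, mem_univ _, mem_biUnion.2
        ⟨i, mem_univ _, mem_sdiff.2 ⟨h, hvA⟩⟩⟩)
  rw [heq]
  refine hA.union hall ?_
  rw [disjoint_biUnion_right]
  intro t _
  rw [disjoint_biUnion_right]
  exact fun i _ => disjoint_sdiff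

/-- Everything reduces to removing matchable sets until each cluster of an almost perfect tiling has
lost exactly `M * j` of its `b = M * g * j` vertices. The factors of `M = (k + 1) * Q * m` serve
different ends: `Q` makes the final parts divisible by `Q`, `k + 1` makes the total load in the last
cover divisible by `k + 1`, and `m` lets whole edges correct the total modulo `M`. -/
theorem hasPerfectMatching_of_goodDegree (m k : ℕ) (hm : 0 < m) (hk : 1 ≤ k) {μ : ℝ} (hμ : 0 < μ)
    (hμ1 : μ ≤ 1) : ∃ n₀ : ℕ, ∀ (V : Type u) [DecidableEq V] (H : MDigraph m V),
      n₀ ≤ H.vertices.card → m ∣ H.vertices.card → H.IsFissile →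
      H.GoodDegree k (matchingThreshold (k + 1) + μ) → H.HasPerfectMatching := by
  classical
  set θ := matchingThreshold (k + 1) with hθ
  have hθ0 : 0 ≤ θ := matchingThreshold_nonneg _
  obtain ⟨Q, hQpos, hQ⟩ := exists_uniform_nat_weights m (k + 1)
  obtain ⟨M, hMdef⟩ : ∃ M, M = (k + 1) * Q * m := ⟨_, rfl⟩
  have hMpos : 0 < M := by rw [hMdef]; positivity
  obtain ⟨C, hC⟩ : ∃ C, C = transferCost m k M := ⟨_, rfl⟩
  obtain ⟨ε, hεdef⟩ : ∃ ε : ℝ, ε = μ / 8 / (2 * (k + 1)) := ⟨_, rfl⟩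
  have hεpos : 0 < ε := by rw [hεdef]; positivity
  have hα : 0 < μ / 8 := by positivity
  have hα1 : μ / 8 ≤ 1 := by linarith
  obtain ⟨ε', hε', N₁, hcover⟩ := exists_cover_of_degree k (half_pos hμ)
  obtain ⟨N₂, hdense⟩ := exists_degree_isDense.{u} k hμ hμ1
  obtain ⟨b₁, hadjust⟩ := exists_residue_adjustment.{u} m k M hMpos hk hα hα1 (half_pos hμ)
  obtain ⟨b₂, hedges⟩ := exists_matchable_of_isDense.{u} m k M hα hα1
  obtain ⟨b₃, _, hblow⟩ := exists_disjoint_blowups.{u} m k Q hQpos hα hα1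
  -- Large `t` leaves few clusters with load above `t` during the adjustment; it must also absorb
  -- the cover and the correcting edges.
  obtain ⟨t₀, ht₀⟩ := exists_nat_ge ((1 + 2 * ((k + 1) * C) : ℝ) / (μ / 2 / (k + 1)))
  rw [div_le_iff₀ (by positivity)] at ht₀
  obtain ⟨t, htdef⟩ : ∃ t, t = t₀ + m + M * m := ⟨_, rfl⟩
  have ht : (1 + 2 * ((k + 1) * C) : ℝ) ≤ μ / 2 / (k + 1) * t := by
    have h1 : (t₀ : ℝ) ≤ t := by exact_mod_cast (by omega : t₀ ≤ t)
    have h2 : (0 : ℝ) ≤ μ / 2 / (k + 1) := by positivity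
    have := mul_le_mul_of_nonneg_right h1 h2
    linarith
  obtain ⟨g, hg⟩ := exists_nat_ge (1 / ε)
  rw [div_le_iff₀ hεpos] at hg
  have hgpos : 0 < g := by
    rcases Nat.eq_zero_or_pos g with h | h
    · rw [h] at hg
      norm_num at hg
    · exact h
  have hmin : 0 < min ε' 1 := lt_min hε' one_pos
  -- With `j` this large, the losses of at most `t + 7 * C` are negligible against `j`, so the loads
  -- `j - l X` below are nearly constant.
  obtain ⟨j₀, hj₀⟩ := exists_nat_ge ((t + 7 * C : ℝ) / min ε' 1)
  rw [div_le_iff₀ hmin] at hj₀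
  obtain ⟨j, hjdef⟩ : ∃ j, j = b₁ + b₂ + b₃ + j₀ + 1 := ⟨_, rfl⟩
  have hj1 : (t + 7 * C : ℝ) ≤ j * min ε' 1 := by
    have h1 : (j₀ : ℝ) ≤ j := by exact_mod_cast (by omega : j₀ ≤ j)
    exact hj₀.trans (mul_le_mul_of_nonneg_right h1 hmin.le)
  have hjε : (t + 7 * C : ℝ) ≤ ε' * j := by
    have : (j : ℝ) * min ε' 1 ≤ j * ε' :=
      mul_le_mul_of_nonneg_left (min_le_left _ _) (by positivity)
    linarith
  have hjj : t + 7 * C ≤ j := by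
    have h1 : (j : ℝ) * min ε' 1 ≤ j * 1 :=
      mul_le_mul_of_nonneg_left (min_le_right _ _) (by positivity)
    have h2 : (t + 7 * C : ℝ) ≤ j := by linarith
    exact_mod_cast h2
  have hjM : j ≤ M * j := Nat.le_mul_of_pos_left j hMpos
  obtain ⟨b, hbdef⟩ : ∃ b, b = M * g * j := ⟨_, rfl⟩
  have hMjb : M * j ≤ b := by
    rw [hbdef, mul_right_comm]
    exact Nat.le_mul_of_pos_right _ hgpos
  have hbpos : 0 < b := by omega
  have hMjε : ((M * j : ℕ) : ℝ) ≤ ε * b := by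
    rw [hbdef]
    push_cast
    have h1 : (0 : ℝ) ≤ (M : ℝ) * j := by positivity
    have := mul_le_mul_of_nonneg_left hg h1
    linarith
  have htε : (t + 7 * C : ℝ) ≤ ε * b := by
    refine le_trans ?_ hMjε
    exact_mod_cast hjj.trans hjM
  obtain ⟨η₁, hη₁, n₁, hleft⟩ := exists_matchable_cover.{u} m k hm hθ0 hμ hμ1 b
  -- The three bounds serve the covering of leftovers, the reduced degrees, and the estimate that
  -- the cover has at most `N / 2` vertices.
  obtain ⟨η, hηdef⟩ : ∃ η, η = min η₁ (min (μ / (8 * (k + 1))) (1 / (4 * b * m))) := ⟨_, rfl⟩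
  have hηpos : 0 < η := by
    rw [hηdef]
    refine lt_min hη₁ (lt_min ?_ ?_) <;> positivity
  have hηη₁ : η ≤ η₁ := hηdef ▸ min_le_left _ _
  have hη2 : η ≤ μ / (8 * (k + 1)) := hηdef ▸ (min_le_right _ _).trans (min_le_left _ _)
  have hη3 : η ≤ 1 / (4 * b * m) := hηdef ▸ (min_le_right _ _).trans (min_le_right _ _)
  have hη4 : η ≤ 1 / 2 := by
    refine hη2.trans ?_
    rw [div_le_div_iff₀ (by positivity) (by positivity)]
    have : (0 : ℝ) ≤ k := by positivity
    linarith
  rw [le_div_iff₀ (by positivity)] at hη3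
  obtain ⟨n₂, htile⟩ := tilingProportion.{u} m k hμ hμ1 hηpos b hbpos
  refine ⟨n₁ + n₂ + 2 * (b * (N₁ + N₂ + 2 * (M * m) + 1)), fun V _ H hn hmn hH hdeg => ?_⟩
  obtain ⟨n, hndef⟩ : ∃ n, n = H.vertices.card := ⟨_, rfl⟩
  rw [← hndef] at hn hmn
  obtain ⟨ι, _, _, W, hW, hWc⟩ := htile V H (by omega) hdeg
  rw [← hndef] at hWc
  have hCl := hW.clustering
  obtain ⟨w, hw⟩ : ∃ w : ι × Fin (k + 1) → Finset V, w = fun p => W p.1 p.2 := ⟨_, rfl⟩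
  rw [← hw] at hCl
  obtain ⟨N, hNdef⟩ : ∃ N, N = Fintype.card (ι × Fin (k + 1)) := ⟨_, rfl⟩
  have hNι : N = Fintype.card ι * (k + 1) := by rw [hNdef, Fintype.card_prod, Fintype.card_fin]
  have hNb : (1 - η) * n ≤ (N : ℝ) * b := by
    rw [hNι]
    push_cast
    linarith
  have hN2 : n ≤ 2 * (b * N) := by
    have h0 : (0 : ℝ) ≤ n := by positivity
    have h1 : 1 / 2 * (n : ℝ) ≤ (1 - η) * n := mul_le_mul_of_nonneg_right (by linarith) h0
    have h2 : (n : ℝ) ≤ 2 * (b * N) := by linarith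
    exact_mod_cast h2
  have hNbig : N₁ + N₂ + 2 * (M * m) + 1 ≤ N := by
    have h1 : b * (N₁ + N₂ + 2 * (M * m) + 1) ≤ b * N := by omega
    exact Nat.le_of_mul_le_mul_left h1 hbpos
  have hUsub : univ.biUnion w ⊆ H.vertices := biUnion_subset.2 fun X _ => hCl.subset X
  have hLc : ((H.vertices \ univ.biUnion w).card : ℝ) ≤ η * n := by
    rw [cast_card_sdiff hUsub, hCl.card_biUnion, ← hNdef, ← hndef]
    push_cast
    linarith
  obtain ⟨A₁, a1, a2, a3, a4⟩ := hleft V H _ w (by omega) hH hdeg hCl (hLc.trans (by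
    rw [← hndef]
    exact mul_le_mul_of_nonneg_right hηη₁ (by positivity)))
  have hdeg' := hdense m V H _ w b θ hθ0 hbpos hCl (by omega) hdeg (by
    rw [← hndef, ← hNdef]
    refine le_trans (mul_le_mul_of_nonneg_right ?_ (by positivity)) hNb
    linarith)
  -- adjust the total number of remaining vertices
  have hNpos : 0 < Fintype.card (ι × Fin (k + 1)) := by omega
  obtain ⟨X₀⟩ := Fintype.card_pos_iff.1 hNpos
  obtain ⟨y₀, hy₀⟩ : ∃ y : Fin k → ι × Fin (k + 1),
      H.IsDense w b (μ / 8) (Fin.cons X₀ y : Fin (k + 1) → ι × Fin (k + 1)) := by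
    have h1 := hdeg' X₀
    have h2 : (0 : ℝ) < Fintype.card (ι × Fin (k + 1)) := by exact_mod_cast hNpos
    have h3 : (0 : ℝ) < (θ + μ / 2) * (Fintype.card (ι × Fin (k + 1)) : ℝ) ^ k := by positivity
    obtain ⟨y, hy⟩ := card_pos.1 (Nat.cast_pos.1 (h3.trans_le h1))
    exact ⟨y, (mem_filter.1 hy).2⟩
  -- A multiple `q * m` of vertices remains. Removing `q % M` further edges makes the remainder a
  -- multiple of `M`.
  obtain ⟨q, hq⟩ : m ∣ n - A₁.card := Nat.dvd_sub hmn a1.dvd_card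
  have hA₁n : A₁.card ≤ n := hndef ▸ card_le_card a1.subset
  obtain ⟨B, c1, c2, c3⟩ := hedges V H _ w b _ A₁ hH (by omega) hCl hy₀ (fun i => by
    rw [← hεdef]
    refine le_trans ?_ htε
    have h1 := a4 ((Fin.cons X₀ y₀ : Fin (k + 1) → ι × Fin (k + 1)) i)
    exact_mod_cast h1.trans (by omega : m ≤ t + 7 * C)) (q % M) (Nat.mod_lt _ hMpos).le
  have hBc : B.card ≤ M * m := by
    rw [c3]
    exact Nat.mul_le_mul_right _ (Nat.mod_lt _ hMpos).le
  have hA₂ := a1.union c1 c2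
  have hA₂c : (A₁ ∪ B).card = A₁.card + B.card := card_union_of_disjoint c2
  have hA₂load : ∀ X, (w X ∩ (A₁ ∪ B)).card ≤ t := by
    intro X
    rw [inter_union_distrib_left]
    refine (card_union_le _ _).trans ?_
    have h1 := a4 X
    have h2 := (card_le_card (inter_subset_right (s₁ := w X) (s₂ := B))).trans hBc
    omega
  have hA₂N : (A₁ ∪ B).card ≤ N := by
    have h1 : 2 * (m * (H.vertices \ univ.biUnion w).card) ≤ N := by
      have h2 : (4 * b * m : ℝ) * (H.vertices \ univ.biUnion w).card ≤ n := by
        have h3 := mul_le_mul_of_nonneg_left hLc (by positivity : (0 : ℝ) ≤ 4 * b * m)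
        have h4 := mul_le_mul_of_nonneg_right hη3 (by positivity : (0 : ℝ) ≤ n)
        linarith
      have h3 : 4 * b * m * (H.vertices \ univ.biUnion w).card ≤ n := by exact_mod_cast h2
      refine Nat.le_of_mul_le_mul_left (c := 2 * b) ?_ (by omega)
      have h4 : 2 * b * (2 * (m * (H.vertices \ univ.biUnion w).card)) =
        4 * b * m * (H.vertices \ univ.biUnion w).card := by ring
      have h5 : 2 * b * N = 2 * (b * N) := by ring
      omega
    omega
  have hcovA : ∀ A, A₁ ⊆ A → ∀ v ∈ H.vertices, v ∉ A → ∃ t i, v ∈ W t i := by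
    intro A hA v hv hvA
    by_contra hne
    refine hvA (hA (a2 (mem_sdiff.2 ⟨hv, fun h => hne ?_⟩)))
    obtain ⟨p, _, hp⟩ := mem_biUnion.1 h
    rw [hw] at hp
    exact ⟨p.1, p.2, hp⟩
  have hsumA₂ : M ∣ ∑ X, (w X \ (A₁ ∪ B)).card := by
    have h1 : H.vertices \ (A₁ ∪ B) = univ.biUnion fun X => w X \ (A₁ ∪ B) := by
      ext v
      simp only [mem_sdiff, mem_biUnion, mem_univ, true_and]
      constructor
      · rintro ⟨h1, h2⟩
        obtain ⟨s, i, h⟩ := hcovA _ subset_union_left v h1 h2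
        exact ⟨(s, i), by rw [hw]; exact h, h2⟩
      · rintro ⟨X, h1, h2⟩
        exact ⟨hCl.subset X h1, h2⟩
    have h2 : (H.vertices \ (A₁ ∪ B)).card = ∑ X, (w X \ (A₁ ∪ B)).card := by
      rw [h1, card_biUnion]
      exact fun X _ Y _ h => disjoint_of_subset_left sdiff_subset
        (disjoint_of_subset_right sdiff_subset (hCl.disj X Y h))
    rw [← h2, card_sdiff_of_subset hA₂.subset, hA₂c, ← hndef, c3]
    have h3 : n - (A₁.card + q % M * m) = M * (q / M * m) := by
      have h4 := Nat.div_add_mod q M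
      have h5 : m * q = M * (q / M * m) + q % M * m := by
        conv_lhs => rw [← h4]
        ring
      omega
    exact ⟨_, h3⟩
  -- make the remaining parts of all clusters divisible by `M`
  obtain ⟨A, e1, e2, e3, e4⟩ := hadjust V H _ w b t (A₁ ∪ B) hH (by omega) hCl
    (fun X => by convert hdeg' X) hA₂ hA₂load (by rw [← hNdef]; exact hA₂N)
    (by rw [← hC]; exact ht) (by rw [← hC, ← hεdef]; exact htε) hsumA₂
  rw [← hC] at e3
  have hl : ∀ X, ∃ l, (w X ∩ A).card = M * l := by
    intro X
    have h1 := card_sdiff_add_card_inter (w X) A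
    rw [hCl.card] at h1
    have h2 : M ∣ b := ⟨g * j, by rw [hbdef, mul_assoc]⟩
    rw [← h1] at h2
    exact (Nat.dvd_add_right (e4 X)).1 h2
  choose l hl using hl
  have hlt : ∀ X, l X ≤ t + 7 * C := by
    intro X
    have h1 := e3 X
    rw [hl] at h1
    have h2 : l X ≤ M * l X := Nat.le_mul_of_pos_left _ hMpos
    omega
  have hlj : ∀ X, l X ≤ j := fun X => (hlt X).trans hjj
  -- balance the clusters
  obtain ⟨J, _, _, τ, hτ, hτc⟩ := hcover (ι × Fin (k + 1)) (fun s => H.IsDense w b (μ / 8) s)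
    (fun X => (k + 1) * m * (j - l X)) ((k + 1) * m * j) (by omega) (fun s hs => hs.1)
    (Nat.mul_pos (by positivity) (by omega)) (fun X => by convert hdeg' X)
    (fun X => Nat.mul_le_mul_left _ (Nat.sub_le _ _))
    (fun X => by
      push_cast
      rw [Nat.cast_sub (hlj X), mul_left_comm]
      refine mul_le_mul_of_nonneg_left ?_ (by positivity)
      have h1 : (l X : ℝ) ≤ t + 7 * C := by exact_mod_cast hlt X
      linarith)
    (dvd_sum fun X _ => (dvd_mul_right (k + 1) m).mul_right _)
  -- A cluster that has lost `M * l X` vertices loses `M * (j - l X)` more to blow-ups with parts of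
  -- size `Q`, so all losses become equal.
  have hbal : ∀ X, M * l X + Q * ((k + 1) * m * (j - l X)) = M * j := by
    intro X
    have h1 : Q * ((k + 1) * m * (j - l X)) = M * (j - l X) := by rw [hMdef]; ring
    rw [h1, ← mul_add, Nat.add_sub_cancel' (hlj X)]
  obtain ⟨K, f1, f2, f3, f4⟩ := hblow V H _ w b A J τ (by omega) hCl hτ fun X => by
    rw [hτc X, hl X, ← hεdef]
    refine le_trans (le_of_eq ?_) hMjε
    exact_mod_cast hbal X
  have hAK : Disjoint A (univ.biUnion K) := by
    rw [disjoint_biUnion_right]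
    exact fun p _ => disjoint_of_subset_right (f1 p) disjoint_sdiff
  have hKeq : univ.biUnion K = univ.biUnion fun s : J => univ.biUnion fun i => K (s, i) := by
    ext v
    simp
  have hKm : H.Matchable (univ.biUnion K) := by
    rw [hKeq]
    refine Matchable.biUnion _ _ (fun s _ => ?_) fun s _ s' _ hss => ?_
    · obtain ⟨E, hE, hKE⟩ := f3 s
      obtain ⟨p, hp⟩ := hQ E hE
      exact hKE.matchable hH (fun i => card_pos.1 (by rw [f2]; exact hQpos)) p
        (fun i => Subset.rfl) fun i => by rw [f2, hp]
    · rw [disjoint_biUnion_left]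
      intro i _
      rw [disjoint_biUnion_right]
      exact fun i' _ => f4 _ _ fun h => hss (congrArg Prod.fst h)
  -- Each part keeps `b - M * j = M * (g - 1) * j` vertices, a multiple of `Q`.
  refine hasPerfectMatching_of_tiling hH hbpos hW hQ (e1.union hKm hAK)
    (hcovA _ (subset_union_left.trans (e2.trans subset_union_left)))
    (x := (k + 1) * m * ((g - 1) * j)) fun s i => ?_
  have h1 := card_sdiff_union_add_card_inter (w (s, i)) hAK
  rw [card_inter_biUnion_eq hCl (fun p => (f1 p).trans sdiff_subset) f2 f4, hτc] at h1
  have h2 := card_sdiff_add_card_inter (w (s, i)) A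
  rw [hCl.card, hl] at h2
  have h3 := hbal (s, i)
  have h4 : (k + 1) * m * ((g - 1) * j) * Q + M * j = b := by
    obtain ⟨g', rfl⟩ : ∃ g', g = g' + 1 := ⟨g - 1, by omega⟩
    rw [hbdef, hMdef, Nat.add_sub_cancel]
    ring
  have h5 : W s i = w (s, i) := by rw [hw]
  rw [h5]
  omega

end MDigraph

theorem mainTheorem1 (m s : ℕ) (hm : 2 ≤ m) (hms : m ≤ s) (μ : ℝ) (hμ : 0 < μ) :
    ∃ n₀ : ℕ, 0 < n₀ ∧ ∀ (V : Type*) [DecidableEq V] (H : MDigraph m V) (n : ℕ),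
      H.vertices.card = n → n₀ ≤ n → m ∣ n → H.IsFissile →
      (matchingThreshold s + μ) * ((n - 1).choose (s - 1) : ℝ) ≤
        ((H.propertyGraph (MDigraph.Spa m V ∩ MDigraph.Div m V ∩ MDigraph.Cov m V) s).minDegree 1 : ℝ) →
      H.HasPerfectMatching := by
  obtain ⟨k, rfl⟩ : ∃ k, s = k + 1 := ⟨s - 1, by omega⟩
  -- The density estimates assume error terms of at most 1, and lowering `μ` only weakens the degree
  -- condition. Half of the error is spent on passing from sets to ordered tuples.
  have hμ' : 0 < min μ 1 := lt_min hμ one_pos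
  obtain ⟨n₁, hn₁, h₁⟩ := MDigraph.exists_goodDegree (m := m) k (by omega) hμ'
  obtain ⟨n₂, h₂⟩ := MDigraph.hasPerfectMatching_of_goodDegree m k (by omega) (by omega)
    (half_pos hμ') (by linarith [min_le_right μ 1])
  refine ⟨n₁ + n₂, by omega, fun V _ H n hn hle hmn hH hdeg => ?_⟩
  subst hn
  refine h₂ V H (by omega) hmn hH (h₁ V H (by omega) (le_trans ?_ hdeg))
  rw [Nat.add_sub_cancel]
  exact mul_le_mul_of_nonneg_right (by linarith [min_le_left μ 1]) (by positivity)
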